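/- Let $dA=dx\,dy/\pi$ and $\Delta=\partial\bar\partial$ (one quarter of the usual Laplacian). Let $Q:\mathbb C\to\mathbb R\cup\{+\infty\}$ be lower semicontinuous, put $\Sigma=\{Q<+\infty\}$, and suppose that $\operatorname{Int}\Sigma$ is dense in $\Sigma$, that $Q$ is real-analytic on $\operatorname{Int}\Sigma$, and that $\liminf_{\zeta\to\infty}Q(\zeta)/\log|\zeta|^2>1$. Let the droplet $S$ be the support of the equilibrium measure of $Q$, i.e. of the minimizer of $$I_Q[\mu]=\iint\log\frac1{|\zeta-\eta|}\,d\mu(\zeta)\,d\mu(\eta)+\int Q\,d\mu$$ among compactly supported Borel probability measures $\mu$ on $\mathbb C$. Suppose that $S\subset\operatorname{Int}\Sigma$, that $S$ is connected, and that every point $q$ of the outer boundary $\Gamma=\partial\operatorname{Pc}S$ is regular; here $\operatorname{Pc}S$ is the union of $S$ and the bounded components of $\mathbb C\setminus S$, and $q$ is regular if near $q$ the set $S$ is one side $\{g\le 0\}$ of a real-analytic arc $\{g=0\}$, with $g$ real-analytic, $g(q)=0$, $\nabla g(q)\ne0$. Suppose finally that $Q$ is radially symmetric, i.e. $Q(\zeta)$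 depends only on $|\zeta-a|$ for some $a\in\mathbb C$. Let $Q^S=Q$ on $S$ and $Q^S=+\infty$ on $\mathbb C\setminus S$. For $n\ge1$ let $\mathbb P_n$ be the probability measure on $\mathbb C^n$ whose density with respect to $dA^{\otimes n}$ is proportional to $e^{-H_n}$, where $$H_n(\zeta_1,\dots,\zeta_n)=\sum_{j\ne k}\log\frac1{|\zeta_j-\zeta_k|}+n\sum_{j=1}^nQ^S(\zeta_j),$$ and let $\mathbf R_n$ be its one-point function, i.e. $n$ times the density with respect to $dA$ of the distribution of $\zeta_1$ (obtained by integrating out $\zeta_2,\dots,\zeta_n$). Let $p\in\Gamma$ be a point with $\Delta Q(p)>0$, let $u$ be the outward unit normal to $\Gamma$ at $p$ (as a complex number of modulus one), and put $$R_n(z)=\frac1{n\Delta Q(p)}\,\mathbf R_n\Big(p+\frac{u\,z}{\sqrt{n\Delta Q(p)}}\Big),\qquad z\in\mathbb C.$$ Let $\gamma(x)=\frac1{\sqrt{2\pi}}e^{-x^2/2}$, $\varphi=\gamma*\mathbf 1_{(-\infty,0)}$, $H=\gamma*\big(\mathbf 1_{(-\infty,0)}/\varphi\big)$ on $\mathbb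 R$, and $R(z)=H(z+\bar z)\,\mathbf 1_{\{\operatorname{Re}z<0\}}$. Then the functions $R_n$ are bounded on $\mathbb C$ uniformly in $n$, $R_n\to R$ almost everywhere on $\mathbb C$, and $R_n\to R$ locally uniformly on $\mathbb C\setminus i\mathbb R$. -/

import Mathlib

open MeasureTheory Filter Topology Set

noncomputable section

namespace HardEdge

/-- Area measure on the plane, normalized so that the unit disc has measure one. -/
def dA : Measure ℂ := (ENNReal.ofReal Real.pi)⁻¹ • volume

/-- The finiteness set `{Q < +∞}` of an external potential. -/
def finiteSet (Q : ℂ → EReal) : Set ℂ := {ζ | Q ζ < ⊤}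

/-- Admissible external potentials `Q : ℂ → ℝ ∪ {+∞}`. -/
structure IsAdmissible (Q : ℂ → EReal) : Prop where
  ne_bot : ∀ ζ, Q ζ ≠ ⊥
  dense_interior : finiteSet Q ⊆ closure (interior (finiteSet Q))
  lsc : LowerSemicontinuous Q
  analytic : AnalyticOnNhd ℝ (fun ζ => (Q ζ).toReal) (interior (finiteSet Q))
  growth : 1 < liminf (fun ζ : ℂ => Q ζ / ((Real.log (‖ζ‖ ^ 2) : ℝ) : EReal)) (cocompact ℂ)

/-- `Q` depends only on the distance to the point `a`. -/
def IsRadialAbout (Q : ℂ → EReal) (a : ℂ) : Prop :=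
  ∀ ζ η : ℂ, ‖ζ - a‖ = ‖η - a‖ → Q ζ = Q η

/-- `∂∂̄ Q`, one quarter of the usual Laplacian. -/
def quarterLaplacian (Q : ℂ → EReal) (ζ : ℂ) : ℝ :=
  (1 / 4) * Laplacian.laplacian (fun w : ℂ => (Q w).toReal) ζ

/-- The integral of an extended real function, as the integral of the positive part minus
the integral of the negative part (it is used only where the latter is finite). -/
def extIntegral {α : Type*} [MeasurableSpace α] (μ : Measure α) (f : α → EReal) : EReal :=
  ((∫⁻ x, (f x).toENNReal ∂μ : ENNReal) : EReal) - ((∫⁻ x, (-f x).toENNReal ∂μ : ENNReal) : EReal)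

/-- `log (1 / |ζ - η|)`, equal to `+∞` on the diagonal. -/
def logKernel (ζ η : ℂ) : EReal := -ENNReal.log ‖ζ - η‖ₑ

/-- The weighted logarithmic energy `I_Q[μ]`. -/
def weightedEnergy (Q : ℂ → EReal) (μ : Measure ℂ) : EReal :=
  extIntegral (μ.prod μ) (fun x => logKernel x.1 x.2) + extIntegral μ Q

/-- Compactly supported Borel probability measures on the plane. -/
def IsCompactProb (μ : Measure ℂ) : Prop :=
  IsProbabilityMeasure μ ∧ ∃ K : Set ℂ, IsCompact K ∧ μ Kᶜ = 0

/-- `σ` is an equilibrium measure in the external potential `Q`. -/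
def IsEquilibriumMeasure (Q : ℂ → EReal) (σ : Measure ℂ) : Prop :=
  IsCompactProb σ ∧ ∀ μ : Measure ℂ, IsCompactProb μ → weightedEnergy Q σ ≤ weightedEnergy Q μ

/-- `S` is the droplet in potential `Q`: the support of the equilibrium measure. -/
def IsDroplet (Q : ℂ → EReal) (S : Set ℂ) : Prop :=
  ∃ σ : Measure ℂ, IsEquilibriumMeasure Q σ ∧ S = σ.support

/-- The polynomially convex hull: the union of `S` and the bounded components of `ℂ \ S`. -/
def polyHull (S : Set ℂ) : Set ℂ :=
  S ∪ {ζ | ζ ∉ S ∧ Bornology.IsBounded (connectedComponentIn Sᶜ ζ)}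

/-- The outer boundary of `S`. -/
def outerBoundary (S : Set ℂ) : Set ℂ := frontier (polyHull S)

/-- `g` is a real-analytic local defining function of `S` at the boundary point `p`: near `p`, the
set `S` is the side `g ≤ 0` of the smooth real-analytic arc `g = 0`. -/
structure IsLocalDefiningFunction (S : Set ℂ) (p : ℂ) (g : ℂ → ℝ) : Prop where
  analytic : AnalyticAt ℝ g p
  zero : g p = 0
  gradient_ne_zero : gradient g p ≠ 0
  mem_iff : ∀ᶠ ζ in 𝓝 p, ζ ∈ S ↔ g ζ ≤ 0

/-- Regular boundary points (neither cusps nor double points). -/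
def IsRegularPoint (S : Set ℂ) (p : ℂ) : Prop := ∃ g, IsLocalDefiningFunction S p g

/-- The unit vector `u` is the outward normal to `S` at the regular boundary point `p`. -/
def IsOutwardUnitNormal (S : Set ℂ) (p u : ℂ) : Prop :=
  ‖u‖ = 1 ∧ ∃ (g : ℂ → ℝ) (c : ℝ), IsLocalDefiningFunction S p g ∧ 0 < c ∧ gradient g p = c • u

open Classical in
/-- The localized potential `Q + ∞ · 1_{ℂ \ S}`. -/
def localized (Q : ℂ → EReal) (S : Set ℂ) (ζ : ℂ) : EReal := if ζ ∈ S then Q ζ else ⊤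

/-- `H_n(ζ₁, …, ζₙ) = ∑_{j ≠ k} log (1 / |ζ_j - ζ_k|) + n ∑_j V (ζ_j)`, the first sum being over
ordered pairs. -/
def hamiltonian (V : ℂ → EReal) (n : ℕ) (ζ : Fin n → ℂ) : EReal :=
  (∑ j, ∑ k ∈ Finset.univ.erase j, logKernel (ζ j) (ζ k)) + (n : EReal) * ∑ j, V (ζ j)

/-- The partition function. -/
def partitionFunction (V : ℂ → EReal) (n : ℕ) : ENNReal :=
  ∫⁻ ζ : Fin n → ℂ, EReal.exp (-hamiltonian V n ζ) ∂(Measure.pi fun _ => dA)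

/-- The density, with respect to the product of the normalized area measures, of the Gibbs
measure `e^{-H_n}` normalized to total mass one. -/
def gibbsDensity (V : ℂ → EReal) (n : ℕ) (ζ : Fin n → ℂ) : ENNReal :=
  (partitionFunction V n)⁻¹ * EReal.exp (-hamiltonian V n ζ)

/-- The one-point function of the `n`-point ensemble: `n` times the density of one particle
(the Gibbs density is symmetric, so it does not matter of which one). -/
def onePoint (V : ℂ → EReal) : ℕ → ℂ → ℝ
  | 0, _ => 0
  | m + 1, ζ => (((m + 1 : ℕ) : ENNReal) *
      ∫⁻ η : Fin m → ℂ, gibbsDensity V (m + 1) (Fin.cons ζ η) ∂(Measure.pi fun _ => dA)).toReal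

/-- The one-point function of the hard edge ensemble, rescaled about the boundary point `p` by the
factor `√(n ∂∂̄Q(p))`, in coordinates in which `p` is the origin and the unit vector `u` points in
the positive real direction. -/
def rescaledOnePoint (Q : ℂ → EReal) (S : Set ℂ) (p u : ℂ) (n : ℕ) (z : ℂ) : ℝ :=
  (n * quarterLaplacian Q p)⁻¹ *
    onePoint (localized Q S) n (p + u * (z / (Real.sqrt (n * quarterLaplacian Q p) : ℂ)))

/-- The Gaussian kernel. -/
def gaussKernel (x : ℝ) : ℝ := (Real.sqrt (2 * Real.pi))⁻¹ * Real.exp (-x ^ 2 / 2)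

/-- Convolution with the Gaussian kernel. -/
def gaussConv (g : ℝ → ℝ) (x : ℝ) : ℝ := ∫ t, gaussKernel (x - t) * g t

/-- The free boundary function `φ = γ * 1_{(-∞,0)}`. -/
def freeBoundary (x : ℝ) : ℝ := gaussConv (indicator (Iio 0) 1) x

/-- The hard edge plasma function `H = γ * (1_{(-∞,0)} / φ)`. -/
def plasma (x : ℝ) : ℝ := gaussConv (fun t => indicator (Iio 0) 1 t / freeBoundary t) x

/-- The limiting one-point function `H(z + z̄) · 1_{Re z < 0}`. -/
def limitOnePoint (z : ℂ) : ℝ :=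
  plasma (z + (starRingEnd ℂ) z).re * indicator {w : ℂ | w.re < 0} 1 z

end HardEdge

end

/-! Radial symmetry reduces everything to one real variable. The logarithmic kernel is a
superposition of Gaussian kernels (a Frullani integral), and the Gaussian energy of a difference of
probability measures is a weighted L² norm of its Fourier transform, so the logarithmic energy is
strictly positive definite on such differences. The equilibrium measure and its rotations about `a`
have equal energy; positive definiteness and the first variation force them to coincide
(`map_rotAbout_eq`). Testing minimality against uniform measures on circles then gives Frostman's
conditions (`exists_frostman`): Q minus twice the radial potential is at least a constant, with
equality on S off the centre. Being compact, connected and rotation invariant, S is a closed annulus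
or disc, and regularity at p makes it nondegenerate.

In the coordinate t = log(|ζ - a|/ρ), with ρ the outer radius, the potential becomes a function ψ.
By Frostman's conditions m = ψ'/2 is nondecreasing on the droplet (the radial potential is convex in
t), equals 1 at the outer edge t = 0 and vanishes at the inner edge if there is one. Its left
derivative at 0 is 2D with D = ρ²ΔQ(p). These facts are collected in `IsEdgeProfile`.

The monomials (ζ - a)^j are orthogonal for the weight e^{-nQ} on S, so expanding the Vandermonde
determinant gives the one-point function as an explicit sum (`onePoint_eq_sum`). With N = n e^{2x},
the j-th term at x is at most a constant times e^{-2x} √N / (1 + (j + 1 - n m(x))²/N): the norm in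
its denominator is bounded below by integrating over a short interval on which the exponent hardly
falls, or rises linearly (`exists_div_edgeNorm_le`). Summing this Lorentzian gives the uniform
bound, and the same estimate dominates the sum near the edge.

For the limit put j = n - k, κ = k/√n and s = √n t. The sum over k is exactly the integral of a step
function of κ. By Laplace's method at the endpoint each rescaled norm tends to a half-line Gaussian
integral (`tendsto_sqrt_mul_edgeNorm`), and dominated convergence yields ∫_{κ>0} e^{-2κξ-2Dξ²} /
(∫_{s<0} 2e^{-2κs-2Ds²} ds) dκ, which is D·H(2√D ξ) after completing squares
(`integral_profile_eq_plasma`). Convergence is established jointly in n and the point, which is what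
makes it locally uniform off the imaginary axis; outside S the one-point function vanishes. -/

open MeasureTheory Filter Topology Set

noncomputable section

namespace HardEdge

/-! ### Positive definiteness of Gaussian kernels -/

/-- The Gaussian interaction energy of two measures on the plane. -/
def gaussEnergy (t : ℝ) (μ ν : Measure ℂ) : ℝ := ∫ x : ℂ × ℂ, Real.exp (-t * ‖x.1 - x.2‖ ^ 2) ∂(μ.prod ν)

lemma integrable_exp_neg_mul_norm_sq {b : ℝ} (hb : 0 < b) :
    Integrable (fun ξ : ℂ => Real.exp (-b * ‖ξ‖ ^ 2)) := by
  have h := GaussianFourier.integrable_cexp_neg_mul_sq_norm_add (V := ℂ) (b := (b : ℂ))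
    (by simpa using hb) 0 0
  refine (h.norm).congr (Eventually.of_forall fun ξ => ?_)
  simp only [Complex.norm_exp]
  congr 1
  rw [← Complex.ofReal_pow, ← Complex.ofReal_neg, zero_mul, add_zero, ← Complex.ofReal_mul,
    Complex.ofReal_re]

lemma integrable_exp_neg_mul_norm_sub_sq {t : ℝ} (ht : 0 ≤ t) (μ ν : Measure ℂ)
    [IsFiniteMeasure μ] [IsFiniteMeasure ν] :
    Integrable (fun x : ℂ × ℂ => Real.exp (-t * ‖x.1 - x.2‖ ^ 2)) (μ.prod ν) := by
  refine Integrable.of_bound (C := 1) (by fun_prop) (Eventually.of_forall fun x => ?_)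
  rw [Real.norm_of_nonneg (Real.exp_pos _).le, Real.exp_le_one_iff]
  nlinarith [mul_nonneg ht (sq_nonneg ‖x.1 - x.2‖)]

/-- Fubini, and the fact that the Fourier transform of a Gaussian is a Gaussian. The exponents b and
1/(4b) are dual. -/
lemma integral_gauss_mul_charFun {b : ℝ} (hb : 0 < b) (μ ν : Measure ℂ)
    [IsProbabilityMeasure μ] [IsProbabilityMeasure ν] :
    ∫ ξ : ℂ, (Real.exp (-b * ‖ξ‖ ^ 2) : ℂ) * (charFun μ ξ * (starRingEnd ℂ) (charFun ν ξ)) =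
      ((Real.pi / b * gaussEnergy (1 / (4 * b)) μ ν : ℝ) : ℂ) := by
  have h1 : ∀ ξ : ℂ, charFun μ ξ * (starRingEnd ℂ) (charFun ν ξ) =
      ∫ x : ℂ × ℂ, Complex.exp ((inner ℝ (x.1 - x.2) ξ : ℝ) * Complex.I) ∂(μ.prod ν) := by
    intro ξ
    rw [charFun_apply, charFun_apply, ← integral_conj, ← integral_prod_mul]
    congr 1 with x
    rw [← Complex.exp_conj, ← Complex.exp_add]
    congr 1
    simp only [map_mul, Complex.conj_ofReal, Complex.conj_I, inner_sub_left]
    push_cast; ring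
  simp_rw [h1, ← integral_const_mul]
  rw [integral_integral_swap]
  · have h2 : ∀ x : ℂ × ℂ, ∫ ξ : ℂ, (Real.exp (-b * ‖ξ‖ ^ 2) : ℂ) *
        Complex.exp ((inner ℝ (x.1 - x.2) ξ : ℝ) * Complex.I) =
        ((Real.pi / b * Real.exp (-(1 / (4 * b)) * ‖x.1 - x.2‖ ^ 2) : ℝ) : ℂ) := by
      intro x
      have := GaussianFourier.integral_cexp_neg_mul_sq_norm_add (V := ℂ) (b := (b : ℂ))
        (by simpa using hb) Complex.I (x.1 - x.2)
      have h3 : ((Module.finrank ℝ ℂ : ℂ) / 2) = 1 := by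
        rw [Complex.finrank_real_complex]; norm_num
      rw [h3, Complex.cpow_one] at this
      push_cast
      convert this using 2
      · congr 1 with ξ
        rw [← Complex.exp_add]
        congr 1; ring
      · rw [Complex.I_sq]
        congr 1; ring
    simp_rw [h2, gaussEnergy]
    rw [integral_complex_ofReal, integral_const_mul]
  · have := (integrable_exp_neg_mul_norm_sq hb).mul_prod
      (integrable_const (1 : ℝ) (μ := μ.prod ν))
    refine this.mono' (Continuous.aestronglyMeasurable (by fun_prop)) (Eventually.of_forall fun x => ?_)
    simp only [Function.uncurry, norm_mul]
    rw [Complex.norm_exp_ofReal_mul_I, Complex.norm_real, Real.norm_of_nonneg (Real.exp_pos _).le]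

lemma gaussEnergy_comm (t : ℝ) (μ ν : Measure ℂ) [IsProbabilityMeasure μ] [IsProbabilityMeasure ν] :
    gaussEnergy t μ ν = gaussEnergy t ν μ := by
  unfold gaussEnergy
  rw [← integral_prod_swap]
  simp [norm_sub_rev]

/-- Plancherel for the signed measure μ - ν: expanding the square leaves four instances of
`integral_gauss_mul_charFun`. The left side is visibly nonnegative, and zero only if the
characteristic functions agree almost everywhere. -/
lemma integral_gauss_mul_normSq_charFun_sub {b : ℝ} (hb : 0 < b) (μ ν : Measure ℂ)
    [IsProbabilityMeasure μ] [IsProbabilityMeasure ν] :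
    Integrable (fun ξ : ℂ => Real.exp (-b * ‖ξ‖ ^ 2) * ‖charFun μ ξ - charFun ν ξ‖ ^ 2) ∧
    ∫ ξ : ℂ, Real.exp (-b * ‖ξ‖ ^ 2) * ‖charFun μ ξ - charFun ν ξ‖ ^ 2 =
      Real.pi / b * (gaussEnergy (1 / (4 * b)) μ μ + gaussEnergy (1 / (4 * b)) ν ν
        - 2 * gaussEnergy (1 / (4 * b)) μ ν) := by
  have hI : ∀ (μ ν : Measure ℂ) [IsProbabilityMeasure μ] [IsProbabilityMeasure ν],
      Integrable (fun ξ : ℂ => (Real.exp (-b * ‖ξ‖ ^ 2) : ℂ) *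
        (charFun μ ξ * (starRingEnd ℂ) (charFun ν ξ))) := by
    intro μ ν _ _
    refine (integrable_exp_neg_mul_norm_sq hb).mono' ?_ (Eventually.of_forall fun ξ => ?_)
    · have := measurable_charFun (μ := μ)
      have := measurable_charFun (μ := ν)
      exact Measurable.aestronglyMeasurable (by fun_prop)
    · rw [norm_mul, norm_mul, RCLike.norm_conj, Complex.norm_real,
        Real.norm_of_nonneg (Real.exp_pos _).le]
      have h1 := norm_charFun_le_one (μ := μ) ξ
      have h2 := norm_charFun_le_one (μ := ν) ξ
      have := mul_le_one₀ h1 (norm_nonneg _) h2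
      exact mul_le_of_le_one_right (Real.exp_pos _).le this
  have key : ∀ ξ : ℂ, ((Real.exp (-b * ‖ξ‖ ^ 2) * ‖charFun μ ξ - charFun ν ξ‖ ^ 2 : ℝ) : ℂ) =
      (Real.exp (-b * ‖ξ‖ ^ 2) : ℂ) * (charFun μ ξ * (starRingEnd ℂ) (charFun μ ξ))
      + (Real.exp (-b * ‖ξ‖ ^ 2) : ℂ) * (charFun ν ξ * (starRingEnd ℂ) (charFun ν ξ))
      - ((Real.exp (-b * ‖ξ‖ ^ 2) : ℂ) * (charFun μ ξ * (starRingEnd ℂ) (charFun ν ξ))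
      + (Real.exp (-b * ‖ξ‖ ^ 2) : ℂ) * (charFun ν ξ * (starRingEnd ℂ) (charFun μ ξ))) := by
    intro ξ
    rw [Complex.ofReal_mul, ← Complex.normSq_eq_norm_sq (_ - _), ← Complex.mul_conj, map_sub]
    ring
  have h1 := (hI μ μ).add (hI ν ν)
  have h2 := (hI μ ν).add (hI ν μ)
  have h3 := h1.sub h2
  have h4 : Integrable (fun ξ : ℂ =>
      ((Real.exp (-b * ‖ξ‖ ^ 2) * ‖charFun μ ξ - charFun ν ξ‖ ^ 2 : ℝ) : ℂ)) :=
    h3.congr (Eventually.of_forall fun ξ => (key ξ).symm)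
  refine ⟨?_, ?_⟩
  · exact h4.re
  · apply Complex.ofReal_injective
    rw [← integral_complex_ofReal]
    simp_rw [key]
    have e1 := integral_sub h1 h2
    have e2 := integral_add (hI μ μ) (hI ν ν)
    have e3 := integral_add (hI μ ν) (hI ν μ)
    simp only [Pi.add_apply] at e1
    rw [e1, e2, e3, integral_gauss_mul_charFun hb, integral_gauss_mul_charFun hb,
      integral_gauss_mul_charFun hb, integral_gauss_mul_charFun hb, gaussEnergy_comm _ ν μ]
    push_cast; ring

lemma two_mul_gaussEnergy_le {t : ℝ} (ht : 0 < t) (μ ν : Measure ℂ)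
    [IsProbabilityMeasure μ] [IsProbabilityMeasure ν] :
    2 * gaussEnergy t μ ν ≤ gaussEnergy t μ μ + gaussEnergy t ν ν := by
  have hb : (0 : ℝ) < 1 / (4 * t) := by positivity
  have h := (integral_gauss_mul_normSq_charFun_sub hb μ ν).2
  have e : 1 / (4 * (1 / (4 * t))) = t := by field_simp
  rw [e] at h
  have h0 : 0 ≤ ∫ ξ : ℂ, Real.exp (-(1 / (4 * t)) * ‖ξ‖ ^ 2) * ‖charFun μ ξ - charFun ν ξ‖ ^ 2 :=
    integral_nonneg fun ξ => by positivity
  rw [h] at h0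
  have := nonneg_of_mul_nonneg_right h0 (by positivity)
  linarith

/-- The Gaussian weight is positive everywhere, so the characteristic functions agree almost
everywhere, hence everywhere by continuity. -/
lemma eq_of_two_mul_gaussEnergy_eq {t : ℝ} (ht : 0 < t) (μ ν : Measure ℂ)
    [IsProbabilityMeasure μ] [IsProbabilityMeasure ν]
    (h : 2 * gaussEnergy t μ ν = gaussEnergy t μ μ + gaussEnergy t ν ν) : μ = ν := by
  have hb : (0 : ℝ) < 1 / (4 * t) := by positivity
  obtain ⟨hi, hv⟩ := integral_gauss_mul_normSq_charFun_sub hb μ ν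
  have e : 1 / (4 * (1 / (4 * t))) = t := by field_simp
  rw [e, h, sub_self, mul_zero, integral_eq_zero_iff_of_nonneg (fun ξ => by positivity) hi] at hv
  have hc : charFun μ =ᵐ[volume] charFun ν := by
    filter_upwards [hv] with ξ hξ
    have hξ' : ‖charFun μ ξ - charFun ν ξ‖ ^ 2 = 0 :=
      (mul_eq_zero.1 hξ).resolve_left (Real.exp_pos _).ne'
    exact sub_eq_zero.1 (norm_eq_zero.1 (pow_eq_zero_iff two_ne_zero |>.1 hξ'))
  apply Measure.ext_of_charFun
  exact Continuous.ae_eq_iff_eq volume continuous_charFun continuous_charFun |>.1 hc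

/-- Frullani's integral: the integrand is ∫_a^b e^{-ts} ds, and Tonelli reduces the double integral
to ∫_a^b ds/s. -/
lemma lintegral_exp_sub_exp_div {a b : ℝ} (ha : 0 < a) (hab : a ≤ b) :
    ∫⁻ t in Ioi (0 : ℝ), ENNReal.ofReal ((Real.exp (-t * a) - Real.exp (-t * b)) / t) =
      ENNReal.ofReal (Real.log b - Real.log a) := by
  have h1 : ∀ t ∈ Ioi (0 : ℝ), ENNReal.ofReal ((Real.exp (-t * a) - Real.exp (-t * b)) / t) =
      ∫⁻ s in Ioc a b, ENNReal.ofReal (Real.exp (-t * s)) := by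
    intro t ht
    have ht : 0 < t := ht
    have hc : Continuous fun s : ℝ => Real.exp (-t * s) := by fun_prop
    rw [← ofReal_integral_eq_lintegral_ofReal
      (hc.integrableOn_Ioc) (Eventually.of_forall fun s => (Real.exp_pos _).le),
      ← intervalIntegral.integral_of_le hab]
    congr 1
    rw [intervalIntegral.integral_eq_sub_of_hasDerivAt
      (f := fun s => -(Real.exp (-t * s) / t)) _ (hc.intervalIntegrable _ _)]
    · ring
    · intro s _
      have := (((hasDerivAt_id s).const_mul (-t)).exp.div_const t).neg
      refine this.congr_deriv ?_
      simp only [id]; field_simp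
  have h2 : ∀ s ∈ Ioc a b, ∫⁻ t in Ioi (0 : ℝ), ENNReal.ofReal (Real.exp (-t * s)) =
      ENNReal.ofReal (1 / s) := by
    intro s hs
    have hs : 0 < s := ha.trans hs.1
    have hI := integrableOn_exp_mul_Ioi (a := -s) (by linarith) 0
    have hV := integral_exp_mul_Ioi (a := -s) (by linarith) 0
    simp_rw [show ∀ t : ℝ, -t * s = -s * t by intro t; ring]
    rw [← ofReal_integral_eq_lintegral_ofReal hI (Eventually.of_forall fun s => (Real.exp_pos _).le),
      hV]
    simp
  rw [setLIntegral_congr_fun measurableSet_Ioi h1, lintegral_lintegral_swap]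
  · rw [setLIntegral_congr_fun measurableSet_Ioc h2]
    have hii : IntervalIntegrable (fun s : ℝ => 1 / s) volume a b := by
      apply intervalIntegral.intervalIntegrable_one_div
      · intro x hx; rw [uIcc_of_le hab] at hx; exact (ha.trans_le hx.1).ne'
      · exact continuousOn_id
    rw [← ofReal_integral_eq_lintegral_ofReal ((intervalIntegrable_iff_integrableOn_Ioc_of_le hab).1 hii),
      ← intervalIntegral.integral_of_le hab, integral_one_div_of_pos ha (ha.trans_le hab),
      Real.log_div (ha.trans_le hab).ne' ha.ne']
    filter_upwards [ae_restrict_mem measurableSet_Ioc] with s hs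
    exact (one_div_pos.2 (ha.trans hs.1)).le
  · exact Measurable.aemeasurable (by fun_prop)

end HardEdge
end

/-! ### The logarithmic kernel as a superposition of Gaussians -/

noncomputable section

namespace HardEdge

/-- The logarithmic kernel `log (D / |z - w|)`, truncated to nonnegative values. -/
def posKernel (D : ℝ) (z w : ℂ) : ENNReal := (logKernel z w + (Real.log D : EReal)).toENNReal

/-- The mutual energy of two measures with respect to `posKernel`. -/
def mutualEnergy (D : ℝ) (μ ν : Measure ℂ) : ENNReal := ∫⁻ z, ∫⁻ w, posKernel D z w ∂ν ∂μ

lemma logKernel_self (z : ℂ) : logKernel z z = ⊤ := by simp [logKernel]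

lemma logKernel_of_ne {z w : ℂ} (h : z ≠ w) : logKernel z w = ((-Real.log ‖z - w‖ : ℝ) : EReal) := by
  have h0 : 0 < ‖z - w‖ := norm_pos_iff.2 (sub_ne_zero.2 h)
  rw [logKernel, ← ofReal_norm, ENNReal.log_ofReal_of_pos h0, EReal.coe_neg]

lemma logKernel_comm (z w : ℂ) : logKernel z w = logKernel w z := by
  rw [logKernel, logKernel, ← ofReal_norm, ← ofReal_norm, norm_sub_rev]

lemma logKernel_ne_bot (z w : ℂ) : logKernel z w ≠ ⊥ := by
  by_cases h : z = w
  · rw [h, logKernel_self]; simp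
  · rw [logKernel_of_ne h]; exact EReal.coe_ne_bot _

lemma measurable_logKernel : Measurable fun x : ℂ × ℂ => logKernel x.1 x.2 := by
  unfold logKernel
  exact (((measurable_fst.sub measurable_snd).enorm).ennreal_log).neg

lemma posKernel_self (D : ℝ) (z : ℂ) : posKernel D z z = ⊤ := by
  rw [posKernel, logKernel_self, EReal.top_add_coe, EReal.toENNReal_top]

lemma posKernel_of_ne {D : ℝ} {z w : ℂ} (h : z ≠ w) :
    posKernel D z w = ENNReal.ofReal (Real.log D - Real.log ‖z - w‖) := by
  rw [posKernel, logKernel_of_ne h, ← EReal.coe_add, EReal.toENNReal_of_ne_top (EReal.coe_ne_top _),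
    EReal.toReal_coe]
  congr 1; ring

lemma posKernel_comm (D : ℝ) (z w : ℂ) : posKernel D z w = posKernel D w z := by
  rw [posKernel, posKernel, logKernel_comm]

lemma measurable_posKernel (D : ℝ) : Measurable fun x : ℂ × ℂ => posKernel D x.1 x.2 := by
  unfold posKernel
  exact (measurable_logKernel.add_const _).ereal_toENNReal

/-- Frullani's integral with a = |z - w|² and b = D²; the factor 2 comes from the squares. This
transfers positive definiteness from Gaussians to the logarithm. -/
lemma two_mul_posKernel {D : ℝ} (hD : 0 < D) {z w : ℂ} (h : ‖z - w‖ ≤ D) :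
    2 * posKernel D z w = ∫⁻ t in Ioi (0 : ℝ),
      ENNReal.ofReal ((Real.exp (-t * ‖z - w‖ ^ 2) - Real.exp (-t * D ^ 2)) / t) := by
  by_cases hzw : z = w
  · subst hzw
    rw [posKernel_self, ENNReal.mul_top two_ne_zero, eq_comm]
    -- On the diagonal both sides are infinite: replacing |z - z|² = 0 by D²e^{-r} lowers the
    -- integrand, and the Frullani integral is then exactly r, which is arbitrary.
    refine ENNReal.eq_top_of_forall_nnreal_le fun r => ?_
    have h1 := lintegral_exp_sub_exp_div (a := D ^ 2 * Real.exp (-r)) (b := D ^ 2) (by positivity)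
      (mul_le_of_le_one_right (by positivity) (Real.exp_le_one_iff.2 (by simp)))
    rw [Real.log_mul (by positivity) (by positivity), Real.log_exp, show Real.log (D ^ 2) -
      (Real.log (D ^ 2) + -(r : ℝ)) = r by ring, ENNReal.ofReal_coe_nnreal] at h1
    rw [← h1]
    refine setLIntegral_mono' measurableSet_Ioi fun t ht => ENNReal.ofReal_le_ofReal ?_
    have ht : 0 < t := ht
    have h3 : Real.exp (-t * (D ^ 2 * Real.exp (-r))) ≤ Real.exp (-t * ‖z - z‖ ^ 2) := by
      rw [sub_self, norm_zero, Real.exp_le_exp, neg_mul, neg_mul, neg_le_neg_iff,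
        zero_pow two_ne_zero, mul_zero]
      positivity
    gcongr
  · have h0 : 0 < ‖z - w‖ := norm_pos_iff.2 (sub_ne_zero.2 hzw)
    rw [posKernel_of_ne hzw, lintegral_exp_sub_exp_div (by positivity) (by gcongr), Real.log_pow,
      Real.log_pow, ← ENNReal.ofReal_ofNat, ← ENNReal.ofReal_mul (by norm_num)]
    congr 1
    push_cast; ring

lemma mutualEnergy_eq_prod (D : ℝ) (μ ν : Measure ℂ) [SFinite μ] [SFinite ν] :
    mutualEnergy D μ ν = ∫⁻ x, posKernel D x.1 x.2 ∂(μ.prod ν) := by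
  rw [mutualEnergy, lintegral_prod _ (measurable_posKernel D).aemeasurable]

lemma mutualEnergy_comm (D : ℝ) (μ ν : Measure ℂ) [SFinite μ] [SFinite ν] :
    mutualEnergy D μ ν = mutualEnergy D ν μ := by
  rw [mutualEnergy, lintegral_lintegral_swap (measurable_posKernel D).aemeasurable]
  simp_rw [posKernel_comm D _]
  rw [mutualEnergy]

/-- Tonelli applies because points at distance at most D make the Frullani integrand nonnegative for
every t. -/
lemma two_mul_mutualEnergy {D : ℝ} (hD : 0 < D) (μ ν : Measure ℂ)
    [IsProbabilityMeasure μ] [IsProbabilityMeasure ν]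
    (h : ∀ᵐ x ∂(μ.prod ν), ‖x.1 - x.2‖ ≤ D) :
    2 * mutualEnergy D μ ν = ∫⁻ t in Ioi (0 : ℝ),
      ENNReal.ofReal ((gaussEnergy t μ ν - Real.exp (-t * D ^ 2)) / t) := by
  rw [mutualEnergy_eq_prod, ← lintegral_const_mul _ (measurable_posKernel D)]
  have h1 : ∫⁻ x, 2 * posKernel D x.1 x.2 ∂(μ.prod ν) = ∫⁻ x, (∫⁻ t in Ioi (0 : ℝ),
      ENNReal.ofReal ((Real.exp (-t * ‖x.1 - x.2‖ ^ 2) - Real.exp (-t * D ^ 2)) / t)) ∂(μ.prod ν) :=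
    lintegral_congr_ae (h.mono fun x hx => two_mul_posKernel hD hx)
  rw [h1, lintegral_lintegral_swap (Measurable.aemeasurable (by fun_prop))]
  refine setLIntegral_congr_fun measurableSet_Ioi fun t ht => ?_
  have ht : 0 < t := ht
  have hi : Integrable (fun x : ℂ × ℂ => Real.exp (-t * ‖x.1 - x.2‖ ^ 2) - Real.exp (-t * D ^ 2))
      (μ.prod ν) := (integrable_exp_neg_mul_norm_sub_sq ht.le μ ν).sub (integrable_const _)
  rw [← ofReal_integral_eq_lintegral_ofReal (hi.div_const t)]
  · congr 1
    rw [integral_div, integral_sub (integrable_exp_neg_mul_norm_sub_sq ht.le μ ν)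
      (integrable_const _)]
    simp [gaussEnergy]
  · filter_upwards [h] with x hx
    refine div_nonneg (sub_nonneg.2 (Real.exp_le_exp.2 ?_)) ht.le
    simp only [neg_mul, neg_le_neg_iff]
    gcongr

lemma exp_le_gaussEnergy {D t : ℝ} (ht : 0 ≤ t) (μ ν : Measure ℂ)
    [IsProbabilityMeasure μ] [IsProbabilityMeasure ν]
    (h : ∀ᵐ x ∂(μ.prod ν), ‖x.1 - x.2‖ ≤ D) : Real.exp (-t * D ^ 2) ≤ gaussEnergy t μ ν := by
  have h1 : ∫ _x : ℂ × ℂ, Real.exp (-t * D ^ 2) ∂(μ.prod ν) ≤ gaussEnergy t μ ν := by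
    refine integral_mono_ae (integrable_const _) (integrable_exp_neg_mul_norm_sub_sq ht μ ν) ?_
    filter_upwards [h] with x hx
    refine Real.exp_le_exp.2 ?_
    simp only [neg_mul, neg_le_neg_iff]
    gcongr
  simpa using h1

lemma measurable_gaussEnergy (μ ν : Measure ℂ) [IsProbabilityMeasure μ] [IsProbabilityMeasure ν] :
    Measurable fun t => gaussEnergy t μ ν := by
  have : StronglyMeasurable (Function.uncurry fun (t : ℝ) (x : ℂ × ℂ) =>
      Real.exp (-t * ‖x.1 - x.2‖ ^ 2)) := Measurable.stronglyMeasurable (by fun_prop)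
  exact this.integral_prod_right.measurable

/-- Strict positive definiteness of the logarithmic kernel. -/
lemma eq_of_mutualEnergy_le {D : ℝ} (hD : 0 < D) (μ ν : Measure ℂ)
    [IsProbabilityMeasure μ] [IsProbabilityMeasure ν]
    (hμ : ∀ᵐ x ∂(μ.prod μ), ‖x.1 - x.2‖ ≤ D) (h : ∀ᵐ x ∂(μ.prod ν), ‖x.1 - x.2‖ ≤ D)
    (hG : ∀ t, gaussEnergy t ν ν = gaussEnergy t μ μ) (hfin : mutualEnergy D μ μ ≠ ⊤) :
    mutualEnergy D μ ν ≤ mutualEnergy D μ μ ∧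
      (mutualEnergy D μ μ ≤ mutualEnergy D μ ν → μ = ν) := by
  have hle : ∀ t ∈ Ioi (0 : ℝ),
      ENNReal.ofReal ((gaussEnergy t μ ν - Real.exp (-t * D ^ 2)) / t) ≤
      ENNReal.ofReal ((gaussEnergy t μ μ - Real.exp (-t * D ^ 2)) / t) := by
    intro t ht
    have ht : 0 < t := ht
    have := two_mul_gaussEnergy_le ht μ ν
    rw [hG] at this
    refine ENNReal.ofReal_le_ofReal ?_
    gcongr
    linarith
  have e1 := two_mul_mutualEnergy hD μ ν h
  have e2 := two_mul_mutualEnergy hD μ μ hμ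
  have hle2 : 2 * mutualEnergy D μ ν ≤ 2 * mutualEnergy D μ μ := by
    rw [e1, e2]; exact setLIntegral_mono' measurableSet_Ioi hle
  have hc : ∀ {x y : ENNReal}, 2 * x ≤ 2 * y → x ≤ y := fun {x y} hxy =>
    (ENNReal.mul_le_mul_iff_right two_ne_zero (by simp)).1 hxy
  refine ⟨hc hle2, fun hge => ?_⟩
  have hge2 : 2 * mutualEnergy D μ μ ≤ 2 * mutualEnergy D μ ν := by gcongr
  have hfin2 : 2 * mutualEnergy D μ ν ≠ ⊤ :=
    ne_top_of_le_ne_top (ENNReal.mul_ne_top (by simp) hfin) hle2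
  rw [e1, e2] at hge2
  rw [e1] at hfin2
  have hm := measurable_gaussEnergy μ μ
  -- The integrands are ordered and have equal finite integrals, so they agree for almost every t >
  -- 0. A single such t suffices, since each Gaussian kernel is already strictly positive definite.
  have hae := ae_eq_of_ae_le_of_lintegral_le
    ((ae_restrict_iff' measurableSet_Ioi).2 (Eventually.of_forall hle)) hfin2
    (Measurable.aemeasurable (by fun_prop)) hge2
  obtain ⟨t, ht, hte⟩ : ∃ t ∈ Ioi (0 : ℝ),
      ENNReal.ofReal ((gaussEnergy t μ ν - Real.exp (-t * D ^ 2)) / t) =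
      ENNReal.ofReal ((gaussEnergy t μ μ - Real.exp (-t * D ^ 2)) / t) := by
    have h3 := (ae_restrict_mem (μ := volume) (measurableSet_Ioi (a := (0 : ℝ)))).and hae
    have : (ae (volume.restrict (Ioi (0 : ℝ)))).NeBot := by
      rw [ae_neBot]; simp [Measure.restrict_eq_zero]
    obtain ⟨t, h⟩ := h3.exists
    exact ⟨t, h.1, h.2⟩
  have ht : 0 < t := ht
  rw [ENNReal.ofReal_eq_ofReal_iff
    (div_nonneg (sub_nonneg.2 (exp_le_gaussEnergy ht.le μ ν h)) ht.le)
    (div_nonneg (sub_nonneg.2 (exp_le_gaussEnergy ht.le μ μ hμ)) ht.le)] at hte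
  have hte' : gaussEnergy t μ ν = gaussEnergy t μ μ := by
    field_simp at hte; linarith
  exact eq_of_two_mul_gaussEnergy_eq ht μ ν (by rw [hG, hte']; ring)

/-! ### Extended real integrals bounded below -/

/-- Shifting by C turns the difference of two extended integrals into a single integral of a
nonnegative function, so that ∞ - ∞ never arises. -/
lemma extIntegral_of_le {α : Type*} [MeasurableSpace α] (μ : Measure α) [IsProbabilityMeasure μ]
    {f : α → EReal} (hf : Measurable f) {C : ℝ} (hC : 0 ≤ C)
    (h : ∀ᵐ x ∂μ, ((-C : ℝ) : EReal) ≤ f x) :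
    extIntegral μ f = ((∫⁻ x, (f x + (C : EReal)).toENNReal ∂μ : ENNReal) : EReal) -
      (C : EReal) := by
  -- The relation between positive parts is written additively, (f + C)⁺ + f⁻ = f⁺ + C, because
  -- subtraction in `ENNReal` truncates.
  have hp : ∀ᵐ x ∂μ, (f x + (C : EReal)).toENNReal + (-f x).toENNReal =
      (f x).toENNReal + ENNReal.ofReal C := by
    filter_upwards [h] with x hx
    induction hfx : f x using EReal.rec with
    | bot => rw [hfx] at hx; simp at hx
    | top => simp
    | coe y =>
      rw [hfx, EReal.coe_le_coe_iff] at hx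
      rw [← EReal.coe_add, ← EReal.coe_neg, EReal.toENNReal_of_ne_top (EReal.coe_ne_top _),
        EReal.toENNReal_of_ne_top (EReal.coe_ne_top _),
        EReal.toENNReal_of_ne_top (EReal.coe_ne_top _), EReal.toReal_coe, EReal.toReal_coe,
        EReal.toReal_coe]
      rcases le_total 0 y with hy | hy
      · rw [ENNReal.ofReal_of_nonpos (by linarith : -y ≤ 0), add_zero, ENNReal.ofReal_add hy hC]
      · rw [ENNReal.ofReal_of_nonpos hy, zero_add, ← ENNReal.ofReal_add (by linarith) (by linarith)]
        congr 1; ring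
  have hm : Measurable fun x => (-f x).toENNReal := hf.neg.ereal_toENNReal
  have hI := lintegral_congr_ae hp
  rw [lintegral_add_right _ hm, lintegral_add_right _ measurable_const, lintegral_const, measure_univ,
    mul_one] at hI
  have hneg : ∫⁻ x, (-f x).toENNReal ∂μ ≤ ENNReal.ofReal C := by
    calc _ ≤ ∫⁻ _x, ENNReal.ofReal C ∂μ := by
          refine lintegral_mono_ae ?_
          filter_upwards [h] with x hx
          have : -f x ≤ (C : EReal) := by
            rw [EReal.neg_le]; simpa using hx
          calc (-f x).toENNReal ≤ (C : EReal).toENNReal := EReal.toENNReal_le_toENNReal this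
            _ = ENNReal.ofReal C := by
              rw [EReal.toENNReal_of_ne_top (EReal.coe_ne_top _), EReal.toReal_coe]
      _ = _ := by simp
  have hneg' : ∫⁻ x, (-f x).toENNReal ∂μ ≠ ⊤ := ne_top_of_le_ne_top ENNReal.ofReal_ne_top hneg
  unfold extIntegral
  generalize ∫⁻ x, (-f x).toENNReal ∂μ = A at *
  generalize ∫⁻ x, (f x).toENNReal ∂μ = B at *
  generalize ∫⁻ x, (f x + (C : EReal)).toENNReal ∂μ = E at *
  lift A to NNReal using hneg'
  have hCe : (C : EReal) = ((ENNReal.ofReal C : ENNReal) : EReal) := by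
    rw [EReal.coe_ennreal_ofReal, max_eq_left hC]
  by_cases hB : B = ⊤
  · subst hB
    have : E = ⊤ := by
      by_contra hE
      rw [top_add] at hI
      exact ENNReal.add_ne_top.2 ⟨hE, ENNReal.coe_ne_top⟩ hI
    subst this
    simp only [EReal.coe_ennreal_top]
    rw [EReal.top_sub_coe]
    exact EReal.top_sub_coe _
  · have hE : E ≠ ⊤ := by
      intro hE
      rw [hE, top_add] at hI
      exact ENNReal.add_ne_top.2 ⟨hB, ENNReal.ofReal_ne_top⟩ hI.symm
    lift B to NNReal using hB
    lift E to NNReal using hE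
    have hI' := congrArg ENNReal.toReal hI
    rw [ENNReal.toReal_add (by simp) (by simp), ENNReal.toReal_add (by simp) (by simp),
      ENNReal.toReal_ofReal hC] at hI'
    simp only [ENNReal.coe_toReal] at hI'
    have c : ∀ x : NNReal, (((x : ENNReal) : EReal)) = ((x : ℝ) : EReal) := fun x => rfl
    rw [c, c, c, ← EReal.coe_sub, ← EReal.coe_sub]
    congr 1; linarith

lemma extIntegral_coe {α : Type*} [MeasurableSpace α] {μ : Measure α} {f : α → EReal} {g : α → ℝ}
    (hg : Integrable g μ) (h : ∀ᵐ x ∂μ, f x = (g x : EReal)) :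
    extIntegral μ f = ((∫ x, g x ∂μ : ℝ) : EReal) := by
  have h1 : ∫⁻ x, (f x).toENNReal ∂μ = ∫⁻ x, ENNReal.ofReal (g x) ∂μ := by
    refine lintegral_congr_ae (h.mono fun x hx => ?_)
    simp only [hx]
    rw [EReal.toENNReal_of_ne_top (EReal.coe_ne_top _), EReal.toReal_coe]
  have h2 : ∫⁻ x, (-f x).toENNReal ∂μ = ∫⁻ x, ENNReal.ofReal (-g x) ∂μ := by
    refine lintegral_congr_ae (h.mono fun x hx => ?_)
    simp only [hx]
    rw [← EReal.coe_neg, EReal.toENNReal_of_ne_top (EReal.coe_ne_top _), EReal.toReal_coe]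
  have h3 : ∫⁻ x, ENNReal.ofReal (-g x) ∂μ ≠ ⊤ := hg.neg.lintegral_lt_top.ne
  rw [extIntegral, h1, h2, integral_eq_lintegral_pos_part_sub_lintegral_neg_part hg, EReal.coe_sub,
    EReal.coe_ennreal_toReal hg.lintegral_lt_top.ne,
    EReal.coe_ennreal_toReal h3]

end HardEdge
end

/-! ### Perturbations of the equilibrium measure -/

noncomputable section

namespace HardEdge

lemma mutualEnergy_mix (D : ℝ) (c d : ENNReal) (μ ν : Measure ℂ) [IsFiniteMeasure μ]
    [IsFiniteMeasure ν] :
    mutualEnergy D (c • μ + d • ν) (c • μ + d • ν) =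
      c * c * mutualEnergy D μ μ + 2 * (c * d * mutualEnergy D μ ν) + d * d * mutualEnergy D ν ν := by
  have hm : ∀ (τ : Measure ℂ) [SFinite τ], Measurable fun z => ∫⁻ w, posKernel D z w ∂τ :=
    fun τ _ => (measurable_posKernel D).lintegral_prod_right
  have h1 : ∀ τ : Measure ℂ, mutualEnergy D (c • μ + d • ν) τ =
      c * mutualEnergy D μ τ + d * mutualEnergy D ν τ := by
    intro τ
    simp only [mutualEnergy, lintegral_add_measure, lintegral_smul_measure, smul_eq_mul]
  have h2 : ∀ (τ : Measure ℂ), mutualEnergy D τ (c • μ + d • ν) =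
      c * mutualEnergy D τ μ + d * mutualEnergy D τ ν := by
    intro τ
    simp only [mutualEnergy, lintegral_add_measure, lintegral_smul_measure, smul_eq_mul]
    rw [lintegral_add_left ((hm μ).const_mul c), lintegral_const_mul _ (hm μ),
      lintegral_const_mul _ (hm ν)]
  rw [h1, h2, h2, mutualEnergy_comm D ν μ]
  ring

/-- Probability measures supported on a compact subset of the interior of `{Q < ∞}` that is
contained in the closed ball of radius `R` about `a`. -/
def IsConfined (Q : ℂ → EReal) (a : ℂ) (R : ℝ) (μ : Measure ℂ) : Prop :=
  IsProbabilityMeasure μ ∧ ∃ K : Set ℂ, IsCompact K ∧ K ⊆ interior (finiteSet Q) ∧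
    K ⊆ Metric.closedBall a R ∧ μ Kᶜ = 0

variable {Q : ℂ → EReal} {a : ℂ} {R : ℝ} {μ ν σ : Measure ℂ}

lemma IsConfined.ae_prod_le (hμ : IsConfined Q a R μ) (hν : IsConfined Q a R ν) :
    ∀ᵐ x ∂(μ.prod ν), ‖x.1 - x.2‖ ≤ 2 * R := by
  obtain ⟨_, K, hK, -, hKR, hK0⟩ := hμ
  obtain ⟨_, K', hK', -, hKR', hK0'⟩ := hν
  have h1 : ∀ᵐ x ∂(μ.prod ν), x.1 ∈ K := Measure.quasiMeasurePreserving_fst.ae (mem_ae_iff.2 hK0)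
  have h2 : ∀ᵐ x ∂(μ.prod ν), x.2 ∈ K' := Measure.quasiMeasurePreserving_snd.ae (mem_ae_iff.2 hK0')
  filter_upwards [h1, h2] with x hx hx'
  have e1 := hKR hx
  have e2 := hKR' hx'
  rw [mem_closedBall_iff_norm] at e1 e2
  calc ‖x.1 - x.2‖ = ‖(x.1 - a) - (x.2 - a)‖ := by congr 1; ring
    _ ≤ ‖x.1 - a‖ + ‖x.2 - a‖ := norm_sub_le _ _
    _ ≤ 2 * R := by linarith

lemma IsConfined.isCompactProb (hμ : IsConfined Q a R μ) : IsCompactProb μ :=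
  ⟨hμ.1, hμ.2.imp fun _ h => ⟨h.1, h.2.2.2⟩⟩

lemma coe_toReal_of_mem (hQ : IsAdmissible Q) {ζ : ℂ} (h : ζ ∈ finiteSet Q) :
    ((Q ζ).toReal : EReal) = Q ζ :=
  EReal.coe_toReal (ne_of_lt h) (hQ.ne_bot ζ)

lemma IsConfined.ae_eq (hQ : IsAdmissible Q) (hμ : IsConfined Q a R μ) :
    ∀ᵐ ζ ∂μ, Q ζ = ((Q ζ).toReal : EReal) := by
  obtain ⟨_, K, hK, hKQ, -, hK0⟩ := hμ
  filter_upwards [compl_mem_ae_iff.2 hK0] with ζ hζ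
  rw [compl_compl] at hζ
  exact (coe_toReal_of_mem hQ (interior_subset (hKQ hζ))).symm

lemma IsConfined.integrable (hQ : IsAdmissible Q) (hμ : IsConfined Q a R μ) :
    Integrable (fun ζ => (Q ζ).toReal) μ := by
  obtain ⟨_, K, hK, hKQ, -, hK0⟩ := hμ
  have h : IntegrableOn (fun ζ => (Q ζ).toReal) K μ :=
    (hQ.analytic.continuousOn.mono hKQ).integrableOn_compact hK
  rw [IntegrableOn, Measure.restrict_eq_self_of_ae_mem] at h
  · exact h
  · filter_upwards [compl_mem_ae_iff.2 hK0] with ζ hζ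
    simpa using hζ

/-- Points of the ball are at distance at most 2R, so the truncation in `posKernel` is inactive
almost everywhere and only the additive constant log(2R) remains; R ≥ 1 makes that constant
nonnegative. -/
lemma IsConfined.weightedEnergy_eq (hQ : IsAdmissible Q) (hR : 1 ≤ R) (hμ : IsConfined Q a R μ) :
    weightedEnergy Q μ = (mutualEnergy (2 * R) μ μ : EReal) +
      ((∫ ζ, (Q ζ).toReal ∂μ - Real.log (2 * R) : ℝ) : EReal) := by
  have := hμ.1
  have hD : 0 ≤ Real.log (2 * R) := Real.log_nonneg (by linarith)
  rw [weightedEnergy, extIntegral_coe (hμ.integrable hQ) (hμ.ae_eq hQ),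
    extIntegral_of_le _ measurable_logKernel hD, mutualEnergy_eq_prod]
  · simp only [posKernel]
    rw [sub_eq_add_neg, add_assoc, ← EReal.coe_neg, ← EReal.coe_add]
    congr 2; ring
  · filter_upwards [hμ.ae_prod_le hμ] with x hx
    by_cases h : x.1 = x.2
    · rw [h, logKernel_self]; exact le_top
    · rw [logKernel_of_ne h, EReal.coe_le_coe_iff, neg_le_neg_iff]
      exact Real.log_le_log (norm_pos_iff.2 (sub_ne_zero.2 h)) hx

lemma IsConfined.energy_le (hQ : IsAdmissible Q) (hR : 1 ≤ R) (hσ : IsConfined Q a R σ)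
    (hmin : IsEquilibriumMeasure Q σ) (hμ : IsConfined Q a R μ)
    (hfin : mutualEnergy (2 * R) μ μ ≠ ⊤) :
    mutualEnergy (2 * R) σ σ ≠ ⊤ ∧ (mutualEnergy (2 * R) σ σ).toReal + ∫ ζ, (Q ζ).toReal ∂σ ≤
      (mutualEnergy (2 * R) μ μ).toReal + ∫ ζ, (Q ζ).toReal ∂μ := by
  have h := hmin.2 μ hμ.isCompactProb
  rw [hσ.weightedEnergy_eq hQ hR, hμ.weightedEnergy_eq hQ hR, ← EReal.coe_ennreal_toReal hfin,
    ← EReal.coe_add] at h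
  have hσf : mutualEnergy (2 * R) σ σ ≠ ⊤ := by
    intro ht
    rw [ht, EReal.coe_ennreal_top, EReal.top_add_coe, top_le_iff] at h
    exact EReal.coe_ne_top _ h
  rw [← EReal.coe_ennreal_toReal hσf, ← EReal.coe_add, EReal.coe_le_coe_iff] at h
  exact ⟨hσf, by linarith⟩

lemma IsConfined.mix (hμ : IsConfined Q a R μ) (hν : IsConfined Q a R ν) {ε : ℝ} (h0 : 0 ≤ ε)
    (h1 : ε ≤ 1) : IsConfined Q a R (ENNReal.ofReal (1 - ε) • μ + ENNReal.ofReal ε • ν) := by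
  obtain ⟨_, K, hK, hKQ, hKR, hK0⟩ := hμ
  obtain ⟨_, K', hK', hKQ', hKR', hK0'⟩ := hν
  refine ⟨⟨?_⟩, K ∪ K', hK.union hK', union_subset hKQ hKQ', union_subset hKR hKR', ?_⟩
  · simp only [Measure.add_apply, Measure.smul_apply, measure_univ, smul_eq_mul, mul_one]
    rw [← ENNReal.ofReal_add (by linarith) h0]; simp
  · have e1 : μ (K ∪ K')ᶜ = 0 := measure_mono_null (compl_subset_compl.2 subset_union_left) hK0
    have e2 : ν (K ∪ K')ᶜ = 0 := measure_mono_null (compl_subset_compl.2 subset_union_right) hK0'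
    simp only [Measure.add_apply, Measure.smul_apply, e1, e2, smul_zero, add_zero]

/-- The first variation of the energy at an equilibrium measure. -/
lemma IsConfined.first_variation (hQ : IsAdmissible Q) (hR : 1 ≤ R) (hσ : IsConfined Q a R σ)
    (hmin : IsEquilibriumMeasure Q σ) (hν : IsConfined Q a R ν)
    (hσσ : mutualEnergy (2 * R) σ σ ≠ ⊤) (hσν : mutualEnergy (2 * R) σ ν ≠ ⊤)
    (hνν : mutualEnergy (2 * R) ν ν ≠ ⊤) :
    2 * (mutualEnergy (2 * R) σ σ).toReal + ∫ ζ, (Q ζ).toReal ∂σ ≤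
      2 * (mutualEnergy (2 * R) σ ν).toReal + ∫ ζ, (Q ζ).toReal ∂ν := by
  have := hσ.1
  have := hν.1
  set A := (mutualEnergy (2 * R) σ σ).toReal with hA
  set B := (mutualEnergy (2 * R) σ ν).toReal with hB
  set C := (mutualEnergy (2 * R) ν ν).toReal with hC
  set q := ∫ ζ, (Q ζ).toReal ∂σ
  set q' := ∫ ζ, (Q ζ).toReal ∂ν
  -- The energy of (1 - ε)σ + εν is quadratic in ε and minimal at ε = 0. The inequality is the
  -- energy increment divided by ε; letting ε → 0 leaves the linear coefficient.
  have key : ∀ ε : ℝ, 0 < ε → ε ≤ 1 → 0 ≤ 2 * (B - A) + (q' - q) + ε * (A - 2 * B + C) := by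
    intro ε h0 h1
    have hmix := mutualEnergy_mix (2 * R) (ENNReal.ofReal (1 - ε)) (ENNReal.ofReal ε) σ ν
    have hf1 : ENNReal.ofReal (1 - ε) * ENNReal.ofReal (1 - ε) * mutualEnergy (2 * R) σ σ ≠ ⊤ :=
      ENNReal.mul_ne_top (by finiteness) hσσ
    have hf2 : 2 * (ENNReal.ofReal (1 - ε) * ENNReal.ofReal ε * mutualEnergy (2 * R) σ ν) ≠ ⊤ :=
      ENNReal.mul_ne_top (by simp) (ENNReal.mul_ne_top (by finiteness) hσν)
    have hf3 : ENNReal.ofReal ε * ENNReal.ofReal ε * mutualEnergy (2 * R) ν ν ≠ ⊤ :=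
      ENNReal.mul_ne_top (by finiteness) hνν
    have hf12 := ENNReal.add_ne_top.2 ⟨hf1, hf2⟩
    have := (hσ.energy_le hQ hR hmin (hσ.mix hν h0.le h1)
      (by rw [hmix]; exact ENNReal.add_ne_top.2 ⟨hf12, hf3⟩)).2
    rw [hmix, ENNReal.toReal_add hf12 hf3, ENNReal.toReal_add hf1 hf2] at this
    simp only [ENNReal.toReal_mul, ENNReal.toReal_ofNat, ENNReal.toReal_ofReal h0.le,
      ENNReal.toReal_ofReal (sub_nonneg.2 h1), ← hA, ← hB, ← hC] at this
    rw [integral_add_measure ((hσ.integrable hQ).smul_measure (by simp))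
      ((hν.integrable hQ).smul_measure (by simp)), integral_smul_measure, integral_smul_measure,
      ENNReal.toReal_ofReal h0.le, ENNReal.toReal_ofReal (sub_nonneg.2 h1)] at this
    simp only [smul_eq_mul] at this
    have h2 : 0 ≤ ε * (2 * (B - A) + (q' - q) + ε * (A - 2 * B + C)) := by
      simp only [q, q']; nlinarith
    exact nonneg_of_mul_nonneg_right h2 h0
  by_contra hcon
  push Not at hcon
  have hlim : Tendsto (fun ε : ℝ => 2 * (B - A) + (q' - q) + ε * (A - 2 * B + C)) (𝓝[>] 0)
      (𝓝 (2 * (B - A) + (q' - q) + 0 * (A - 2 * B + C))) :=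
    tendsto_nhdsWithin_of_tendsto_nhds (Continuous.tendsto (by fun_prop) 0)
  have : 0 ≤ 2 * (B - A) + (q' - q) + 0 * (A - 2 * B + C) := by
    refine ge_of_tendsto hlim ?_
    filter_upwards [Ioc_mem_nhdsGT (zero_lt_one' ℝ)] with ε hε using key ε hε.1 hε.2
  linarith

/-! ### Uniform measures on circles -/

/-- Uniform probability measure on the circle of radius `r` about `a`. -/
def circleMeasure (a : ℂ) (r : ℝ) : Measure ℂ :=
  ((ENNReal.ofReal (2 * Real.pi))⁻¹ • volume.restrict (Ioc 0 (2 * Real.pi))).map (circleMap a r)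

lemma lintegral_circleMeasure (a : ℂ) (r : ℝ) {f : ℂ → ENNReal} (hf : Measurable f) :
    ∫⁻ z, f z ∂(circleMeasure a r) = (ENNReal.ofReal (2 * Real.pi))⁻¹ *
      ∫⁻ θ in Ioc 0 (2 * Real.pi), f (circleMap a r θ) := by
  rw [circleMeasure, lintegral_map hf (continuous_circleMap a r).measurable, lintegral_smul_measure,
    smul_eq_mul]

instance (a : ℂ) (r : ℝ) : IsProbabilityMeasure (circleMeasure a r) := by
  refine ⟨?_⟩
  rw [← lintegral_one, lintegral_circleMeasure _ _ measurable_const]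
  simp only [lintegral_const, MeasurableSet.univ, Measure.restrict_apply, univ_inter,
    Real.volume_Ioc, sub_zero, one_mul]
  exact ENNReal.inv_mul_cancel (by simp [Real.pi_pos]) ENNReal.ofReal_ne_top

lemma circleMeasure_sphere (a : ℂ) {r : ℝ} (hr : 0 ≤ r) : circleMeasure a r (Metric.sphere a r)ᶜ = 0 := by
  rw [circleMeasure, Measure.map_apply (continuous_circleMap a r).measurable
    Metric.isClosed_sphere.measurableSet.compl, preimage_compl]
  have : circleMap a r ⁻¹' Metric.sphere a r = univ :=
    eq_univ_of_forall fun θ => circleMap_mem_sphere a hr θ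
  simp [this]

/-- The mean of log|z - w| over the circle is log max(r, |w - a|) (Jensen's formula for a linear
function). The hypothesis keeps |z - w| ≤ D, so no truncation occurs. -/
lemma lintegral_posKernel_circleMeasure {D : ℝ} {a w : ℂ} {r : ℝ} (hr : 0 < r)
    (h : r + ‖w - a‖ ≤ D) :
    ∫⁻ z, posKernel D z w ∂(circleMeasure a r) =
      ENNReal.ofReal (Real.log D - Real.log (max r ‖w - a‖)) := by
  have hm : Measurable fun z => posKernel D z w :=
    Measurable.of_uncurry_right (f := posKernel D) (measurable_posKernel D)
  -- If w lies on the circle the kernel is infinite there, but only for countably many angles.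
  have hne : ∀ᵐ θ ∂(volume.restrict (Ioc 0 (2 * Real.pi))), circleMap a r θ ≠ w := by
    refine ae_restrict_of_ae ?_
    have h1 : (circleMap a r ⁻¹' {w}).Countable := (countable_singleton w).preimage_circleMap a hr.ne'
    filter_upwards [compl_mem_ae_iff.2 (h1.measure_zero volume)] with θ hθ
    simpa using hθ
  have hintg : CircleIntegrable (fun z => Real.log ‖z - w‖) a r :=
    circleIntegrable_log_norm_sub_const r
  rw [lintegral_circleMeasure _ _ hm]
  have h1 : ∫⁻ θ in Ioc 0 (2 * Real.pi), posKernel D (circleMap a r θ) w =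
      ∫⁻ θ in Ioc 0 (2 * Real.pi),
        ENNReal.ofReal (Real.log D - Real.log ‖circleMap a r θ - w‖) :=
    lintegral_congr_ae (hne.mono fun θ hθ => posKernel_of_ne hθ)
  have hpi : (0 : ℝ) ≤ 2 * Real.pi := by positivity
  have hintg' : IntervalIntegrable (fun θ => Real.log D - Real.log ‖circleMap a r θ - w‖) volume 0
      (2 * Real.pi) := (intervalIntegrable_const).sub hintg
  rw [h1, ← ofReal_integral_eq_lintegral_ofReal
    ((intervalIntegrable_iff_integrableOn_Ioc_of_le hpi).1 hintg'),
    ← intervalIntegral.integral_of_le hpi, intervalIntegral.integral_sub intervalIntegrable_const hintg,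
    ← ENNReal.ofReal_inv_of_pos (by positivity), ← ENNReal.ofReal_mul (by positivity)]
  · have e := circleAverage_log_norm_sub_const_eq_log_radius_add_posLog (a := w) (c := a) hr.ne'
    rw [Real.circleAverage, smul_eq_mul] at e
    have hmax : Real.log r + Real.posLog (r⁻¹ * ‖a - w‖) = Real.log (max r ‖w - a‖) := by
      rw [norm_sub_rev, Real.posLog, ← Real.log_one]
      rcases le_total r ‖w - a‖ with h' | h'
      · have h1 : 1 ≤ r⁻¹ * ‖w - a‖ := by rwa [inv_mul_eq_div, one_le_div hr]
        have h0 := hr.trans_le h'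
        rw [max_eq_right h', max_eq_right (Real.log_le_log one_pos h1), ← Real.log_mul hr.ne'
          (by positivity)]
        congr 1; field_simp
      · rw [max_eq_left h', max_eq_left, Real.log_one, add_zero]
        rw [Real.log_one]
        refine Real.log_nonpos (by positivity) ?_
        rwa [inv_mul_eq_div, div_le_one hr]
    rw [hmax] at e
    congr 1
    rw [mul_sub, e, intervalIntegral.integral_const, sub_zero, smul_eq_mul]
    field_simp
  · filter_upwards [hne] with θ hθ
    have h2 : ‖circleMap a r θ - w‖ ≤ D := by
      calc ‖circleMap a r θ - w‖ = ‖(circleMap a r θ - a) - (w - a)‖ := by congr 1; ring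
        _ ≤ ‖circleMap a r θ - a‖ + ‖w - a‖ := norm_sub_le _ _
        _ = r + ‖w - a‖ := by rw [circleMap_sub_center, norm_circleMap_zero, abs_of_pos hr]
        _ ≤ D := h
    exact sub_nonneg.2 (Real.log_le_log (norm_pos_iff.2 (sub_ne_zero.2 hθ)) h2)

end HardEdge
end

/-! ### Rotation invariance and Frostman's conditions -/

noncomputable section

namespace HardEdge

/-- The affine map `z ↦ a + c (z - a)`, a rotation about `a` when `|c| = 1`. -/
def rotAbout (a c z : ℂ) : ℂ := a + c * (z - a)

lemma continuous_rotAbout (a c : ℂ) : Continuous (rotAbout a c) := by unfold rotAbout; fun_prop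

lemma rotAbout_sub_rotAbout {a c : ℂ} (hc : ‖c‖ = 1) (z w : ℂ) :
    ‖rotAbout a c z - rotAbout a c w‖ = ‖z - w‖ := by
  rw [show rotAbout a c z - rotAbout a c w = c * (z - w) by unfold rotAbout; ring, norm_mul, hc, one_mul]

lemma norm_rotAbout_sub {a c : ℂ} (hc : ‖c‖ = 1) (z : ℂ) : ‖rotAbout a c z - a‖ = ‖z - a‖ := by
  rw [show rotAbout a c z - a = c * (z - a) by unfold rotAbout; ring, norm_mul, hc, one_mul]

lemma exists_rotAbout_eq {a z w : ℂ} (h : ‖z - a‖ = ‖w - a‖) : ∃ c : ℂ, ‖c‖ = 1 ∧ rotAbout a c z = w := by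
  by_cases hz : z - a = 0
  · refine ⟨1, norm_one, ?_⟩
    rw [hz, norm_zero, eq_comm, norm_eq_zero, sub_eq_zero] at h
    rw [sub_eq_zero] at hz
    simp [rotAbout, hz, h]
  · refine ⟨(w - a) / (z - a), ?_, ?_⟩
    · rw [norm_div, h, div_self]
      rw [← h]; exact norm_ne_zero_iff.2 hz
    · unfold rotAbout; field_simp; ring

lemma posKernel_rotAbout {D : ℝ} {a c : ℂ} (hc : ‖c‖ = 1) (z w : ℂ) :
    posKernel D (rotAbout a c z) (rotAbout a c w) = posKernel D z w := by
  rw [posKernel, posKernel, logKernel, logKernel, ← ofReal_norm, ← ofReal_norm,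
    rotAbout_sub_rotAbout hc]

variable {Q : ℂ → EReal} {a : ℂ} {R : ℝ} {σ ν : Measure ℂ}

lemma IsRadialAbout.mem_interior (hrad : IsRadialAbout Q a) {z w : ℂ} (h : ‖z - a‖ = ‖w - a‖)
    (hz : z ∈ interior (finiteSet Q)) : w ∈ interior (finiteSet Q) := by
  obtain ⟨c, hc, rfl⟩ := exists_rotAbout_eq h.symm
  have : interior (finiteSet Q) ⊆ finiteSet Q := interior_subset
  rw [_root_.mem_interior]
  refine ⟨rotAbout a c ⁻¹' interior (finiteSet Q), fun v hv => ?_,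
    isOpen_interior.preimage (continuous_rotAbout a c), hz⟩
  have h1 : Q (rotAbout a c v) < ⊤ := this hv
  rwa [hrad _ v (norm_rotAbout_sub hc v)] at h1

lemma isConfined_circleMeasure (hrad : IsRadialAbout Q a) {r : ℝ} (hr : 0 < r) (hrR : r ≤ R)
    (h : a + r ∈ interior (finiteSet Q)) : IsConfined Q a R (circleMeasure a r) := by
  refine ⟨inferInstance, Metric.sphere a r, isCompact_sphere a r, fun z hz => ?_,
    Metric.sphere_subset_closedBall.trans (Metric.closedBall_subset_closedBall hrR),
    circleMeasure_sphere a hr.le⟩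
  refine hrad.mem_interior ?_ h
  rw [mem_sphere_iff_norm] at hz
  rw [hz]; simp [abs_of_pos hr]

/-- The average of `log max(r, |w - a|)`; minus the logarithmic potential when the measure is
rotation invariant. -/
def radialPotential (σ : Measure ℂ) (a : ℂ) (r : ℝ) : ℝ := ∫ w, Real.log (max r ‖w - a‖) ∂σ

lemma ae_norm_le (hσ : IsConfined Q a R σ) : ∀ᵐ w ∂σ, ‖w - a‖ ≤ R := by
  obtain ⟨_, K, -, -, hKR, hK0⟩ := hσ
  filter_upwards [mem_ae_iff.2 hK0] with w hw
  exact mem_closedBall_iff_norm.1 (hKR hw)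

lemma integrable_log_max [IsFiniteMeasure σ] (hR : ∀ᵐ w ∂σ, ‖w - a‖ ≤ R) {r : ℝ} (hr : 0 < r) :
    Integrable (fun w => Real.log (max r ‖w - a‖)) σ := by
  refine Integrable.of_bound (C := max |Real.log r| |Real.log (max r R)|)
    (Measurable.aestronglyMeasurable (by fun_prop)) ?_
  filter_upwards [hR] with w hw
  rw [Real.norm_eq_abs]
  refine abs_le_max_abs_abs (Real.log_le_log hr (le_max_left _ _))
    (Real.log_le_log (lt_max_of_lt_left hr) (max_le_max_left _ hw))

lemma mutualEnergy_circleMeasure (hσ : IsConfined Q a R σ) {r : ℝ} (hr : 0 < r) (hrR : r ≤ R) :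
    mutualEnergy (2 * R) σ (circleMeasure a r) =
      ENNReal.ofReal (Real.log (2 * R) - radialPotential σ a r) ∧
    0 ≤ Real.log (2 * R) - radialPotential σ a r := by
  have := hσ.1
  have hI := integrable_log_max (ae_norm_le hσ) hr
  have hb : ∀ᵐ w ∂σ, 0 ≤ Real.log (2 * R) - Real.log (max r ‖w - a‖) := by
    filter_upwards [ae_norm_le hσ] with w hw
    refine sub_nonneg.2 (Real.log_le_log (lt_max_of_lt_left hr) (max_le ?_ ?_)) <;> linarith
  have e : ∫ w, (Real.log (2 * R) - Real.log (max r ‖w - a‖)) ∂σ =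
      Real.log (2 * R) - radialPotential σ a r := by
    rw [integral_sub (integrable_const _) hI, radialPotential]; simp
  refine ⟨?_, ?_⟩
  · have hI' : Integrable (fun w => Real.log (2 * R) - Real.log (max r ‖w - a‖)) σ :=
      (integrable_const _).sub hI
    rw [← e, ofReal_integral_eq_lintegral_ofReal hI' hb, mutualEnergy]
    refine lintegral_congr_ae ?_
    filter_upwards [ae_norm_le hσ] with w hw
    simp_rw [posKernel_comm _ w]
    exact lintegral_posKernel_circleMeasure hr (by linarith)
  · rw [← e]; exact integral_nonneg_of_ae hb

lemma integral_circleMeasure (hrad : IsRadialAbout Q a) {r : ℝ} (hr : 0 ≤ r) :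
    ∫ ζ, (Q ζ).toReal ∂(circleMeasure a r) = (Q (a + r)).toReal := by
  have : ∫ ζ, (Q ζ).toReal ∂(circleMeasure a r) = ∫ _ζ, (Q (a + r)).toReal ∂(circleMeasure a r) := by
    refine integral_congr_ae ?_
    filter_upwards [mem_ae_iff.2 (circleMeasure_sphere a hr)] with ζ hζ
    rw [mem_sphere_iff_norm] at hζ
    rw [hrad ζ (a + r) (by rw [hζ]; simp [abs_of_nonneg hr])]
  rw [this]; simp

lemma isConfined_of_support (hmin : IsEquilibriumMeasure Q σ)
    (hS : σ.support ⊆ interior (finiteSet Q)) (hSR : σ.support ⊆ Metric.closedBall a R) :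
    IsConfined Q a R σ := by
  obtain ⟨⟨hp, K, hK, hK0⟩, -⟩ := hmin
  exact ⟨hp, σ.support, hK.of_isClosed_subset Measure.isClosed_support
    (Measure.support_subset_of_isClosed hK.isClosed (mem_ae_iff.2 hK0)), hS, hSR,
    Measure.measure_compl_support⟩

/-- The uniform measure on a circle in the interior of the finiteness set has finite energy, and
minimality passes finiteness on to σ. -/
lemma mutualEnergy_self_ne_top (hQ : IsAdmissible Q) (hrad : IsRadialAbout Q a) (hR : 1 ≤ R)
    (hmin : IsEquilibriumMeasure Q σ) (hS : σ.support ⊆ interior (finiteSet Q))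
    (hSR : σ.support ⊆ Metric.closedBall a (R / 2)) : mutualEnergy (2 * R) σ σ ≠ ⊤ := by
  have hσ : IsConfined Q a R σ := isConfined_of_support hmin hS
    (hSR.trans (Metric.closedBall_subset_closedBall (by linarith)))
  have := hσ.1
  obtain ⟨z, hz⟩ : σ.support.Nonempty := Measure.nonempty_support (IsProbabilityMeasure.ne_zero σ)
  obtain ⟨ε, hε, hball⟩ := Metric.isOpen_iff.1 isOpen_interior z (hS hz)
  -- The circle through a support point works by radial symmetry. If the support point found is the
  -- centre, a small circle around it is used instead.
  obtain ⟨r, hr, hrR, hmem⟩ : ∃ r : ℝ, 0 < r ∧ r ≤ R ∧ a + r ∈ interior (finiteSet Q) := by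
    by_cases hza : z = a
    · subst hza
      refine ⟨min (ε / 2) R, by positivity, min_le_right _ _, hball ?_⟩
      rw [mem_ball_iff_norm, add_sub_cancel_left, Complex.norm_real, Real.norm_of_nonneg (by positivity)]
      exact (min_le_left _ _).trans_lt (by linarith)
    · have h1 := hSR hz
      rw [mem_closedBall_iff_norm] at h1
      refine ⟨‖z - a‖, norm_pos_iff.2 (sub_ne_zero.2 hza), by linarith, hrad.mem_interior ?_ (hS hz)⟩
      simp
  have hν := isConfined_circleMeasure hrad hr hrR hmem
  exact (hσ.energy_le hQ hR hmin hν (by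
    rw [(mutualEnergy_circleMeasure hν hr hrR).1]; exact ENNReal.ofReal_ne_top)).1

/-- The equilibrium measure of a radial potential is rotation invariant. -/
lemma map_rotAbout_eq (hQ : IsAdmissible Q) (hrad : IsRadialAbout Q a) (hR : 1 ≤ R)
    (hmin : IsEquilibriumMeasure Q σ) (hσ : IsConfined Q a R σ)
    (hfin : mutualEnergy (2 * R) σ σ ≠ ⊤) {c : ℂ} (hc : ‖c‖ = 1) : σ.map (rotAbout a c) = σ := by
  have := hσ.1
  have hm : Measurable (rotAbout a c) := (continuous_rotAbout a c).measurable
  set τ := σ.map (rotAbout a c) with hτ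
  have hpτ : IsProbabilityMeasure τ := Measure.isProbabilityMeasure_map hm.aemeasurable
  have hcτ : IsConfined Q a R τ := by
    obtain ⟨_, K, hK, hKQ, hKR, hK0⟩ := hσ
    refine ⟨hpτ, rotAbout a c '' K, hK.image (continuous_rotAbout a c), ?_, ?_, ?_⟩
    · rintro _ ⟨z, hz, rfl⟩
      exact hrad.mem_interior (norm_rotAbout_sub hc z).symm (hKQ hz)
    · rintro _ ⟨z, hz, rfl⟩
      rw [mem_closedBall_iff_norm, norm_rotAbout_sub hc]
      exact mem_closedBall_iff_norm.1 (hKR hz)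
    · rw [hτ, Measure.map_apply hm
        (hK.image (continuous_rotAbout a c)).isClosed.measurableSet.compl]
      refine measure_mono_null (fun z hz hzK => hz ⟨z, hzK, rfl⟩) hK0
  have hG : ∀ t, gaussEnergy t τ τ = gaussEnergy t σ σ := by
    intro t
    rw [gaussEnergy, hτ, Measure.map_prod_map _ _ hm hm, integral_map (by fun_prop)
      (Measurable.aestronglyMeasurable (by fun_prop)), gaussEnergy]
    simp only [Prod.map_fst, Prod.map_snd, rotAbout_sub_rotAbout hc]
  have hττ : mutualEnergy (2 * R) τ τ = mutualEnergy (2 * R) σ σ := by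
    rw [mutualEnergy_eq_prod, hτ, Measure.map_prod_map _ _ hm hm, lintegral_map
      (measurable_posKernel _) (by fun_prop), mutualEnergy_eq_prod]
    simp only [Prod.map_fst, Prod.map_snd, posKernel_rotAbout hc]
  have hq : ∫ ζ, (Q ζ).toReal ∂τ = ∫ ζ, (Q ζ).toReal ∂σ := by
    rw [hτ, integral_map hm.aemeasurable (hcτ.integrable hQ).aestronglyMeasurable]
    congr 1 with ζ
    rw [hrad _ ζ (norm_rotAbout_sub hc ζ)]
  -- Positive definiteness bounds the mutual energy of σ and its rotation above by the self-energy
  -- of σ; the first variation towards the rotation, whose potential term is the same, gives the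
  -- reverse inequality.
  obtain ⟨h1, h2⟩ := eq_of_mutualEnergy_le (by linarith : 0 < 2 * R) σ τ (hσ.ae_prod_le hσ)
    (hσ.ae_prod_le hcτ) hG hfin
  have hστ := ne_top_of_le_ne_top hfin h1
  have h3 := hσ.first_variation hQ hR hmin hcτ hfin hστ (by rw [hττ]; exact hfin)
  rw [hq] at h3
  refine (h2 ((ENNReal.toReal_le_toReal hfin hστ).1 (by linarith))).symm

/-- As a function of log r, log max(r, y) is nondecreasing and 1-Lipschitz for each y; averaging
keeps both properties. -/
lemma abs_radialPotential_sub_le [IsProbabilityMeasure σ] (hR : ∀ᵐ w ∂σ, ‖w - a‖ ≤ R) {r s : ℝ}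
    (hr : 0 < r) (hrs : r ≤ s) :
    0 ≤ radialPotential σ a s - radialPotential σ a r ∧
    radialPotential σ a s - radialPotential σ a r ≤ Real.log s - Real.log r := by
  have hs := hr.trans_le hrs
  have hIr := integrable_log_max hR hr
  have hIs := integrable_log_max hR hs
  rw [radialPotential, radialPotential, ← integral_sub hIs hIr]
  constructor
  · exact integral_nonneg fun w =>
      sub_nonneg.2 (Real.log_le_log (lt_max_of_lt_left hr) (max_le_max_right _ hrs))
  · have : ∫ w, (Real.log (max s ‖w - a‖) - Real.log (max r ‖w - a‖)) ∂σ ≤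
        ∫ _w, (Real.log s - Real.log r) ∂σ := by
      refine integral_mono (hIs.sub hIr) (integrable_const _) fun w => ?_
      simp only
      rcases le_total ‖w - a‖ r with h | h
      · rw [max_eq_left h, max_eq_left (h.trans hrs)]
      · rw [max_eq_right h]
        have h0 := hr.trans_le h
        rcases le_total ‖w - a‖ s with h' | h'
        · rw [max_eq_left h']; linarith [Real.log_le_log hr h]
        · rw [max_eq_right h', sub_self]; linarith [Real.log_le_log hr hrs]
    simpa using this

lemma continuousAt_radialPotential [IsProbabilityMeasure σ] (hR : ∀ᵐ w ∂σ, ‖w - a‖ ≤ R) {r : ℝ}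
    (hr : 0 < r) : ContinuousAt (radialPotential σ a) r := by
  have hb : ∀ᶠ s in 𝓝 r, ‖radialPotential σ a s - radialPotential σ a r‖ ≤
      |Real.log s - Real.log r| := by
    filter_upwards [lt_mem_nhds hr] with s hs
    rw [Real.norm_eq_abs]
    rcases le_total r s with h | h
    · obtain ⟨h1, h2⟩ := abs_radialPotential_sub_le hR hr h
      rw [abs_of_nonneg h1]; exact h2.trans (le_abs_self _)
    · obtain ⟨h1, h2⟩ := abs_radialPotential_sub_le hR hs h
      rw [abs_sub_comm, abs_of_nonneg h1, abs_sub_comm]; exact h2.trans (le_abs_self _)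
  rw [ContinuousAt, tendsto_iff_norm_sub_tendsto_zero]
  refine squeeze_zero' (Eventually.of_forall fun _ => norm_nonneg _) hb ?_
  have : Tendsto (fun s => |Real.log s - Real.log r|) (𝓝 r) (𝓝 |Real.log r - Real.log r|) :=
    ((Real.continuousAt_log hr.ne').tendsto.sub tendsto_const_nhds).abs
  simpa using this

/-- Frostman's conditions for the equilibrium measure of a radial potential. -/
lemma exists_frostman (hQ : IsAdmissible Q) (hrad : IsRadialAbout Q a) (hR : 1 ≤ R)
    (hmin : IsEquilibriumMeasure Q σ) (hσ : IsConfined Q a R σ)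
    (hS : σ.support ⊆ interior (finiteSet Q)) (hSR : σ.support ⊆ Metric.closedBall a R)
    (hfin : mutualEnergy (2 * R) σ σ ≠ ⊤) :
    ∃ κ : ℝ, (∀ r : ℝ, 0 < r → r ≤ R → a + r ∈ interior (finiteSet Q) →
        κ ≤ (Q (a + r)).toReal - 2 * radialPotential σ a r) ∧
      ∀ z ∈ σ.support, z ≠ a → (Q z).toReal - 2 * radialPotential σ a ‖z - a‖ = κ := by
  have := hσ.1
  set E := (mutualEnergy (2 * R) σ σ).toReal with hE
  set q := ∫ ζ, (Q ζ).toReal ∂σ with hq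
  set U : ℂ → ENNReal := fun z => ∫⁻ w, posKernel (2 * R) z w ∂σ with hU
  have hUm : Measurable U := (measurable_posKernel (2 * R)).lintegral_prod_right
  have h1 : ∀ r : ℝ, 0 < r → r ≤ R → a + r ∈ interior (finiteSet Q) →
      2 * (E - Real.log (2 * R)) + q ≤ (Q (a + r)).toReal - 2 * radialPotential σ a r := by
    intro r hr hrR hmem
    have hν := isConfined_circleMeasure hrad hr hrR hmem
    obtain ⟨e1, e2⟩ := mutualEnergy_circleMeasure hσ hr hrR
    have e3 := (mutualEnergy_circleMeasure hν hr hrR).1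
    have := hσ.first_variation hQ hR hmin hν hfin (by rw [e1]; exact ENNReal.ofReal_ne_top)
      (by rw [e3]; exact ENNReal.ofReal_ne_top)
    rw [e1, ENNReal.toReal_ofReal e2, integral_circleMeasure hrad hr.le] at this
    linarith
  have h1' : ∀ z ∈ σ.support, z ≠ a → 2 * (E - Real.log (2 * R)) + q ≤
      (Q z).toReal - 2 * radialPotential σ a ‖z - a‖ := by
    intro z hz hza
    have hn : ‖z - a‖ = ‖a + (‖z - a‖ : ℂ) - a‖ := by simp
    have hzR := hSR hz
    rw [mem_closedBall_iff_norm] at hzR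
    rw [hrad z _ hn]
    exact h1 _ (norm_pos_iff.2 (sub_ne_zero.2 hza)) hzR (hrad.mem_interior hn (hS hz))
  refine ⟨2 * (E - Real.log (2 * R)) + q, h1, ?_⟩
  -- Rotation invariance of σ makes its potential constant on circles about `a`. The potential at a
  -- support point therefore equals its average over the circle, which has already been computed.
  have hUrot : ∀ c : ℂ, ‖c‖ = 1 → ∀ z, U (rotAbout a c z) = U z := by
    intro c hc z
    have hrot := map_rotAbout_eq hQ hrad hR hmin hσ hfin hc
    simp only [hU]
    conv_lhs => rw [← hrot]
    rw [lintegral_map (Measurable.of_uncurry_left (f := posKernel (2 * R)) (measurable_posKernel _))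
      (continuous_rotAbout a c).measurable]
    simp only [posKernel_rotAbout hc]
  have hUval : ∀ z ∈ σ.support, z ≠ a →
      U z = ENNReal.ofReal (Real.log (2 * R) - radialPotential σ a ‖z - a‖) := by
    intro z hz hza
    have hr := norm_pos_iff.2 (sub_ne_zero.2 hza)
    have hzR := hSR hz
    rw [mem_closedBall_iff_norm] at hzR
    rw [← (mutualEnergy_circleMeasure hσ hr hzR).1, mutualEnergy_comm]
    have : ∫⁻ w, U w ∂(circleMeasure a ‖z - a‖) = ∫⁻ _w, U z ∂(circleMeasure a ‖z - a‖) := by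
      refine lintegral_congr_ae ?_
      filter_upwards [mem_ae_iff.2 (circleMeasure_sphere a hr.le)] with w hw
      rw [mem_sphere_iff_norm] at hw
      obtain ⟨c, hc, rfl⟩ := exists_rotAbout_eq hw.symm
      exact hUrot c hc z
    rw [mutualEnergy]
    simp only [hU] at this ⊢
    rw [this]; simp
  have hEU : ∫⁻ z, U z ∂σ = mutualEnergy (2 * R) σ σ := rfl
  have hUfin : ∀ᵐ z ∂σ, U z < ⊤ := ae_lt_top hUm (by rw [hEU]; exact hfin)
  -- An atom at `a` would make the potential infinite on a set of positive mass, contradicting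
  -- finite energy.
  have hane : ∀ᵐ z ∂σ, z ≠ a := by
    have hUa : U a = ⊤ ∨ σ {a} = 0 := by
      by_cases h : σ {a} = 0
      · exact Or.inr h
      · left
        rw [← top_le_iff]
        calc ⊤ = ∫⁻ w in {a}, posKernel (2 * R) a w ∂σ := by
              rw [lintegral_singleton, posKernel_self, ENNReal.top_mul h]
          _ ≤ U a := setLIntegral_le_lintegral _ _
    rcases hUa with h | h
    · filter_upwards [hUfin] with z hz hza
      rw [hza, h] at hz; exact lt_irrefl _ hz
    · exact compl_mem_ae_iff.2 h
  have hUI : Integrable (fun z => (U z).toReal) σ :=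
    integrable_toReal_of_lintegral_ne_top hUm.aemeasurable (by rw [hEU]; exact hfin)
  have hUint : ∫ z, (U z).toReal ∂σ = E := by
    rw [integral_toReal hUm.aemeasurable hUfin, hEU]
  have hsupp : ∀ᵐ z ∂σ, z ∈ σ.support := Measure.support_mem_ae
  have hΨ : ∀ᵐ z ∂σ, (Q z).toReal - 2 * radialPotential σ a ‖z - a‖ =
      2 * (E - Real.log (2 * R)) + q := by
    have hval : ∀ᵐ z ∂σ, (U z).toReal = Real.log (2 * R) - radialPotential σ a ‖z - a‖ := by
      filter_upwards [hsupp, hane] with z hz hza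
      have hzR := hSR hz
      rw [mem_closedBall_iff_norm] at hzR
      rw [hUval z hz hza, ENNReal.toReal_ofReal
        (mutualEnergy_circleMeasure hσ (norm_pos_iff.2 (sub_ne_zero.2 hza)) hzR).2]
    have hI' : Integrable (fun z => (Q z).toReal + 2 * (U z).toReal) σ :=
      (hσ.integrable hQ).add (hUI.const_mul 2)
    have hI : Integrable (fun z => (Q z).toReal + 2 * (U z).toReal - (2 * E + q)) σ :=
      hI'.sub (integrable_const _)
    -- The defect in the Frostman inequality is nonnegative and has σ-mean q + 2E - (2E + q) = 0, so
    -- it vanishes almost everywhere.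
    have h0 : ∫ z, ((Q z).toReal + 2 * (U z).toReal - (2 * E + q)) ∂σ = 0 := by
      rw [integral_sub hI' (integrable_const _),
        integral_add (hσ.integrable hQ) (hUI.const_mul 2), integral_const_mul, hUint]
      simp [← hq]; ring
    have hnn : 0 ≤ᵐ[σ] fun z => (Q z).toReal + 2 * (U z).toReal - (2 * E + q) := by
      filter_upwards [hsupp, hane, hval] with z hz hza hv
      have := h1' z hz hza
      simp only [Pi.zero_apply]
      rw [hv]; linarith
    have := (integral_eq_zero_iff_of_nonneg_ae hnn hI).1 h0
    filter_upwards [this, hval] with z hz hv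
    simp only [Pi.zero_apply] at hz
    rw [hv] at hz; linarith
  intro z hz hza
  refine le_antisymm ?_ (h1' z hz hza)
  by_contra hcon
  push Not at hcon
  -- A strict inequality at a support point would persist on a neighbourhood, which has positive
  -- mass; hence equality holds at every support point other than `a`.
  have hcont : ContinuousAt (fun z => (Q z).toReal - 2 * radialPotential σ a ‖z - a‖) z := by
    refine ContinuousAt.sub ?_ (ContinuousAt.mul continuousAt_const ?_)
    · exact hQ.analytic.continuousOn.continuousAt (isOpen_interior.mem_nhds (hS hz))
    · exact ContinuousAt.comp (g := radialPotential σ a) (f := fun z => ‖z - a‖)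
        (continuousAt_radialPotential (ae_norm_le hσ) (norm_pos_iff.2 (sub_ne_zero.2 hza)))
        (by fun_prop)
  have hnhds := hcont.eventually (lt_mem_nhds hcon)
  have hpos := (Measure.mem_support_iff_forall z).1 hz _ hnhds
  refine hpos.ne' (measure_mono_null ?_ hΨ)
  intro w hw hw'
  exact (ne_of_gt hw) hw'

end HardEdge
end

/-! ### Squared determinants of orthogonal functions -/

noncomputable section

namespace HardEdge

section Determinantal

variable {μ : Measure ℂ} [SigmaFinite μ] {w : ℂ → ℝ} {φ : ℕ → ℂ → ℂ} {h : ℕ → ℝ}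

/-- The matrix `φ_j(x_i)`. -/
def evalMatrix (φ : ℕ → ℂ → ℂ) {n : ℕ} (x : Fin n → ℂ) : Matrix (Fin n) (Fin n) ℂ :=
  Matrix.of fun i j => φ j (x i)

lemma det_evalMatrix_mul_conj (φ : ℕ → ℂ → ℂ) {n : ℕ} (x : Fin n → ℂ) :
    (evalMatrix φ x).det * (starRingEnd ℂ) (evalMatrix φ x).det =
      ∑ π : Equiv.Perm (Fin n), ∑ τ : Equiv.Perm (Fin n),
        ((Equiv.Perm.sign π : ℤ) : ℂ) * ((Equiv.Perm.sign τ : ℤ) : ℂ) *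
          ∏ i, φ (π i) (x i) * (starRingEnd ℂ) (φ (τ i) (x i)) := by
  rw [← Matrix.det_transpose, Matrix.det_apply', map_sum, Finset.sum_mul_sum]
  refine Finset.sum_congr rfl fun π _ => Finset.sum_congr rfl fun τ _ => ?_
  simp only [Matrix.transpose_apply, evalMatrix, Matrix.of_apply, map_mul, map_prod, map_intCast,
    Finset.prod_mul_distrib]
  ring

/-- Expand the determinant and its conjugate over permutations π and τ and integrate out all
variables but the first. Orthogonality kills every pair with π ≠ τ, and the signs cancel when π = τ.
-/
lemma integral_det_evalMatrix_cons
    (hintg : ∀ j l, Integrable (fun z => φ j z * (starRingEnd ℂ) (φ l z) * (w z : ℂ)) μ)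
    (horth : ∀ j l, ∫ z, φ j z * (starRingEnd ℂ) (φ l z) * (w z : ℂ) ∂μ =
      if j = l then (h j : ℂ) else 0) (m : ℕ) (ζ : ℂ) :
    Integrable (fun η : Fin m → ℂ =>
      ‖(evalMatrix φ (Fin.cons ζ η : Fin (m + 1) → ℂ)).det‖ ^ 2 * ∏ i, w (η i))
      (Measure.pi fun _ => μ) ∧
    ∫ η : Fin m → ℂ, ‖(evalMatrix φ (Fin.cons ζ η : Fin (m + 1) → ℂ)).det‖ ^ 2 * ∏ i, w (η i)
      ∂(Measure.pi fun _ => μ) =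
      ∑ π : Equiv.Perm (Fin (m + 1)), ‖φ (π 0) ζ‖ ^ 2 * ∏ i : Fin m, h (π i.succ) := by
  have key : ∀ η : Fin m → ℂ,
      ((‖(evalMatrix φ (Fin.cons ζ η : Fin (m + 1) → ℂ)).det‖ ^ 2 * ∏ i, w (η i) : ℝ) : ℂ) =
      ∑ π : Equiv.Perm (Fin (m + 1)), ∑ τ : Equiv.Perm (Fin (m + 1)),
        (((Equiv.Perm.sign π : ℤ) : ℂ) * ((Equiv.Perm.sign τ : ℤ) : ℂ) *
          (φ (π 0) ζ * (starRingEnd ℂ) (φ (τ 0) ζ))) *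
          ∏ i : Fin m, (φ (π i.succ) (η i) * (starRingEnd ℂ) (φ (τ i.succ) (η i)) * (w (η i) : ℂ)) := by
    intro η
    rw [Complex.ofReal_mul, ← Complex.normSq_eq_norm_sq, ← Complex.mul_conj,
      det_evalMatrix_mul_conj, Finset.sum_mul]
    refine Finset.sum_congr rfl fun π _ => ?_
    rw [Finset.sum_mul]
    refine Finset.sum_congr rfl fun τ _ => ?_
    rw [Fin.prod_univ_succ, Complex.ofReal_prod]
    simp only [Fin.cons_zero, Fin.cons_succ]
    rw [Finset.prod_mul_distrib (g := fun i => (w (η i) : ℂ))]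
    ring
  have hI : ∀ π τ : Equiv.Perm (Fin (m + 1)), Integrable (fun η : Fin m → ℂ =>
      (((Equiv.Perm.sign π : ℤ) : ℂ) * ((Equiv.Perm.sign τ : ℤ) : ℂ) *
          (φ (π 0) ζ * (starRingEnd ℂ) (φ (τ 0) ζ))) *
          ∏ i : Fin m, (φ (π i.succ) (η i) * (starRingEnd ℂ) (φ (τ i.succ) (η i)) * (w (η i) : ℂ)))
        (Measure.pi fun _ => μ) := fun π τ =>
    (Integrable.fintype_prod (f := fun i z => φ (π (Fin.succ i)) z *
      (starRingEnd ℂ) (φ (τ (Fin.succ i)) z) * (w z : ℂ)) fun i => hintg _ _).const_mul _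
  constructor
  · have h1 : Integrable (fun η : Fin m → ℂ =>
        ((‖(evalMatrix φ (Fin.cons ζ η : Fin (m + 1) → ℂ)).det‖ ^ 2 * ∏ i, w (η i) : ℝ) : ℂ))
        (Measure.pi fun _ => μ) := by
      simp_rw [key]
      exact integrable_finsetSum _ fun π _ => integrable_finsetSum _ fun τ _ => hI π τ
    exact h1.re
  · apply Complex.ofReal_injective
    rw [← integral_complex_ofReal]
    simp_rw [key]
    rw [integral_finsetSum _ fun π _ => integrable_finsetSum _ fun τ _ => hI π τ, Complex.ofReal_sum]
    refine Finset.sum_congr rfl fun π _ => ?_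
    rw [integral_finsetSum _ fun τ _ => hI π τ, Finset.sum_eq_single π]
    · rw [integral_const_mul, integral_fintype_prod_eq_prod (𝕜 := ℂ) (fun (i : Fin m) z =>
        φ (π (Fin.succ i)) z * (starRingEnd ℂ) (φ (π (Fin.succ i)) z) * (w z : ℂ))]
      simp_rw [horth, if_true]
      rw [← Int.cast_mul, ← Units.val_mul, Int.units_mul_self, Units.val_one, Int.cast_one, one_mul,
        Complex.mul_conj, Complex.normSq_eq_norm_sq]
      push_cast; rfl
    · intro τ _ hτ
      rw [integral_const_mul, integral_fintype_prod_eq_prod (𝕜 := ℂ) (fun (i : Fin m) z =>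
        φ (π (Fin.succ i)) z * (starRingEnd ℂ) (φ (τ (Fin.succ i)) z) * (w z : ℂ))]
      simp_rw [horth]
      -- Only the indices `i.succ` are integrated. Two permutations agreeing on all of these also
      -- agree at 0, so distinct ones differ at an integrated index.
      obtain ⟨i, hi⟩ : ∃ i : Fin m, π i.succ ≠ τ i.succ := by
        by_contra hcon
        push Not at hcon
        apply hτ
        have hpt : ∀ i : Fin m, τ i.succ = π i.succ := fun i => (hcon i).symm
        have : τ⁻¹ * π = 1 := by
          have hs : ∀ i : Fin m, (τ⁻¹ * π) i.succ = i.succ := fun i => by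
            rw [Equiv.Perm.mul_apply, hcon i]; exact τ.symm_apply_apply _
          ext i
          refine Fin.cases ?_ (fun i => by rw [hs i]; rfl) i
          by_contra h0
          have h0' : (τ⁻¹ * π) 0 ≠ 0 := fun hh => h0 (by rw [hh]; rfl)
          obtain ⟨k, hk⟩ := Fin.exists_succ_eq.2 h0'
          have := (τ⁻¹ * π).injective (hk.symm.trans (hs k).symm)
          exact absurd this (Fin.succ_ne_zero k).symm
        exact (inv_mul_eq_one.1 this)
      rw [Finset.prod_eq_zero (Finset.mem_univ i), mul_zero]
      exact if_neg fun hh => hi (Fin.val_injective hh)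
    · simp

lemma sum_perm_apply_zero {m : ℕ} (g : Fin (m + 1) → ℝ) :
    ∑ π : Equiv.Perm (Fin (m + 1)), g (π 0) = m.factorial * ∑ j, g j := by
  rw [← Equiv.sum_comp Equiv.Perm.decomposeFin.symm, Fintype.sum_prod_type, Finset.mul_sum]
  refine Finset.sum_congr rfl fun j _ => ?_
  simp [Equiv.Perm.decomposeFin_symm_apply_zero, Fintype.card_perm]

/-- Each term is g/h at the index π(0) times the full product of the h's, and each value of π(0) is
taken by m! permutations. -/
lemma sum_perm_mul_prod {m : ℕ} (hh : ∀ j, h j ≠ 0) (g : ℕ → ℝ) :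
    ∑ π : Equiv.Perm (Fin (m + 1)), g (π 0) * ∏ i : Fin m, h (π i.succ) =
      m.factorial * (∏ i : Fin (m + 1), h i) * ∑ j ∈ Finset.range (m + 1), g j / h j := by
  have h1 : ∀ π : Equiv.Perm (Fin (m + 1)), g (π 0) * ∏ i : Fin m, h (π i.succ) =
      (g (π 0) / h (π 0)) * ∏ i : Fin (m + 1), h i := by
    intro π
    rw [← Equiv.prod_comp π (fun i => h i), Fin.prod_univ_succ]
    have := hh (π 0)
    field_simp
  simp_rw [h1]
  rw [← Finset.sum_mul, sum_perm_apply_zero (fun j => g j / h j), Finset.sum_range]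
  ring

end Determinantal

/-! ### The one-point function of a radial ensemble -/

section OnePoint

lemma exp_neg_sum {ι : Type*} (s : Finset ι) (f : ι → EReal) (hf : ∀ i ∈ s, f i ≠ ⊥) :
    ∑ i ∈ s, f i ≠ ⊥ ∧ EReal.exp (-∑ i ∈ s, f i) = ∏ i ∈ s, EReal.exp (-f i) := by
  classical
  induction s using Finset.induction_on with
  | empty => simp
  | insert i s hi ih =>
    obtain ⟨h1, h2⟩ := ih fun j hj => hf j (Finset.mem_insert_of_mem hj)
    have h3 := hf i (Finset.mem_insert_self i s)
    rw [Finset.sum_insert hi, Finset.prod_insert hi]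
    refine ⟨by simp [EReal.add_eq_bot_iff, h1, h3], ?_⟩
    rw [EReal.neg_add (Or.inl h3) (Or.inr h1), sub_eq_add_neg, EReal.exp_add, h2]

/-- The exponential turns sums into products. In `EReal`, negation distributes over a sum only if ∞
and -∞ do not meet, so no summand may be ⊥. -/
lemma exp_neg_hamiltonian {V : ℂ → EReal} (hV : ∀ ζ, V ζ ≠ ⊥) (n : ℕ) (ζ : Fin n → ℂ) :
    EReal.exp (-hamiltonian V n ζ) =
      (∏ j, ∏ k ∈ Finset.univ.erase j, ‖ζ j - ζ k‖ₑ) * ∏ j, EReal.exp (-V (ζ j)) ^ n := by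
  have h1 : ∀ j, ∑ k ∈ Finset.univ.erase j, logKernel (ζ j) (ζ k) ≠ ⊥ ∧ _ := fun j =>
    exp_neg_sum (Finset.univ.erase j) (fun k => logKernel (ζ j) (ζ k)) fun k _ => logKernel_ne_bot _ _
  obtain ⟨h2, h2'⟩ := exp_neg_sum Finset.univ (fun j => ∑ k ∈ Finset.univ.erase j, logKernel (ζ j) (ζ k))
    fun j _ => (h1 j).1
  obtain ⟨h3, h3'⟩ := exp_neg_sum Finset.univ (fun j => V (ζ j)) fun j _ => hV _
  have h4 : (n : EReal) * ∑ j, V (ζ j) ≠ ⊥ := by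
    rcases Nat.eq_zero_or_pos n with hn | hn
    · subst hn; simp
    · intro hb
      rw [EReal.mul_eq_bot] at hb
      have hn' : (0 : EReal) < n := by exact_mod_cast hn
      rcases hb with h | h | h | h
      · exact EReal.natCast_ne_bot n h.1
      · exact h3 h.2
      · exact EReal.natCast_ne_top n h.1
      · exact absurd h.1 (not_lt.2 hn'.le)
  rw [hamiltonian, EReal.neg_add (Or.inl h2) (Or.inr h4), sub_eq_add_neg, EReal.exp_add, h2',
    ← mul_neg, EReal.exp_nmul, h3', Finset.prod_pow]
  congr 1
  refine Finset.prod_congr rfl fun j _ => ?_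
  rw [(h1 j).2]
  refine Finset.prod_congr rfl fun k _ => ?_
  rw [logKernel, neg_neg, ENNReal.exp_log]

/-- The product over ordered pairs is the squared modulus of the Vandermonde determinant, which may
be formed with powers of z - a because only differences enter. -/
lemma prod_enorm_sub {n : ℕ} (a : ℂ) (ζ : Fin n → ℂ) :
    ∏ j, ∏ k ∈ Finset.univ.erase j, ‖ζ j - ζ k‖ₑ =
      ENNReal.ofReal (‖(evalMatrix (fun j z => (z - a) ^ j) ζ).det‖ ^ 2) := by
  have h1 : evalMatrix (fun j z => (z - a) ^ j) ζ = Matrix.vandermonde fun i => ζ i - a := by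
    ext i j; simp [evalMatrix, Matrix.vandermonde_apply]
  have h2 := Finset.prod_prod_Ioi_mul_eq_prod_prod_off_diag fun j i : Fin n => ‖ζ i - ζ j‖ₑ
  rw [h1, Matrix.det_vandermonde, ENNReal.ofReal_pow (norm_nonneg _), ofReal_norm]
  have h3 : ‖∏ i, ∏ j ∈ Finset.Ioi i, (ζ j - a - (ζ i - a))‖ₑ =
      ∏ i, ∏ j ∈ Finset.Ioi i, ‖ζ j - ζ i‖ₑ := by
    rw [← ofReal_norm, norm_prod, ENNReal.ofReal_prod_of_nonneg fun _ _ => norm_nonneg _]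
    refine Finset.prod_congr rfl fun i _ => ?_
    rw [norm_prod, ENNReal.ofReal_prod_of_nonneg fun _ _ => norm_nonneg _]
    refine Finset.prod_congr rfl fun j _ => ?_
    rw [ofReal_norm]; congr 1; ring
  rw [h3]
  calc _ = ∏ i, ∏ j ∈ ({i} : Finset (Fin n))ᶜ, ‖ζ i - ζ j‖ₑ := by
        refine Finset.prod_congr rfl fun i _ => Finset.prod_congr ?_ fun _ _ => rfl
        ext; simp
    _ = _ := h2.symm
    _ = _ := by
      rw [← Finset.prod_pow]
      refine Finset.prod_congr rfl fun i _ => ?_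
      rw [← Finset.prod_pow]
      refine Finset.prod_congr rfl fun j _ => ?_
      rw [sq, ← ofReal_norm, ← ofReal_norm, norm_sub_rev]

lemma dA_eq : dA = (Real.toNNReal Real.pi)⁻¹ • (volume : Measure ℂ) := by
  rw [dA, ENNReal.ofReal, ← ENNReal.coe_inv (by simpa using Real.pi_pos)]
  rfl

instance : SigmaFinite dA := by rw [dA_eq]; infer_instance

instance : IsFiniteMeasureOnCompacts dA := by rw [dA_eq]; infer_instance

lemma measurePreserving_rotAbout (a : ℂ) {c : ℂ} (hc : ‖c‖ = 1) :
    MeasurePreserving (rotAbout a c) dA dA := by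
  have h1 : MeasurePreserving (rotAbout a c) volume volume := by
    have e : rotAbout a c = (fun z => a + z) ∘
        (rotation ⟨c, mem_sphere_zero_iff_norm.2 hc⟩) ∘ fun z => z - a := by
      ext z; rfl
    rw [e]
    exact (measurePreserving_add_left volume a).comp
      ((LinearIsometryEquiv.measurePreserving _).comp (measurePreserving_sub_right volume a))
  exact h1.smul_measure _

variable {Q : ℂ → EReal} {S : Set ℂ} {a : ℂ}

/-- The weight `e^{-nQ}` on `S`. -/
def weight (Q : ℂ → EReal) (S : Set ℂ) (n : ℕ) (ζ : ℂ) : ℝ :=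
  S.indicator (fun ζ => Real.exp (-(n * (Q ζ).toReal))) ζ

/-- The squared norm of the monomial `(ζ - a)^j` in the weighted space. -/
def monomialNorm (Q : ℂ → EReal) (S : Set ℂ) (a : ℂ) (n j : ℕ) : ℝ :=
  ∫ z, ‖z - a‖ ^ (2 * j) * weight Q S n z ∂dA

lemma weight_nonneg (n : ℕ) (ζ : ℂ) : 0 ≤ weight Q S n ζ :=
  indicator_nonneg (fun _ _ => (Real.exp_pos _).le) _

/-- Off S the base is 0, so n ≠ 0 is needed to exclude 0⁰ = 1. -/
lemma exp_neg_localized_pow (hfin : ∀ ζ ∈ S, Q ζ ≠ ⊤ ∧ Q ζ ≠ ⊥) {n : ℕ} (hn : n ≠ 0) (ζ : ℂ) :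
    EReal.exp (-localized Q S ζ) ^ n = ENNReal.ofReal (weight Q S n ζ) := by
  by_cases hζ : ζ ∈ S
  · obtain ⟨h1, h2⟩ := hfin ζ hζ
    rw [localized, if_pos hζ, weight, indicator_of_mem hζ, ← EReal.coe_toReal h1 h2, ← EReal.coe_neg,
      EReal.exp_coe, ← ENNReal.ofReal_pow (Real.exp_pos _).le, ← Real.exp_nat_mul, EReal.toReal_coe]
    congr 2; ring
  · rw [localized, if_neg hζ, weight, indicator_of_notMem hζ]
    simp [hn]

lemma integrable_mul_weight (hS : IsCompact S) (hc : ContinuousOn (fun ζ => (Q ζ).toReal) S)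
    (n : ℕ) {f : ℂ → ℂ} (hf : Continuous f) :
    Integrable (fun z => f z * (weight Q S n z : ℂ)) dA := by
  have h1 : IntegrableOn (fun z => f z * (Real.exp (-(n * (Q z).toReal)) : ℂ)) S dA := by
    refine ContinuousOn.integrableOn_compact hS ?_
    refine hf.continuousOn.mul (Complex.continuous_ofReal.comp_continuousOn ?_)
    exact Real.continuous_exp.comp_continuousOn ((continuousOn_const.mul hc).neg)
  rw [← integrable_indicator_iff hS.measurableSet] at h1
  refine h1.congr (Eventually.of_forall fun z => ?_)
  by_cases hz : z ∈ S
  · simp [weight, hz]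
  · simp [weight, hz]

lemma integral_monomial_mul_conj (hrad : IsRadialAbout Q a)
    (hSrot : ∀ z w : ℂ, ‖z - a‖ = ‖w - a‖ → z ∈ S → w ∈ S) (n j l : ℕ) :
    ∫ z, (z - a) ^ j * (starRingEnd ℂ) ((z - a) ^ l) * (weight Q S n z : ℂ) ∂dA =
      if j = l then (monomialNorm Q S a n j : ℂ) else 0 := by
  split_ifs with hjl
  · subst hjl
    rw [monomialNorm, ← integral_complex_ofReal]
    congr 1 with z
    rw [Complex.mul_conj, Complex.normSq_eq_norm_sq, norm_pow]
    push_cast; ring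
  · have hd : ((j : ℂ) - l) ≠ 0 := by
      rw [sub_ne_zero]; exact_mod_cast hjl
    -- This angle satisfies e^{i(j-l)t} = -1, so the corresponding rotation changes the sign of the
    -- integrand while preserving the measure and the weight. The integral equals its own negative.
    set t : ℝ := Real.pi / ((j : ℝ) - l) with ht
    set c : ℂ := Complex.exp (t * Complex.I) with hc
    have hc1 : ‖c‖ = 1 := Complex.norm_exp_ofReal_mul_I t
    have hcc : c ^ j * (starRingEnd ℂ) (c ^ l) = -1 := by
      rw [hc, map_pow, ← Complex.exp_conj, ← Complex.exp_nat_mul, ← Complex.exp_nat_mul,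
        ← Complex.exp_add, ← Complex.exp_pi_mul_I]
      congr 1
      simp only [map_mul, Complex.conj_ofReal, Complex.conj_I, ht]
      push_cast
      field_simp
      ring
    have hw : ∀ z, weight Q S n (rotAbout a c z) = weight Q S n z := by
      intro z
      have hn := norm_rotAbout_sub (a := a) hc1 z
      unfold weight
      by_cases hz : z ∈ S
      · rw [indicator_of_mem hz, indicator_of_mem (hSrot _ _ hn.symm hz), hrad _ _ hn]
      · rw [indicator_of_notMem hz, indicator_of_notMem fun h => hz (hSrot _ _ hn h)]
    have hemb : MeasurableEmbedding (rotAbout a c) := by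
      refine (continuous_rotAbout a c).measurableEmbedding fun z w hzw => ?_
      rw [← sub_eq_zero, ← norm_eq_zero, ← rotAbout_sub_rotAbout (a := a) hc1, hzw, sub_self, norm_zero]
    have := (measurePreserving_rotAbout a hc1).integral_comp hemb
      (fun z => (z - a) ^ j * (starRingEnd ℂ) ((z - a) ^ l) * (weight Q S n z : ℂ))
    simp_rw [hw] at this
    have h2 : ∀ z, (rotAbout a c z - a) ^ j * (starRingEnd ℂ) ((rotAbout a c z - a) ^ l) *
        (weight Q S n z : ℂ) =
        -((z - a) ^ j * (starRingEnd ℂ) ((z - a) ^ l) * (weight Q S n z : ℂ)) := by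
      intro z
      rw [show rotAbout a c z - a = c * (z - a) by unfold rotAbout; ring, mul_pow, mul_pow, map_mul]
      calc _ = (c ^ j * (starRingEnd ℂ) (c ^ l)) *
            ((z - a) ^ j * (starRingEnd ℂ) ((z - a) ^ l) * (weight Q S n z : ℂ)) := by ring
        _ = _ := by rw [hcc]; ring
    simp_rw [h2] at this
    rw [integral_neg] at this
    exact self_eq_neg.1 this.symm

/-- The one-point function of a rotation invariant ensemble. -/
lemma onePoint_eq_sum (hS : IsCompact S) (hc : ContinuousOn (fun ζ => (Q ζ).toReal) S)
    (hQm : Measurable Q) (hbot : ∀ ζ, Q ζ ≠ ⊥) (hfin : ∀ ζ ∈ S, Q ζ ≠ ⊤) (hrad : IsRadialAbout Q a)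
    (hSrot : ∀ z w : ℂ, ‖z - a‖ = ‖w - a‖ → z ∈ S → w ∈ S) {n : ℕ}
    (hpos : ∀ j, 0 < monomialNorm Q S a n j) (ζ : ℂ) :
    onePoint (localized Q S) n ζ = weight Q S n ζ *
      ∑ j ∈ Finset.range n, ‖ζ - a‖ ^ (2 * j) / monomialNorm Q S a n j := by
  obtain _ | m := n
  · simp [onePoint]
  set φ : ℕ → ℂ → ℂ := fun j z => (z - a) ^ j with hφ
  set w := weight Q S (m + 1) with hw
  set h := monomialNorm Q S a (m + 1) with hh
  have hwn : ∀ z, 0 ≤ w z := fun z => weight_nonneg _ z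
  have hintg : ∀ j l, Integrable (fun z => φ j z * (starRingEnd ℂ) (φ l z) * (w z : ℂ)) dA :=
    fun j l => integrable_mul_weight hS hc _ (by fun_prop)
  have horth := integral_monomial_mul_conj (n := m + 1) hrad hSrot
  have hV : ∀ ζ, localized Q S ζ ≠ ⊥ := by
    intro ζ; unfold localized; split_ifs
    · exact hbot ζ
    · simp
  have hexp : ∀ x : Fin (m + 1) → ℂ, EReal.exp (-hamiltonian (localized Q S) (m + 1) x) =
      ENNReal.ofReal (‖(evalMatrix φ x).det‖ ^ 2 * ∏ i, w (x i)) := by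
    intro x
    rw [exp_neg_hamiltonian hV, prod_enorm_sub a, ENNReal.ofReal_mul (by positivity),
      ENNReal.ofReal_prod_of_nonneg fun _ _ => hwn _]
    congr 1
    exact Finset.prod_congr rfl fun i _ =>
      exp_neg_localized_pow (fun ζ hζ => ⟨hfin ζ hζ, hbot ζ⟩) (Nat.succ_ne_zero m) _
  set P := ∏ i : Fin (m + 1), h i with hP
  have hP0 : 0 < P := Finset.prod_pos fun i _ => hpos _
  have hinner : ∀ z : ℂ, ∫⁻ η : Fin m → ℂ,
      EReal.exp (-hamiltonian (localized Q S) (m + 1) (Fin.cons z η)) ∂(Measure.pi fun _ => dA) =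
      ENNReal.ofReal (m.factorial * P *
        (w z * ∑ j ∈ Finset.range (m + 1), ‖z - a‖ ^ (2 * j) / h j)) := by
    intro z
    obtain ⟨hI, hv⟩ := integral_det_evalMatrix_cons (h := h) hintg horth m z
    have e1 : ∀ η : Fin m → ℂ, EReal.exp (-hamiltonian (localized Q S) (m + 1) (Fin.cons z η)) =
        ENNReal.ofReal (w z * (‖(evalMatrix φ (Fin.cons z η : Fin (m + 1) → ℂ)).det‖ ^ 2 *
          ∏ i, w (η i))) := by
      intro η
      rw [hexp, Fin.prod_univ_succ]
      simp only [Fin.cons_zero, Fin.cons_succ]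
      congr 1; ring
    simp_rw [e1]
    rw [← ofReal_integral_eq_lintegral_ofReal (hI.const_mul _)
      (Eventually.of_forall fun η => mul_nonneg (hwn _)
        (mul_nonneg (by positivity) (Finset.prod_nonneg fun _ _ => hwn _))),
      integral_const_mul, hv]
    congr 1
    have := sum_perm_mul_prod (h := h) (m := m) (fun j => (hpos j).ne') fun j => ‖φ j z‖ ^ 2
    rw [this]
    have e2 : ∀ j, ‖φ j z‖ ^ 2 = ‖z - a‖ ^ (2 * j) := by
      intro j; rw [hφ, norm_pow, ← pow_mul, mul_comm]
    simp_rw [e2]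
    ring
  have hwm : Measurable w :=
    Measurable.indicator (by have := hQm.ereal_toReal; fun_prop) hS.measurableSet
  -- Integrating `hinner` over the remaining variable, each of the m + 1 normalized squared
  -- monomials contributes 1.
  have hZ : partitionFunction (localized Q S) (m + 1) =
      ENNReal.ofReal ((m + 1 : ℕ) * (m.factorial * P)) := by
    have hmeas : Measurable fun x : Fin (m + 1) → ℂ =>
        EReal.exp (-hamiltonian (localized Q S) (m + 1) x) := by
      simp_rw [hexp]
      have h5 : Measurable fun x : Fin (m + 1) → ℂ => (evalMatrix φ x).det := by
        refine (Continuous.matrix_det (continuous_matrix fun i j => ?_)).measurable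
        simp only [evalMatrix, Matrix.of_apply, hφ]
        fun_prop
      have h6 : Measurable fun x : Fin (m + 1) → ℂ => ∏ i, w (x i) :=
        Finset.measurable_prod _ fun i _ => hwm.comp (measurable_pi_apply i)
      exact ((h5.norm.pow_const 2).mul h6).ennreal_ofReal
    have e := (measurePreserving_piFinSuccAbove (fun _ : Fin (m + 1) => dA) 0).symm
    rw [partitionFunction, ← e.lintegral_comp hmeas, lintegral_prod]
    · have e3 : ∀ (z : ℂ) (η : Fin m → ℂ),
          (MeasurableEquiv.piFinSuccAbove (fun _ : Fin (m + 1) => ℂ) 0).symm (z, η) = Fin.cons z η := by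
        intro z η
        simp [MeasurableEquiv.piFinSuccAbove_symm_apply, Fin.insertNthEquiv]
      simp_rw [e3]
      have hIj : ∀ j, Integrable (fun z => ‖z - a‖ ^ (2 * j) * w z) dA := by
        intro j
        have := (integrable_mul_weight (n := m + 1) hS hc
          (f := fun z => ((‖z - a‖ ^ (2 * j) : ℝ) : ℂ)) (by fun_prop)).re
        refine this.congr (Eventually.of_forall fun z => ?_)
        simp only [RCLike.re_eq_complex_re]
        rw [← Complex.ofReal_mul, Complex.ofReal_re]
      have hIs : Integrable (fun z => w z * ∑ j ∈ Finset.range (m + 1), ‖z - a‖ ^ (2 * j) / h j) dA := by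
        simp_rw [Finset.mul_sum]
        refine integrable_finsetSum _ fun j _ => ?_
        refine ((hIj j).div_const (h j)).congr (Eventually.of_forall fun z => ?_)
        simp only; ring
      have hval : ∫ z, w z * ∑ j ∈ Finset.range (m + 1), ‖z - a‖ ^ (2 * j) / h j ∂dA = (m + 1 : ℕ) := by
        have e4 : ∀ z, w z * ∑ j ∈ Finset.range (m + 1), ‖z - a‖ ^ (2 * j) / h j =
            ∑ j ∈ Finset.range (m + 1), ‖z - a‖ ^ (2 * j) * w z / h j := by
          intro z; rw [Finset.mul_sum]; exact Finset.sum_congr rfl fun j _ => by ring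
        simp_rw [e4]
        rw [integral_finsetSum _ fun j _ => (hIj j).div_const _]
        have e5 : ∀ j, ∫ z, ‖z - a‖ ^ (2 * j) * w z / h j ∂dA = 1 := by
          intro j
          rw [integral_div]
          exact div_self (hpos j).ne'
        simp [e5]
      calc _ = ∫⁻ z, ENNReal.ofReal (m.factorial * P *
            (w z * ∑ j ∈ Finset.range (m + 1), ‖z - a‖ ^ (2 * j) / h j)) ∂dA :=
            lintegral_congr fun z => hinner z
        _ = _ := by
          rw [← ofReal_integral_eq_lintegral_ofReal (hIs.const_mul _), integral_const_mul, hval,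
            mul_comm]
          exact Eventually.of_forall fun z => mul_nonneg (by positivity) (mul_nonneg (hwn z)
            (Finset.sum_nonneg fun j _ => div_nonneg (by positivity) (hpos j).le))
    · exact (hmeas.comp (MeasurableEquiv.measurable _)).aemeasurable
  have hZ0 : (0 : ℝ) < (m + 1 : ℕ) * (m.factorial * P) := by positivity
  have hsum : 0 ≤ w ζ * ∑ j ∈ Finset.range (m + 1), ‖ζ - a‖ ^ (2 * j) / h j :=
    mul_nonneg (hwn ζ) (Finset.sum_nonneg fun j _ => div_nonneg (by positivity) (hpos j).le)
  rw [onePoint]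
  simp only [gibbsDensity]
  rw [lintegral_const_mul', hinner, hZ, ← ENNReal.ofReal_inv_of_pos hZ0,
    ← ENNReal.ofReal_mul (by positivity), ENNReal.toReal_mul,
    ENNReal.toReal_ofReal (by positivity), ENNReal.toReal_natCast]
  · field_simp
  · rw [hZ]; exact ENNReal.inv_ne_top.2 (by simpa using hZ0)

end OnePoint

end HardEdge
end

/-! ### Edge profiles in logarithmic coordinates -/

noncomputable section

namespace HardEdge

/-- A radial potential in logarithmic coordinates: `ψ` is the potential, `J` the droplet with outer
edge `0`, and `m = ψ' / 2` the mass function. -/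
structure IsEdgeProfile (ψ m : ℝ → ℝ) (J : Set ℝ) (C ℓ D : ℝ) : Prop where
  measurable : MeasurableSet J
  ordConnected : J.OrdConnected
  subset : J ⊆ Iic 0
  ell_pos : 0 < ℓ
  ell_le : ℓ ≤ 1
  Icc_subset : Icc (-ℓ) 0 ⊆ J
  deriv : ∀ t ∈ J, HasDerivAt ψ (2 * m t) t
  mono : MonotoneOn m J
  m_zero : m 0 = 1
  lip : ∀ s ∈ J, ∀ t ∈ J, s ≤ t → m t - m s ≤ C * Real.exp (2 * t) * (t - s)
  bound : ∀ t ∈ J, m t ≤ C * Real.exp (2 * t)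
  left : ∀ x ∈ J, ∀ s, 0 ≤ s → x - s ∈ J ∨ m x ≤ C * Real.exp (2 * x) * s
  D_pos : 0 < D
  m_deriv : HasDerivWithinAt m (2 * D) (Iic 0) 0

/-- The weighted norm of the `j`-th monomial in logarithmic coordinates. -/
def edgeNorm (ψ : ℝ → ℝ) (J : Set ℝ) (n j : ℕ) : ℝ :=
  ∫ t in J, 2 * Real.exp (2 * (j + 1) * t - n * ψ t)

/-- The one-point function in logarithmic coordinates. -/
def edgeOnePoint (ψ : ℝ → ℝ) (J : Set ℝ) (n : ℕ) (x : ℝ) : ℝ :=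
  ∑ j ∈ Finset.range n, Real.exp (2 * j * x - n * ψ x) / edgeNorm ψ J n j

/-- Since N ≥ 1, the Lorentzian of width √N varies by at most a factor 3 over an interval of unit
length. The sum is thus at most three times the integral, which is π√N. -/
lemma sum_inv_one_add_sq_le (n : ℕ) (y : ℝ) {N : ℝ} (hN : 1 ≤ N) :
    ∑ j ∈ Finset.range n, (1 + (j + 1 - y) ^ 2 / N)⁻¹ ≤ 3 * Real.pi * √N := by
  have hN0 : 0 < N := by linarith
  have hs : 0 < √N := Real.sqrt_pos.2 hN0
  set g : ℝ → ℝ := fun u => (1 + ((u - y) / √N) ^ 2)⁻¹ with hg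
  have hgc : Continuous g := by
    refine Continuous.inv₀ (by fun_prop) fun u => by positivity
  have hgi : Integrable g := by
    have := ((integrable_inv_one_add_sq.comp_sub_right (y / √N)).comp_div hs.ne')
    refine this.congr (Eventually.of_forall fun u => ?_)
    simp only [hg, sub_div]
  have hgv : ∫ u, g u = Real.pi * √N := by
    have h1 : ∀ u, g u = (fun v => (1 + (v - y / √N) ^ 2)⁻¹) (u / √N) := by
      intro u; simp only [hg, sub_div]
    simp_rw [h1]
    rw [Measure.integral_comp_div (fun v => (1 + (v - y / √N) ^ 2)⁻¹) (√N),
      integral_sub_right_eq_self (fun v : ℝ => (1 + v ^ 2)⁻¹), integral_univ_inv_one_add_sq,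
      abs_of_pos hs, smul_eq_mul, mul_comm]
  have hterm : ∀ j : ℕ, (1 + (j + 1 - y) ^ 2 / N)⁻¹ ≤ 3 * ∫ u in (j : ℝ)..((j + 1 : ℕ) : ℝ), g u := by
    intro j
    have h1 : ∫ u in (j : ℝ)..((j + 1 : ℕ) : ℝ), (1 + ((j : ℝ) + 1 - y) ^ 2 / N)⁻¹ / 3 ≤
        ∫ u in (j : ℝ)..((j + 1 : ℕ) : ℝ), g u := by
      refine intervalIntegral.integral_mono_on (by push_cast; linarith) (by simp)
        (hgc.intervalIntegrable _ _) fun u hu => ?_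
      push_cast at hu
      rw [hg, div_eq_mul_inv, ← mul_inv]
      simp only [div_pow, Real.sq_sqrt hN0.le]
      refine inv_anti₀ (by positivity) ?_
      have h2 : (u - y) ^ 2 ≤ 2 * (j + 1 - y) ^ 2 + 2 := by
        nlinarith [sq_nonneg ((j + 1 - y) + (j + 1 - u)), hu.1, hu.2]
      have h3 : (u - y) ^ 2 / N ≤ 2 * ((j + 1 - y) ^ 2 / N) + 2 := by
        rw [div_le_iff₀ hN0]
        have : (2 * ((j + 1 - y) ^ 2 / N) + 2) * N = 2 * (j + 1 - y) ^ 2 + 2 * N := by field_simp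
        rw [this]; linarith
      have h4 : 0 ≤ ((j : ℝ) + 1 - y) ^ 2 / N := by positivity
      linarith
    rw [intervalIntegral.integral_const, smul_eq_mul] at h1
    push_cast at h1 ⊢
    linarith
  calc _ ≤ ∑ j ∈ Finset.range n, 3 * ∫ u in (j : ℝ)..((j + 1 : ℕ) : ℝ), g u :=
        Finset.sum_le_sum fun j _ => hterm j
    _ = 3 * ∫ u in ((0 : ℕ) : ℝ)..(n : ℝ), g u := by
        rw [← Finset.mul_sum, intervalIntegral.sum_integral_adjacent_intervals (a := fun j : ℕ => (j : ℝ))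
          fun k _ => hgc.intervalIntegrable _ _]
    _ ≤ 3 * ∫ u, g u := by
        gcongr
        rw [intervalIntegral.integral_of_le (by simp)]
        exact setIntegral_le_integral hgi (Eventually.of_forall fun u => by simp only [hg, Pi.zero_apply]; positivity)
    _ = _ := by rw [hgv]; ring

namespace IsEdgeProfile

variable {ψ m : ℝ → ℝ} {J : Set ℝ} {C ℓ D : ℝ}



lemma zero_mem (H : IsEdgeProfile ψ m J C ℓ D) : (0 : ℝ) ∈ J :=
  H.Icc_subset ⟨by linarith [H.ell_pos], le_rfl⟩

lemma one_le_C (H : IsEdgeProfile ψ m J C ℓ D) : 1 ≤ C := by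
  have := H.bound 0 H.zero_mem
  rw [H.m_zero] at this; simpa using this

lemma continuousOn (H : IsEdgeProfile ψ m J C ℓ D) : ContinuousOn ψ J := fun t ht =>
  (H.deriv t ht).continuousAt.continuousWithinAt

/-- Comparison of the increments of `ψ` with those of a function with larger derivative. -/
lemma sub_le_of_deriv_le (H : IsEdgeProfile ψ m J C ℓ D) {s t : ℝ} (hs : s ∈ J) (ht : t ∈ J)
    (hst : s ≤ t) {g g' : ℝ → ℝ} (hg : ∀ u, HasDerivAt g (g' u) u)
    (h : ∀ u ∈ Icc s t, 2 * m u ≤ g' u) : ψ t - ψ s ≤ g t - g s := by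
  have hsub : Icc s t ⊆ J := H.ordConnected.out hs ht
  have hd : ∀ u ∈ Icc s t, HasDerivAt (fun u => ψ u - g u) (2 * m u - g' u) u := fun u hu =>
    (H.deriv u (hsub hu)).sub (hg u)
  have := antitoneOn_of_deriv_nonpos (convex_Icc s t)
    (fun u hu => (hd u hu).continuousAt.continuousWithinAt)
    (fun u hu => (hd u (interior_subset hu)).differentiableAt.differentiableWithinAt)
    (fun u hu => by rw [(hd u (interior_subset hu)).deriv]; linarith [h u (interior_subset hu)])
  have h2 := this (left_mem_Icc.2 hst) (right_mem_Icc.2 hst) hst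
  simp only at h2
  linarith

/-- Comparison of the increments of `ψ` with those of a function with smaller derivative. -/
lemma le_sub_of_le_deriv (H : IsEdgeProfile ψ m J C ℓ D) {s t : ℝ} (hs : s ∈ J) (ht : t ∈ J)
    (hst : s ≤ t) {g g' : ℝ → ℝ} (hg : ∀ u, HasDerivAt g (g' u) u)
    (h : ∀ u ∈ Icc s t, g' u ≤ 2 * m u) : g t - g s ≤ ψ t - ψ s := by
  have hsub : Icc s t ⊆ J := H.ordConnected.out hs ht
  have hd : ∀ u ∈ Icc s t, HasDerivAt (fun u => ψ u - g u) (2 * m u - g' u) u := fun u hu =>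
    (H.deriv u (hsub hu)).sub (hg u)
  have := monotoneOn_of_deriv_nonneg (convex_Icc s t)
    (fun u hu => (hd u hu).continuousAt.continuousWithinAt)
    (fun u hu => (hd u (interior_subset hu)).differentiableAt.differentiableWithinAt)
    (fun u hu => by rw [(hd u (interior_subset hu)).deriv]; linarith [h u (interior_subset hu)])
  have h2 := this (left_mem_Icc.2 hst) (right_mem_Icc.2 hst) hst
  simp only at h2
  linarith

/-- Integrates ψ' = 2m ≤ 2Ce^{2u}. With t = 0 this bounds ψ below on all of J, which makes the norms
finite even when J is a half-line. -/
lemma sub_le (H : IsEdgeProfile ψ m J C ℓ D) {s t : ℝ} (hs : s ∈ J) (ht : t ∈ J) (hst : s ≤ t) :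
    ψ t - ψ s ≤ C * Real.exp (2 * t) := by
  have hC := H.one_le_C
  have hd : ∀ u : ℝ, HasDerivAt (fun u => C * Real.exp (2 * u)) (2 * (C * Real.exp (2 * u))) u := by
    intro u
    refine ((((hasDerivAt_id u).const_mul 2).exp).const_mul C).congr_deriv ?_
    simp only [id]; ring
  have := H.sub_le_of_deriv_le hs ht hst hd fun u hu => by
    have := H.bound u (H.ordConnected.out hs ht hu)
    linarith
  have h2 : 0 < C * Real.exp (2 * s) := by positivity
  linarith

/-- A second-order Taylor bound from the Lipschitz estimate for m; the factor e² absorbs the growth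
of e^{2u} over a step of length at most 1. -/
lemma sub_le_right (H : IsEdgeProfile ψ m J C ℓ D) {x s : ℝ} (hx : x ∈ J) (hs0 : 0 ≤ s) (hs1 : s ≤ 1)
    (hxs : x + s ∈ J) :
    ψ (x + s) - ψ x ≤ 2 * m x * s + C * Real.exp 2 * Real.exp (2 * x) * s ^ 2 := by
  have hC := H.one_le_C
  have hd : ∀ u : ℝ, HasDerivAt
      (fun u => 2 * m x * u + C * Real.exp 2 * Real.exp (2 * x) * (u - x) ^ 2)
      (2 * m x + C * Real.exp 2 * Real.exp (2 * x) * (2 * (u - x))) u := by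
    intro u
    refine (((hasDerivAt_id u).const_mul (2 * m x)).add
      ((((hasDerivAt_id u).sub_const x).pow 2).const_mul (C * Real.exp 2 * Real.exp (2 * x)))).congr_deriv ?_
    simp only [id]; push_cast; ring
  have := H.sub_le_of_deriv_le hx hxs (by linarith) hd fun u hu => by
    have h1 := H.lip x hx u (H.ordConnected.out hx hxs hu) hu.1
    have h2 : Real.exp (2 * u) ≤ Real.exp 2 * Real.exp (2 * x) := by
      rw [← Real.exp_add]; exact Real.exp_le_exp.2 (by linarith [hu.2])
    have h3 : C * Real.exp (2 * u) * (u - x) ≤ C * (Real.exp 2 * Real.exp (2 * x)) * (u - x) := by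
      have := hu.1
      gcongr
    nlinarith
  have e : x + s - x = s := by ring
  rw [e] at this
  simp only [sub_self] at this
  linarith

lemma sub_le_left (H : IsEdgeProfile ψ m J C ℓ D) {x s : ℝ} (hx : x ∈ J) (hs0 : 0 ≤ s)
    (hxs : x - s ∈ J) :
    ψ (x - s) - ψ x ≤ -(2 * m x * s) + C * Real.exp 2 * Real.exp (2 * x) * s ^ 2 := by
  have hC := H.one_le_C
  have hd : ∀ u : ℝ, HasDerivAt
      (fun u => 2 * m x * u - C * Real.exp (2 * x) * (-(u - x) ^ 2))
      (2 * m x - C * Real.exp (2 * x) * (2 * (x - u))) u := by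
    intro u
    refine (((hasDerivAt_id u).const_mul (2 * m x)).sub
      (((((hasDerivAt_id u).sub_const x).pow 2).neg).const_mul (C * Real.exp (2 * x)))).congr_deriv ?_
    simp only [id]; push_cast; ring
  have := H.le_sub_of_le_deriv hxs hx (by linarith) hd fun u hu => by
    have h1 := H.lip u (H.ordConnected.out hxs hx hu) x hx hu.2
    linarith
  have e : x - s - x = -s := by ring
  rw [e] at this
  simp only [sub_self] at this
  have h2 : C * Real.exp (2 * x) * s ^ 2 ≤ C * Real.exp 2 * Real.exp (2 * x) * s ^ 2 := by
    have : (1 : ℝ) ≤ Real.exp 2 := Real.one_le_exp (by norm_num)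
    have h3 : 0 ≤ C * Real.exp (2 * x) * s ^ 2 := by positivity
    nlinarith
  nlinarith

lemma integrableOn_exp (H : IsEdgeProfile ψ m J C ℓ D) (n j : ℕ) :
    IntegrableOn (fun t => 2 * Real.exp (2 * (j + 1) * t - n * ψ t)) J := by
  have h1 : IntegrableOn (fun t : ℝ => 2 * Real.exp (n * (C - ψ 0)) * Real.exp (2 * (j + 1) * t)) J := by
    refine IntegrableOn.mono_set ?_ H.subset
    exact (integrableOn_exp_mul_Iic (by positivity : (0 : ℝ) < 2 * (j + 1)) 0).const_mul _
  refine h1.mono' ?_ ?_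
  · refine (ContinuousOn.aestronglyMeasurable ?_ H.measurable)
    have := H.continuousOn
    fun_prop
  · filter_upwards [ae_restrict_mem H.measurable] with t ht
    rw [Real.norm_of_nonneg (by positivity), mul_assoc 2 (Real.exp _), ← Real.exp_add]
    gcongr
    have h2 := H.sub_le ht H.zero_mem (H.subset ht)
    simp only [mul_zero, Real.exp_zero, mul_one] at h2
    have : (n : ℝ) * (-ψ t) ≤ n * (C - ψ 0) := by gcongr; linarith
    linarith

lemma le_edgeNorm (H : IsEdgeProfile ψ m J C ℓ D) (n j : ℕ) {α β B : ℝ} (hαβ : α ≤ β)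
    (hsub : Icc α β ⊆ J) (hB : ∀ t ∈ Icc α β, B ≤ Real.exp (2 * (j + 1) * t - n * ψ t)) :
    2 * ((β - α) * B) ≤ edgeNorm ψ J n j := by
  have hI := H.integrableOn_exp n j
  calc 2 * ((β - α) * B) = ∫ _t in Icc α β, 2 * B := by
        simp [hαβ]; ring
    _ ≤ ∫ t in Icc α β, 2 * Real.exp (2 * (j + 1) * t - n * ψ t) := by
        refine setIntegral_mono_on (integrableOn_const (by simp)) (hI.mono_set hsub) measurableSet_Icc fun t ht => ?_
        linarith [hB t ht]
    _ ≤ _ := setIntegral_mono_set hI (Eventually.of_forall fun t => by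
        simp only [Pi.zero_apply]; positivity) (Eventually.of_forall hsub)

lemma edgeNorm_pos (H : IsEdgeProfile ψ m J C ℓ D) (n j : ℕ) : 0 < edgeNorm ψ J n j := by
  have hc : ContinuousOn (fun t => Real.exp (2 * (j + 1) * t - n * ψ t)) (Icc (-ℓ) 0) := by
    have := H.continuousOn.mono H.Icc_subset
    fun_prop
  obtain ⟨t0, ht0, hmin⟩ := isCompact_Icc.exists_isMinOn
    (nonempty_Icc.2 (by linarith [H.ell_pos] : -ℓ ≤ 0)) hc
  refine lt_of_lt_of_le ?_ (H.le_edgeNorm n j (by linarith [H.ell_pos]) H.Icc_subset hmin)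
  have := H.ell_pos
  have := Real.exp_pos (2 * (j + 1) * t0 - n * ψ t0)
  rw [sub_neg_eq_add, zero_add]; positivity

end IsEdgeProfile

end HardEdge
end

/-! ### Bounds for the norms and for the one-point function -/

noncomputable section

namespace HardEdge
namespace IsEdgeProfile

variable {ψ m : ℝ → ℝ} {J : Set ℝ} {C ℓ D : ℝ}

/-- Lower bound for the norms near the center of the bulk of the `j`-th monomial. -/
lemma le_edgeNorm_of_small (H : IsEdgeProfile ψ m J C ℓ D) {n j : ℕ} {x N k : ℝ} (hx : x ∈ J)
    (hN : N = n * Real.exp (2 * x)) (hN1 : 1 ≤ N) (hk : k = j + 1 - n * m x) (hkN : |k| ≤ √N) :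
    ℓ * Real.exp (-(1 + C * Real.exp 2)) / √N * Real.exp (2 * (j + 1) * x - n * ψ x) ≤
      edgeNorm ψ J n j := by
  have hC := H.one_le_C
  have hℓ := H.ell_pos
  have hℓ1 := H.ell_le
  have hs1 : 1 ≤ √N := Real.one_le_sqrt.2 hN1
  have hs0 : 0 < √N := by linarith
  -- The exponent 2(j+1)t - nψ(t) has slope 2k at x and curvature controlled by N. As |k| ≤ √N, it
  -- drops by at most a constant over a distance of order 1/√N; the factor ℓ/2 keeps the interval
  -- inside J.
  set d := ℓ / (2 * √N) with hd
  have hd0 : 0 < d := by positivity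
  have hdℓ : d ≤ ℓ / 2 := by
    rw [hd]; exact div_le_div_of_nonneg_left hℓ.le (by norm_num) (by linarith)
  have hdN : d * √N ≤ 1 / 2 := by
    rw [hd]; field_simp; exact hℓ1
  have hest : ∀ s, 0 ≤ s → s ≤ d → 2 * |k| * s + C * Real.exp 2 * N * s ^ 2 ≤ 1 + C * Real.exp 2 := by
    intro s hs hsd
    have h1 : |k| * s ≤ √N * d := by gcongr
    have h2 : N * s ^ 2 ≤ 1 := by
      have : N * s ^ 2 = (√N * s) ^ 2 := by rw [mul_pow, Real.sq_sqrt (by linarith)]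
      rw [this]
      have h3 : √N * s ≤ √N * d := by gcongr
      have h4 : 0 ≤ √N * s := by positivity
      nlinarith
    have h5 : C * Real.exp 2 * N * s ^ 2 ≤ C * Real.exp 2 * 1 := by
      rw [mul_assoc]; gcongr
    nlinarith
  have hn0 : (0 : ℝ) ≤ n := Nat.cast_nonneg n
  have hfin : ∀ α, Icc α (α + d) ⊆ J → (∀ t ∈ Icc α (α + d), 2 * (j + 1) * x - n * ψ x -
      (1 + C * Real.exp 2) ≤ 2 * (j + 1) * t - n * ψ t) →
      ℓ * Real.exp (-(1 + C * Real.exp 2)) / √N * Real.exp (2 * (j + 1) * x - n * ψ x) ≤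
      edgeNorm ψ J n j := by
    intro α hsub hb
    have := H.le_edgeNorm n j (B := Real.exp (2 * (j + 1) * x - n * ψ x - (1 + C * Real.exp 2)))
      (by linarith : α ≤ α + d) hsub fun t ht => Real.exp_le_exp.2 (hb t ht)
    refine le_trans (le_of_eq ?_) this
    rw [sub_eq_add_neg _ (1 + _), Real.exp_add, hd, add_sub_cancel_left]
    field_simp
  -- Close to the outer edge there is room to the left, because [-ℓ, 0] ⊆ J; otherwise there is room
  -- to the right.
  by_cases hxl : -(ℓ / 2) ≤ x
  · have hmem : x - d ∈ J := H.Icc_subset ⟨by linarith, by linarith [H.subset hx, mem_Iic.1 (H.subset hx)]⟩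
    refine hfin (x - d) (by rw [sub_add_cancel]; exact H.ordConnected.out hmem hx) fun t ht => ?_
    rw [sub_add_cancel] at ht
    have htJ : x - (x - t) ∈ J := by
      rw [sub_sub_cancel]; exact H.ordConnected.out hmem hx ht
    have h1 := H.sub_le_left hx (by linarith [ht.2] : 0 ≤ x - t) htJ
    rw [sub_sub_cancel] at h1
    have h2 := hest (x - t) (by linarith [ht.2]) (by linarith [ht.1])
    have h3 : n * (ψ t - ψ x) ≤ n * (-(2 * m x * (x - t)) + C * Real.exp 2 * Real.exp (2 * x) * (x - t) ^ 2) := by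
      gcongr
    have h4 : k * (x - t) ≤ |k| * (x - t) := by
      gcongr
      · linarith [ht.2]
      · exact le_abs_self k
    rw [hk] at h4
    rw [hN, hk] at h2
    linear_combination h3 + h2 + 2 * h4
  · push Not at hxl
    have hmem : x + d ∈ J := H.ordConnected.out hx H.zero_mem ⟨by linarith, by linarith⟩
    refine hfin x (H.ordConnected.out hx hmem) fun t ht => ?_
    have htJ : x + (t - x) ∈ J := by
      rw [add_sub_cancel]; exact H.ordConnected.out hx hmem ht
    have h1 := H.sub_le_right hx (by linarith [ht.1] : 0 ≤ t - x) (by linarith [ht.2]) htJ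
    rw [add_sub_cancel] at h1
    have h2 := hest (t - x) (by linarith [ht.1]) (by linarith [ht.2])
    have h3 : n * (ψ t - ψ x) ≤ n * (2 * m x * (t - x) + C * Real.exp 2 * Real.exp (2 * x) * (t - x) ^ 2) := by
      gcongr
    have h4 : -k * (t - x) ≤ |k| * (t - x) := by
      gcongr
      · linarith [ht.1]
      · exact neg_le_abs k
    rw [hk] at h4
    rw [hN, hk] at h2
    linear_combination h3 + h2 + 2 * h4

/-- Lower bound for the norms away from the bulk of the `j`-th monomial. -/
lemma le_edgeNorm_of_large (H : IsEdgeProfile ψ m J C ℓ D) {n j : ℕ} (hj : j < n) {x N k : ℝ}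
    (hx : x ∈ J) (hN : N = n * Real.exp (2 * x)) (hN1 : 1 ≤ N) (hk : k = j + 1 - n * m x)
    (hkN : √N ≤ |k|) :
    (k ^ 2 / N) / (8 * (C * Real.exp 2) ^ 2 * √N) * Real.exp (2 * (j + 1) * x - n * ψ x) ≤
      edgeNorm ψ J n j := by
  have hC := H.one_le_C
  have hs1 : 1 ≤ √N := Real.one_le_sqrt.2 hN1
  have hs0 : 0 < √N := by linarith
  have hN0 : 0 < N := by linarith
  have hsq : √N * √N = N := Real.mul_self_sqrt hN0.le
  have hn0 : (0 : ℝ) ≤ n := Nat.cast_nonneg n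
  set A := C * Real.exp 2 with hA
  have hA1 : 1 ≤ A := by
    have : (1 : ℝ) ≤ Real.exp 2 := Real.one_le_exp (by norm_num)
    rw [hA]; nlinarith
  set κ := |k| with hκ
  have hκ1 : 1 ≤ κ := hs1.trans hkN
  -- Moving a distance s in the direction of increase gains 2κs and loses at most A N s². For s ≤
  -- κ/(AN) the net gain is at least κs, hence at least κd/2 on the far half of the interval; the
  -- cap 1 is required by `sub_le_right`.
  set d := min 1 (κ / (A * N)) with hd
  have hd0 : 0 < d := by positivity
  have hd1 : d ≤ 1 := min_le_left _ _
  have hdA : A * N * d ≤ κ := by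
    have : d ≤ κ / (A * N) := min_le_right _ _
    rwa [le_div_iff₀ (by positivity), mul_comm] at this
  have hcalc : (k ^ 2 / N) / (8 * A ^ 2 * √N) ≤ 2 * ((d / 2) * Real.exp (κ * d / 2)) := by
    rw [← sq_abs k, ← hκ]
    rcases min_choice 1 (κ / (A * N)) with h | h
    · rw [← hd] at h
      rw [h]
      have h1 : κ ^ 2 / 8 ≤ Real.exp (κ * 1 / 2) := by
        have := Real.quadratic_le_exp_of_nonneg (by positivity : 0 ≤ κ * 1 / 2)
        nlinarith
      have h2 : (κ ^ 2 / N) / (8 * A ^ 2 * √N) ≤ κ ^ 2 / 8 := by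
        rw [div_div]
        refine div_le_div_of_nonneg_left (by positivity) (by norm_num) ?_
        have : 1 ≤ A ^ 2 := one_le_pow₀ hA1
        have h3 : 1 ≤ A ^ 2 * √N := one_le_mul_of_one_le_of_one_le this hs1
        have h4 : 1 ≤ N * (A ^ 2 * √N) := one_le_mul_of_one_le_of_one_le hN1 h3
        linarith
      linarith
    · rw [← hd] at h
      have h1 : κ * d / 2 ≤ Real.exp (κ * d / 2) := by
        linarith [Real.add_one_le_exp (κ * d / 2)]
      have h2 : (κ ^ 2 / N) / (8 * A ^ 2 * √N) ≤ 2 * ((d / 2) * (κ * d / 2)) := by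
        have e : 2 * ((d / 2) * (κ * d / 2)) = (κ ^ 2 / N) * κ / (2 * A ^ 2 * N) := by
          rw [h]; field_simp
        rw [e, div_le_div_iff₀ (by positivity) (by positivity)]
        have h5 : N ≤ κ * √N := by nlinarith
        have h6 : 0 ≤ κ ^ 2 / N * (2 * A ^ 2) := by positivity
        nlinarith [mul_le_mul_of_nonneg_left h5 h6, mul_nonneg h6 (by positivity : 0 ≤ κ * √N)]
      refine h2.trans ?_
      gcongr
  have hfin : ∀ α, Icc α (α + d / 2) ⊆ J → (∀ t ∈ Icc α (α + d / 2), 2 * (j + 1) * x - n * ψ x +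
      κ * d / 2 ≤ 2 * (j + 1) * t - n * ψ t) →
      (k ^ 2 / N) / (8 * A ^ 2 * √N) * Real.exp (2 * (j + 1) * x - n * ψ x) ≤ edgeNorm ψ J n j := by
    intro α hsub hb
    have := H.le_edgeNorm n j (B := Real.exp (2 * (j + 1) * x - n * ψ x + κ * d / 2))
      (by linarith : α ≤ α + d / 2) hsub fun t ht => Real.exp_le_exp.2 (hb t ht)
    refine le_trans ?_ this
    rw [Real.exp_add, add_sub_cancel_left]
    have hE := Real.exp_pos (2 * (j + 1) * x - n * ψ x)
    nlinarith [mul_le_mul_of_nonneg_right hcalc hE.le]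
  have hquad : ∀ s, d / 2 ≤ s → s ≤ d → κ * d / 2 ≤ 2 * κ * s - A * N * s ^ 2 := by
    intro s hs hsd
    have h1 : A * N * s ≤ κ := le_trans (by gcongr) hdA
    nlinarith
  rcases le_total 0 k with hk0 | hk0
  · have hκk : κ = k := abs_of_nonneg hk0
    -- The step cannot cross the outer edge: otherwise -x < d, and since j + 1 ≤ n and m(0) = 1, k ≤
    -- n(1 - m(x)) ≤ nC(-x) < A N d ≤ κ = k.
    have hmem : x + d ∈ J := by
      refine H.ordConnected.out hx H.zero_mem ⟨by linarith, ?_⟩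
      by_contra hcon
      push Not at hcon
      have h1 := H.lip x hx 0 H.zero_mem (H.subset hx)
      rw [H.m_zero] at h1
      simp only [mul_zero, Real.exp_zero, mul_one, zero_sub] at h1
      have h2 : (j : ℝ) + 1 ≤ n := by exact_mod_cast hj
      have h3 : (1 : ℝ) ≤ Real.exp 2 * Real.exp (2 * x) := by
        rw [← Real.exp_add]; exact Real.one_le_exp (by linarith)
      have hx0 : 0 ≤ -x := by linarith [mem_Iic.1 (H.subset hx)]
      have h4 : k ≤ n * (C * -x) := by
        rw [hk]
        have : n * (1 - m x) ≤ n * (C * -x) := by gcongr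
        linarith
      have h5 : n * (C * -x) * 1 ≤ n * (C * -x) * (Real.exp 2 * Real.exp (2 * x)) := by gcongr
      have h6 : n * (C * -x) * (Real.exp 2 * Real.exp (2 * x)) = A * N * -x := by rw [hN, hA]; ring
      have h7 : A * N * -x < A * N * d := by
        have : 0 < A * N := by positivity
        exact mul_lt_mul_of_pos_left (by linarith) this
      linarith
    refine hfin (x + d / 2) ((Icc_subset_Icc (by linarith) (by linarith)).trans
      (H.ordConnected.out hx hmem)) fun t ht => ?_
    have htJ : x + (t - x) ∈ J := by
      rw [add_sub_cancel]
      exact H.ordConnected.out hx hmem ⟨by linarith [ht.1], by linarith [ht.2]⟩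
    have h1 := H.sub_le_right hx (by linarith [ht.1] : 0 ≤ t - x) (by linarith [ht.2]) htJ
    rw [add_sub_cancel] at h1
    have h2 := hquad (t - x) (by linarith [ht.1]) (by linarith [ht.2])
    have h3 : n * (ψ t - ψ x) ≤ n * (2 * m x * (t - x) + A * Real.exp (2 * x) * (t - x) ^ 2) := by
      gcongr
    rw [hκk] at h2 ⊢
    rw [hk] at h2 ⊢
    rw [hN] at h2
    linear_combination h3 + h2
  · have hκk : κ = -k := abs_of_nonpos hk0
    -- Leaving J on the left would force n m(x) ≤ C N d ≤ κ = n m(x) - (j + 1), which is absurd.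
    have hmem : x - d ∈ J := by
      refine (H.left x hx d hd0.le).resolve_right fun hcon => ?_
      have h1 : n * m x ≤ n * (C * Real.exp (2 * x) * d) := by gcongr
      have h2 : n * (C * Real.exp (2 * x) * d) = C * N * d := by rw [hN]; ring
      have h3 : C * N * d ≤ A * N * d := by
        have : (1 : ℝ) ≤ Real.exp 2 := Real.one_le_exp (by norm_num)
        have : C ≤ A := by rw [hA]; nlinarith
        gcongr
      have h4 : (0 : ℝ) ≤ j := Nat.cast_nonneg j
      linarith
    refine hfin (x - d) ((Icc_subset_Icc (by linarith) (by linarith)).trans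
      (H.ordConnected.out hmem hx)) fun t ht => ?_
    have htJ : x - (x - t) ∈ J := by
      rw [sub_sub_cancel]
      exact H.ordConnected.out hmem hx ⟨by linarith [ht.1], by linarith [ht.2]⟩
    have h1 := H.sub_le_left hx (by linarith [ht.2] : 0 ≤ x - t) htJ
    rw [sub_sub_cancel] at h1
    have h2 := hquad (x - t) (by linarith [ht.2]) (by linarith [ht.1])
    have h3 : n * (ψ t - ψ x) ≤ n * (-(2 * m x * (x - t)) + A * Real.exp (2 * x) * (x - t) ^ 2) := by
      gcongr
    rw [hκk] at h2 ⊢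
    rw [hk] at h2 ⊢
    rw [hN] at h2
    linear_combination h3 + h2

/-- Pointwise bound for the weighted orthonormal monomials. -/
lemma exists_div_edgeNorm_le (H : IsEdgeProfile ψ m J C ℓ D) :
    ∃ K : ℝ, 0 < K ∧ ∀ n j : ℕ, j < n → ∀ x ∈ J, 1 ≤ n * Real.exp (2 * x) →
      Real.exp (2 * (j + 1) * x - n * ψ x) / edgeNorm ψ J n j ≤
        K * (√(n * Real.exp (2 * x)) *
          (1 + (j + 1 - n * m x) ^ 2 / (n * Real.exp (2 * x)))⁻¹) := by
  have hC := H.one_le_C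
  have hℓ := H.ell_pos
  set c₁ := ℓ * Real.exp (-(1 + C * Real.exp 2)) with hc₁
  set c₂ := 1 / (8 * (C * Real.exp 2) ^ 2) with hc₂
  have h1 : 0 < c₁ := by positivity
  have h2 : 0 < c₂ := by positivity
  refine ⟨2 / min c₁ c₂, by positivity, fun n j hj x hx hN1 => ?_⟩
  set N := n * Real.exp (2 * x) with hN
  set k := (j : ℝ) + 1 - n * m x with hk
  have hN0 : 0 < N := by linarith
  have hs0 : 0 < √N := Real.sqrt_pos.2 hN0
  have hE := Real.exp_pos (2 * (j + 1) * x - n * ψ x)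
  have hkN : 0 ≤ k ^ 2 / N := by positivity
  have key : min c₁ c₂ / 2 * (1 + k ^ 2 / N) / √N * Real.exp (2 * (j + 1) * x - n * ψ x) ≤
      edgeNorm ψ J n j := by
    rcases le_total |k| √N with h | h
    · refine le_trans ?_ (H.le_edgeNorm_of_small hx hN hN1 hk h)
      have h3 : k ^ 2 / N ≤ 1 := by
        rw [div_le_one hN0, ← sq_abs, ← Real.sq_sqrt hN0.le]; gcongr
      rw [← hc₁]
      gcongr
      have : min c₁ c₂ ≤ c₁ := min_le_left _ _
      nlinarith
    · refine le_trans ?_ (H.le_edgeNorm_of_large hj hx hN hN1 hk h)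
      have h3 : 1 ≤ k ^ 2 / N := by
        rw [one_le_div hN0, ← sq_abs, ← Real.sq_sqrt hN0.le]; gcongr
      have e : (k ^ 2 / N) / (8 * (C * Real.exp 2) ^ 2 * √N) = c₂ * (k ^ 2 / N) / √N := by
        rw [hc₂]; field_simp
      rw [e]
      have h5 : min c₁ c₂ / 2 * (1 + k ^ 2 / N) ≤ c₂ * (k ^ 2 / N) := by
        have : min c₁ c₂ ≤ c₂ := min_le_right _ _
        nlinarith
      gcongr
  rw [div_le_iff₀ (H.edgeNorm_pos n j)]
  have h4 : 0 < min c₁ c₂ := lt_min h1 h2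
  have h5 : 0 ≤ 2 / min c₁ c₂ * (√N * (1 + k ^ 2 / N)⁻¹) := by positivity
  refine le_trans (le_of_eq ?_) (mul_le_mul_of_nonneg_left key h5)
  have : 1 + k ^ 2 / N ≠ 0 := by positivity
  generalize 1 + k ^ 2 / N = b at *
  field_simp

/-- Where n e^{2x} ≥ 1, the Lorentzian bounds sum to a multiple of e^{-2x}·(n e^{2x}) = n. Deeper
inside, within about n^{-1/2} of the centre, the value is compared with the one at the threshold
radius. -/
lemma exists_edgeOnePoint_le (H : IsEdgeProfile ψ m J C ℓ D) :
    ∃ K : ℝ, ∀ n : ℕ, ∀ x ∈ J, edgeOnePoint ψ J n x ≤ K * n := by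
  obtain ⟨K, hK, hb⟩ := H.exists_div_edgeNorm_le
  have hC := H.one_le_C
  have big : ∀ n : ℕ, ∀ x ∈ J, 1 ≤ n * Real.exp (2 * x) →
      edgeOnePoint ψ J n x ≤ K * (3 * Real.pi) * n := by
    intro n x hx hN
    set N := n * Real.exp (2 * x) with hNdef
    have hterm : ∀ j ∈ Finset.range n, Real.exp (2 * j * x - n * ψ x) / edgeNorm ψ J n j ≤
        Real.exp (-(2 * x)) * (K * (√N * (1 + (j + 1 - n * m x) ^ 2 / N)⁻¹)) := by
      intro j hj
      have := hb n j (Finset.mem_range.1 hj) x hx hN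
      have e : Real.exp (2 * j * x - n * ψ x) =
          Real.exp (-(2 * x)) * Real.exp (2 * (j + 1) * x - n * ψ x) := by
        rw [← Real.exp_add]; congr 1; ring
      rw [e, mul_div_assoc]
      gcongr
    calc edgeOnePoint ψ J n x ≤ _ := Finset.sum_le_sum hterm
      _ = Real.exp (-(2 * x)) * (K * (√N * ∑ j ∈ Finset.range n,
            (1 + ((j : ℝ) + 1 - n * m x) ^ 2 / N)⁻¹)) := by
          simp only [Finset.mul_sum]
      _ ≤ Real.exp (-(2 * x)) * (K * (√N * (3 * Real.pi * √N))) := by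
          gcongr
          exact sum_inv_one_add_sq_le n _ hN
      _ = K * (3 * Real.pi) * (Real.exp (-(2 * x)) * (√N * √N)) := by ring
      _ = K * (3 * Real.pi) * n := by
          rw [Real.mul_self_sqrt (by linarith), hNdef, mul_left_comm (Real.exp _), ← Real.exp_add]
          simp
  refine ⟨Real.exp C * (K * (3 * Real.pi)), fun n x hx => ?_⟩
  have hexpC : 1 ≤ Real.exp C := Real.one_le_exp (by linarith)
  rcases Nat.eq_zero_or_pos n with hn | hn
  · subst hn; simp [edgeOnePoint]
  have hn0 : (0 : ℝ) < n := by exact_mod_cast hn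
  have hn1 : (1 : ℝ) ≤ n := by exact_mod_cast hn
  rcases le_or_gt 1 (n * Real.exp (2 * x)) with hN | hN
  · refine (big n x hx hN).trans ?_
    rw [mul_assoc (Real.exp C)]
    exact le_mul_of_one_le_left (by positivity) hexpC
  -- The threshold n e^{2y} = 1. From x up to y the monomials increase, while nψ grows by at most
  -- nCe^{2y} = C; this costs the factor e^C.
  · set y := -(Real.log n / 2) with hy
    have hey : Real.exp (2 * y) = (n : ℝ)⁻¹ := by
      rw [hy, show 2 * -(Real.log n / 2) = -Real.log n by ring, Real.exp_neg, Real.exp_log hn0]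
    have hxy : x ≤ y := by
      have : Real.exp (2 * x) ≤ Real.exp (2 * y) := by
        rw [hey, inv_eq_one_div, le_div_iff₀ hn0, mul_comm]; exact hN.le
      have := Real.exp_le_exp.1 this
      linarith
    have hy0 : y ≤ 0 := by
      have := Real.log_nonneg hn1
      rw [hy]; linarith
    have hyJ : y ∈ J := H.ordConnected.out hx H.zero_mem ⟨hxy, hy0⟩
    have h1 := big n y hyJ (by rw [hey, mul_inv_cancel₀ hn0.ne'])
    have h2 : n * (ψ y - ψ x) ≤ C := by
      have := H.sub_le hx hyJ hxy
      rw [hey] at this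
      calc n * (ψ y - ψ x) ≤ n * (C * (n : ℝ)⁻¹) := by gcongr
        _ = C := by field_simp
    have h3 : edgeOnePoint ψ J n x ≤ Real.exp C * edgeOnePoint ψ J n y := by
      rw [edgeOnePoint, edgeOnePoint, Finset.mul_sum]
      refine Finset.sum_le_sum fun j _ => ?_
      rw [← mul_div_assoc, ← Real.exp_add]
      have := H.edgeNorm_pos n j
      have h4 : 2 * (j : ℝ) * x ≤ 2 * j * y := by gcongr
      gcongr
      linarith
    calc _ ≤ _ := h3
      _ ≤ Real.exp C * (K * (3 * Real.pi) * n) := by gcongr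
      _ = _ := by ring

end IsEdgeProfile
end HardEdge
end

/-! ### The limit profile and the expansion of ψ at the edge -/

noncomputable section

namespace HardEdge

/-- The integrand is constant on each (k, k + 1], so the sum is an exact integral and dominated
convergence can replace a Riemann sum argument. -/
lemma integral_ceil_eq_sum (T : ℕ → ℝ) (N : ℕ) (hT : ∀ k, N < k → T k = 0) :
    ∫ u in Ioi (0 : ℝ), T ⌈u⌉₊ = ∑ k ∈ Finset.range N, T (k + 1) := by
  have hceil : ∀ k : ℕ, ∀ u ∈ Ioc (k : ℝ) ((k + 1 : ℕ) : ℝ), ⌈u⌉₊ = k + 1 := by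
    intro k u hu
    rw [Nat.ceil_eq_iff (Nat.succ_ne_zero k)]
    simpa using hu
  have h1 : ∀ k : ℕ, IntervalIntegrable (fun u : ℝ => T ⌈u⌉₊) volume (k : ℝ) ((k + 1 : ℕ) : ℝ) := by
    intro k
    refine (intervalIntegrable_const (c := T (k + 1))).congr ?_
    rw [uIoc_of_le (by simp)]
    intro u hu
    simp only [hceil k u hu]
  have h2 : ∀ k : ℕ, ∫ u in (k : ℝ)..((k + 1 : ℕ) : ℝ), T ⌈u⌉₊ = T (k + 1) := by
    intro k
    have : ∫ u in (k : ℝ)..((k + 1 : ℕ) : ℝ), T ⌈u⌉₊ =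
        ∫ _u in (k : ℝ)..((k + 1 : ℕ) : ℝ), T (k + 1) := by
      rw [intervalIntegral.integral_of_le (by simp), intervalIntegral.integral_of_le (by simp)]
      exact setIntegral_congr_fun measurableSet_Ioc fun u hu => by simp only [hceil k u hu]
    rw [this, intervalIntegral.integral_const]; simp
  have h3 : ∫ u in Ioi (0 : ℝ), T ⌈u⌉₊ = ∫ u in Ioc (0 : ℝ) N, T ⌈u⌉₊ := by
    refine (setIntegral_eq_of_subset_of_forall_sdiff_eq_zero measurableSet_Ioi Ioc_subset_Ioi_self
      fun u hu => hT _ ?_)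
    rw [Nat.lt_ceil]
    by_contra hcon
    push Not at hcon
    exact hu.2 ⟨hu.1, hcon⟩
  have h4 := intervalIntegral.sum_integral_adjacent_intervals (μ := volume)
    (f := fun u : ℝ => T ⌈u⌉₊) (a := fun k : ℕ => (k : ℝ)) (n := N) fun k _ => h1 k
  rw [h3, ← intervalIntegral.integral_of_le (by simp), ← Finset.sum_congr rfl fun k _ => h2 k, h4]
  simp

lemma integral_Iic_zero_comp_mul_left (f : ℝ → ℝ) {c : ℝ} (hc : 0 < c) :
    ∫ s in Iic (0 : ℝ), f (c * s) = c⁻¹ * ∫ s in Iic (0 : ℝ), f s := by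
  have h1 := integral_comp_neg_Ioi 0 (fun s => f (c * s))
  have h2 := integral_comp_neg_Ioi 0 f
  have h3 := integral_comp_mul_left_Ioi (fun s => f (-s)) 0 hc
  rw [neg_zero] at h1 h2
  rw [mul_zero, smul_eq_mul, h2] at h3
  rw [← h1, ← h3]
  simp only [mul_neg]

/-- The limit profile is the hard edge plasma function. -/
lemma integral_profile_eq_plasma {D : ℝ} (hD : 0 < D) (ξ : ℝ) :
    ∫ κ in Ioi (0 : ℝ), Real.exp (-2 * κ * ξ - 2 * D * ξ ^ 2) /
      ∫ s in Iio (0 : ℝ), 2 * Real.exp (-2 * κ * s - 2 * D * s ^ 2) = D * plasma (2 * √D * ξ) := by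
  have hs : 0 < √D := Real.sqrt_pos.2 hD
  have hsq : √D * √D = D := Real.mul_self_sqrt hD.le
  have h2pi : 0 < √(2 * Real.pi) := by positivity
  have hφ : ∀ η : ℝ, freeBoundary (-η) = ∫ u in Iio (0 : ℝ), gaussKernel (u + η) := by
    intro η
    rw [freeBoundary, gaussConv, ← integral_indicator measurableSet_Iio]
    congr 1 with u
    by_cases hu : u ∈ Iio (0 : ℝ)
    · rw [indicator_of_mem hu, indicator_of_mem hu, Pi.one_apply, mul_one, gaussKernel, gaussKernel]
      congr 3; ring
    · rw [indicator_of_notMem hu, indicator_of_notMem hu, mul_zero]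
  -- Complete the square: -2η√D s - 2Ds² = η²/2 - (2√D s + η)²/2, then substitute v = 2√D s.
  have hI : ∀ η : ℝ, ∫ s in Iio (0 : ℝ), 2 * Real.exp (-2 * (η * √D) * s - 2 * D * s ^ 2) =
      (√D)⁻¹ * (√(2 * Real.pi) * Real.exp (η ^ 2 / 2) * freeBoundary (-η)) := by
    intro η
    have e1 : ∀ s : ℝ, 2 * Real.exp (-2 * (η * √D) * s - 2 * D * s ^ 2) =
        (fun v => 2 * (√(2 * Real.pi) * Real.exp (η ^ 2 / 2) * gaussKernel (v + η))) (2 * √D * s) := by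
      intro s
      simp only [gaussKernel]
      rw [show √(2 * Real.pi) * Real.exp (η ^ 2 / 2) * ((√(2 * Real.pi))⁻¹ *
        Real.exp (-(2 * √D * s + η) ^ 2 / 2)) = Real.exp (η ^ 2 / 2) *
        Real.exp (-(2 * √D * s + η) ^ 2 / 2) by field_simp, ← Real.exp_add]
      congr 2
      linear_combination (-2 * s ^ 2) * (hsq.symm)
    rw [hφ]
    simp_rw [← integral_Iic_eq_integral_Iio, e1]
    rw [integral_Iic_zero_comp_mul_left (fun v => 2 * (√(2 * Real.pi) * Real.exp (η ^ 2 / 2) *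
      gaussKernel (v + η))) (by positivity : 0 < 2 * √D), integral_const_mul,
      integral_const_mul]
    field_simp
  -- Substitution κ = η√D. The factor e^{η²/2} from the denominator then completes the square in the
  -- numerator.
  have hscale := integral_comp_mul_right_Ioi (fun κ => Real.exp (-2 * κ * ξ - 2 * D * ξ ^ 2) /
      ∫ s in Iio (0 : ℝ), 2 * Real.exp (-2 * κ * s - 2 * D * s ^ 2)) 0 hs
  rw [zero_mul, smul_eq_mul] at hscale
  have e2 : ∀ η : ℝ, Real.exp (-2 * (η * √D) * ξ - 2 * D * ξ ^ 2) /
      ∫ s in Iio (0 : ℝ), 2 * Real.exp (-2 * (η * √D) * s - 2 * D * s ^ 2) =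
      √D * (gaussKernel (2 * √D * ξ - -η) * (1 / freeBoundary (-η))) := by
    intro η
    rw [hI]
    simp only [gaussKernel]
    have : Real.exp (-2 * (η * √D) * ξ - 2 * D * ξ ^ 2) =
        Real.exp (-(2 * √D * ξ - -η) ^ 2 / 2) * Real.exp (η ^ 2 / 2) := by
      rw [← Real.exp_add]; congr 1
      linear_combination (-2 * ξ ^ 2) * (hsq.symm)
    rw [this]
    have := Real.exp_pos (η ^ 2 / 2)
    field_simp
  simp_rw [e2] at hscale
  rw [integral_const_mul] at hscale
  have hpl : ∫ η in Ioi (0 : ℝ), gaussKernel (2 * √D * ξ - -η) * (1 / freeBoundary (-η)) =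
      plasma (2 * √D * ξ) := by
    rw [integral_comp_neg_Ioi 0 (fun t => gaussKernel (2 * √D * ξ - t) * (1 / freeBoundary t)), neg_zero,
      plasma, gaussConv, integral_Iic_eq_integral_Iio, ← integral_indicator measurableSet_Iio]
    congr 1 with t
    by_cases ht : t ∈ Iio (0 : ℝ)
    · rw [indicator_of_mem ht, indicator_of_mem ht, Pi.one_apply]
    · rw [indicator_of_notMem ht, indicator_of_notMem ht, zero_div, mul_zero]
  rw [hpl] at hscale
  rw [eq_inv_mul_iff_mul_eq₀ hs.ne'] at hscale
  rw [← hscale, ← mul_assoc, hsq]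

namespace IsEdgeProfile

variable {ψ m : ℝ → ℝ} {J : Set ℝ} {C ℓ D : ℝ}

/-- Second-order expansion from the left. Only the one-sided derivative of m at 0 is available, so
l'Hôpital's rule is applied once, to reach the difference quotient of m. -/
lemma tendsto_taylor (H : IsEdgeProfile ψ m J C ℓ D) :
    Tendsto (fun t => (ψ t - ψ 0 - 2 * t) / t ^ 2) (𝓝[<] 0) (𝓝 (2 * D)) := by
  have hJ : ∀ᶠ t in 𝓝[<] (0 : ℝ), t ∈ J := by
    filter_upwards [Ioo_mem_nhdsLT (by linarith [H.ell_pos] : -ℓ < 0)] with t ht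
    exact H.Icc_subset ⟨ht.1.le, ht.2.le⟩
  refine HasDerivAt.lhopital_zero_nhdsLT (f' := fun t => 2 * m t - 2) (g' := fun t => 2 * t) ?_ ?_ ?_
    ?_ ?_ ?_
  · filter_upwards [hJ] with t ht
    refine (((H.deriv t ht).sub_const (ψ 0)).sub ((hasDerivAt_id t).const_mul 2)).congr_deriv ?_
    simp
  · filter_upwards with t
    simpa using (hasDerivAt_pow 2 t)
  · filter_upwards [self_mem_nhdsWithin] with t ht
    have : t < 0 := ht
    simp [this.ne]
  · have h1 := (H.deriv 0 H.zero_mem).continuousAt.tendsto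
    have : Tendsto (fun t => ψ t - ψ 0 - 2 * t) (𝓝 0) (𝓝 (ψ 0 - ψ 0 - 2 * 0)) :=
      (h1.sub tendsto_const_nhds).sub (tendsto_id.const_mul 2)
    simp only [sub_self, mul_zero] at this
    exact tendsto_nhdsWithin_of_tendsto_nhds this
  · have : Tendsto (fun t : ℝ => t ^ 2) (𝓝 0) (𝓝 (0 ^ 2)) := Continuous.tendsto (by fun_prop) 0
    simp only [ne_eq, OfNat.ofNat_ne_zero, not_false_eq_true, zero_pow] at this
    exact tendsto_nhdsWithin_of_tendsto_nhds this
  · have h1 := hasDerivWithinAt_iff_tendsto_slope.1 H.m_deriv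
    rw [Iic_sdiff_right] at h1
    refine h1.congr' ?_
    filter_upwards [self_mem_nhdsWithin] with t ht
    have : t < 0 := ht
    rw [slope_def_field, H.m_zero, sub_zero]
    have := this.ne
    field_simp

/-- Quadratic growth at the edge. -/
lemma exists_quadratic_growth (H : IsEdgeProfile ψ m J C ℓ D) :
    ∃ δ > 0, ∀ t ∈ J, D / 2 * (-t * min (-t) δ) ≤ ψ t - ψ 0 - 2 * t := by
  have hD := H.D_pos
  have h1 := hasDerivWithinAt_iff_tendsto_slope.1 H.m_deriv
  rw [Iic_sdiff_right] at h1
  have h2 := h1.eventually (lt_mem_nhds (by linarith : D < 2 * D))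
  obtain ⟨ε, hε, hb⟩ := mem_nhdsLT_iff_exists_Ioo_subset.1 h2
  have hε : ε < 0 := hε
  -- On [-δ, 0] the difference quotient of m, whose limit is 2D, still exceeds D; further left,
  -- monotonicity of m preserves the deficit Dδ.
  set δ := min (-ε / 2) ℓ with hδ
  have hδ0 : 0 < δ := lt_min (by linarith) H.ell_pos
  have hsmall : ∀ t, -δ ≤ t → t ≤ 0 → m t ≤ 1 - D * -t := by
    intro t ht ht0
    rcases eq_or_lt_of_le ht0 with h | h
    · rw [h, H.m_zero]; simp
    · have : δ ≤ -ε / 2 := min_le_left _ _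
      have := hb ⟨by linarith, h⟩
      simp only [mem_ofPred_eq, slope_def_field, H.m_zero, sub_zero] at this
      rw [lt_div_iff_of_neg h] at this
      linarith
  have hm : ∀ t ∈ J, m t ≤ 1 - D * min (-t) δ := by
    intro t ht
    rcases le_total (-δ) t with h | h
    · rw [min_eq_left (by linarith)]; exact hsmall t h (H.subset ht)
    · rw [min_eq_right (by linarith)]
      have hδJ : -δ ∈ J := H.Icc_subset ⟨by linarith [min_le_right (-ε / 2) ℓ], by linarith⟩
      have := H.mono ht hδJ h
      have := hsmall (-δ) le_rfl (by linarith)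
      linarith
  refine ⟨δ, hδ0, fun t ht => ?_⟩
  have ht0 : t ≤ 0 := H.subset ht
  have htJ : t / 2 ∈ J := H.ordConnected.out ht H.zero_mem ⟨by linarith, by linarith⟩
  have hlin : ∀ c u : ℝ, HasDerivAt (fun u => c * u) c u := fun c u => by
    simpa using (hasDerivAt_id u).const_mul c
  -- On the outer half [t, t/2] the deficit of m is at least half of D·min(-t, δ); on [t/2, 0] only
  -- m ≤ 1 is used.
  have a1 := H.sub_le_of_deriv_le ht htJ (by linarith) (hlin (2 - D * min (-t) δ)) fun u hu => by
    have h3 := hm u (H.ordConnected.out ht htJ hu)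
    have h4 : min (-t) δ / 2 ≤ min (-u) δ := by
      refine le_min ?_ ?_
      · linarith [hu.2, min_le_left (-t) δ]
      · linarith [min_le_right (-t) δ]
    nlinarith
  have a2 := H.sub_le_of_deriv_le htJ H.zero_mem (by linarith) (hlin 2) fun u hu => by
    have h3 := hm u (H.ordConnected.out htJ H.zero_mem hu)
    have h4 : 0 ≤ min (-u) δ := le_min (by linarith [hu.2]) hδ0.le
    nlinarith
  linarith

end IsEdgeProfile
end HardEdge
end

/-! ### The scaling limit at the outer edge -/

noncomputable section

namespace HardEdge
namespace IsEdgeProfile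

variable {ψ m : ℝ → ℝ} {J : Set ℝ} {C ℓ D : ℝ} {ι : Type*} {F : Filter ι}

lemma tendsto_sqrt_natCast {N : ι → ℕ} (hN : Tendsto N F atTop) :
    Tendsto (fun i => √(N i : ℝ)) F atTop :=
  Real.tendsto_sqrt_atTop.comp (tendsto_natCast_atTop_atTop.comp hN)

lemma tendsto_zero_of_sqrt_mul {N : ι → ℕ} (hN : Tendsto N F atTop) {x : ι → ℝ} {ξ : ℝ}
    (hx : Tendsto (fun i => √(N i : ℝ) * x i) F (𝓝 ξ)) : Tendsto x F (𝓝 0) := by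
  have h1 := hx.mul (tendsto_inv_atTop_zero.comp (tendsto_sqrt_natCast hN))
  rw [mul_zero] at h1
  refine h1.congr' ?_
  filter_upwards [hN.eventually_ge_atTop 1] with i hi
  have : 0 < √(N i : ℝ) := Real.sqrt_pos.2 (by exact_mod_cast hi)
  simp only [Function.comp_apply]
  field_simp

lemma tendsto_mul_taylor (H : IsEdgeProfile ψ m J C ℓ D) {N : ι → ℕ} (hN : Tendsto N F atTop)
    {x : ι → ℝ} {ξ : ℝ} (hx : Tendsto (fun i => √(N i : ℝ) * x i) F (𝓝 ξ)) (hξ : ξ < 0) :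
    Tendsto (fun i => N i * (ψ (x i) - ψ 0 - 2 * x i)) F (𝓝 (2 * D * ξ ^ 2)) := by
  have hneg : ∀ᶠ i in F, x i < 0 := by
    filter_upwards [hx.eventually (gt_mem_nhds hξ)] with i hi
    by_contra hcon
    push Not at hcon
    exact absurd hi (not_lt.2 (mul_nonneg (Real.sqrt_nonneg _) hcon))
  have h1 : Tendsto x F (𝓝[<] 0) :=
    tendsto_nhdsWithin_of_tendsto_nhds_of_eventually_within _ (tendsto_zero_of_sqrt_mul hN hx) hneg
  have h2 := (H.tendsto_taylor.comp h1).mul (hx.pow 2)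
  refine h2.congr' ?_
  filter_upwards [hneg] with i hi
  simp only [Function.comp_apply, mul_pow, Real.sq_sqrt (Nat.cast_nonneg (N i))]
  have := hi.ne
  field_simp

/-- Laplace's method at an endpoint. For j = N - k the linear terms at the edge nearly cancel, since
m(0) = 1, leaving -2(k - 1)t minus N times the Taylor remainder of ψ; the scaling s = √N t makes
both terms of order one. -/
lemma tendsto_sqrt_mul_edgeNorm [F.IsCountablyGenerated] (H : IsEdgeProfile ψ m J C ℓ D) {N k : ι → ℕ}
    (hN : Tendsto N F atTop) (hk : ∀ᶠ i in F, 1 ≤ k i ∧ k i ≤ N i) {κ : ℝ}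
    (hκ : Tendsto (fun i => (k i : ℝ) / √(N i : ℝ)) F (𝓝 κ)) :
    Tendsto (fun i => √(N i : ℝ) * (Real.exp (N i * ψ 0) * edgeNorm ψ J (N i) (N i - k i))) F
      (𝓝 (∫ s in Iio (0 : ℝ), 2 * Real.exp (-2 * κ * s - 2 * D * s ^ 2))) := by
  have hD := H.D_pos
  set g : ι → ℝ → ℝ := fun i => J.indicator fun t =>
    2 * Real.exp (-2 * (k i - 1) * t - N i * (ψ t - ψ 0 - 2 * t)) with hg
  have hgm : ∀ i, Measurable (g i) := by
    intro i
    classical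
    simp only [hg]
    rw [← piecewise_eq_indicator]
    refine ContinuousOn.measurable_piecewise ?_ continuousOn_const H.measurable
    have := H.continuousOn
    fun_prop
  have hsqrt := tendsto_sqrt_natCast hN
  have heq : ∀ᶠ i in F, ∫ s in Iic (0 : ℝ), g i ((√(N i : ℝ))⁻¹ * s) =
      √(N i : ℝ) * (Real.exp (N i * ψ 0) * edgeNorm ψ J (N i) (N i - k i)) := by
    filter_upwards [hk, hN.eventually_ge_atTop 1] with i hi hi1
    have hs : 0 < √(N i : ℝ) := Real.sqrt_pos.2 (by exact_mod_cast hi1)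
    rw [integral_Iic_zero_comp_mul_left _ (inv_pos.2 hs), inv_inv]
    congr 1
    simp only [hg]
    rw [edgeNorm, ← integral_const_mul, setIntegral_indicator H.measurable, inter_eq_right.2 H.subset]
    refine setIntegral_congr_fun H.measurable fun t _ => ?_
    rw [mul_left_comm, ← Real.exp_add, Nat.cast_sub hi.2]
    congr 2; ring
  rw [← integral_Iic_eq_integral_Iio]
  refine Tendsto.congr' heq ?_
  obtain ⟨δ, hδ, hgrow⟩ := H.exists_quadratic_growth
  set b := |κ| + 1 with hb
  have hb1 : 1 ≤ b := by rw [hb]; linarith [abs_nonneg κ]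
  -- The Gaussian dominates where |s| ≤ √N δ, by quadratic growth of ψ. Beyond that ψ grows at least
  -- linearly, with a slope of order √N in s, which eventually beats the linear term 2b|s| and
  -- leaves e^s.
  set bound : ℝ → ℝ := fun s => 2 * (Real.exp (4 * b ^ 2 / D) * Real.exp (-(D / 4) * s ^ 2) + Real.exp s)
    with hbound
  refine tendsto_integral_filter_of_dominated_convergence bound ?_ ?_ ?_ ?_
  · exact Eventually.of_forall fun i =>
      ((hgm i).comp (measurable_const_mul _)).aestronglyMeasurable
  · have h1 : ∀ᶠ i in F, (k i : ℝ) / √(N i : ℝ) ≤ b := by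
      refine hκ.eventually (ge_mem_nhds ?_)
      rw [hb]; linarith [le_abs_self κ]
    have h2 : ∀ᶠ i in F, (2 * b + 1) / (D / 2 * δ) ≤ √(N i : ℝ) := hsqrt.eventually_ge_atTop _
    filter_upwards [h1, h2, hk, hN.eventually_ge_atTop 1] with i hi1 hi2 hki hNi
    have hs : 0 < √(N i : ℝ) := Real.sqrt_pos.2 (by exact_mod_cast hNi)
    rw [div_le_iff₀ (by positivity)] at hi2
    filter_upwards [ae_restrict_mem measurableSet_Iic] with s hs0
    have hs0 : s ≤ 0 := hs0
    have hbn : 0 ≤ bound s := by simp only [hbound]; positivity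
    simp only [hg]
    by_cases ht : (√(N i : ℝ))⁻¹ * s ∈ J
    · rw [indicator_of_mem ht, Real.norm_of_nonneg (by positivity)]
      simp only [hbound]
      gcongr
      have hgt := hgrow _ ht
      set t := (√(N i : ℝ))⁻¹ * s with htdef
      have hst : s = √(N i : ℝ) * t := by rw [htdef]; field_simp
      have hNs : (N i : ℝ) = √(N i : ℝ) * √(N i : ℝ) := (Real.mul_self_sqrt (Nat.cast_nonneg _)).symm
      have ht0 : 0 ≤ -t := by linarith [mem_Iic.1 (H.subset ht)]
      have h3 : -2 * ((k i : ℝ) - 1) * t ≤ 2 * b * -s := by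
        rw [div_le_iff₀ hs] at hi1
        have : (k i : ℝ) * -t ≤ b * √(N i : ℝ) * -t := by gcongr
        rw [hst]; nlinarith
      have h4 : D / 2 * (-s * min (-s) (√(N i : ℝ) * δ)) ≤ N i * (ψ t - ψ 0 - 2 * t) := by
        have e : D / 2 * (-s * min (-s) (√(N i : ℝ) * δ)) = N i * (D / 2 * (-t * min (-t) δ)) := by
          rw [hst, ← mul_neg, ← mul_min_of_nonneg _ _ hs.le]
          linear_combination (-(D / 2 * (-t * min (-t) δ))) * hNs
        rw [e]
        gcongr
      rcases le_total (-s) (√(N i : ℝ) * δ) with h | h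
      · rw [min_eq_left h] at h4
        refine le_trans ?_ (le_add_of_nonneg_right (Real.exp_pos s).le)
        rw [← Real.exp_add, Real.exp_le_exp]
        have h5 : 2 * b * -s ≤ D / 4 * s ^ 2 + 4 * b ^ 2 / D := by
          have : 0 ≤ (D / 4 * -s - b) ^ 2 * (4 / D) := by positivity
          have e : (D / 4 * -s - b) ^ 2 * (4 / D) = D / 4 * s ^ 2 - 2 * b * -s + 4 * b ^ 2 / D := by
            field_simp; ring
          linarith
        nlinarith
      · rw [min_eq_right h] at h4
        refine le_trans ?_ (le_add_of_nonneg_left (by positivity))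
        rw [Real.exp_le_exp]
        have h5 : (2 * b + 1) * -s ≤ √(N i : ℝ) * (D / 2 * δ) * -s := by gcongr; linarith
        nlinarith
    · rw [indicator_of_notMem ht, norm_zero]; exact hbn
  · have h1 := (integrable_exp_neg_mul_sq (by positivity : 0 < D / 4)).const_mul
      (Real.exp (4 * b ^ 2 / D))
    exact (h1.integrableOn.add (integrableOn_exp_Iic 0)).const_mul 2
  · have hne : ∀ᵐ s ∂(volume.restrict (Iic (0 : ℝ))), s ≠ 0 :=
      ae_restrict_of_ae (Measure.ae_ne volume 0)
    filter_upwards [ae_restrict_mem measurableSet_Iic, hne] with s hs0 hsne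
    have hs : s < 0 := lt_of_le_of_ne hs0 hsne
    have hx : Tendsto (fun i => √(N i : ℝ) * ((√(N i : ℝ))⁻¹ * s)) F (𝓝 s) := by
      refine tendsto_const_nhds.congr' ?_
      filter_upwards [hN.eventually_ge_atTop 1] with i hi
      have : 0 < √(N i : ℝ) := Real.sqrt_pos.2 (by exact_mod_cast hi)
      field_simp
    have hx0 := tendsto_zero_of_sqrt_mul hN hx
    have hT := H.tendsto_mul_taylor hN hx hs
    have hmem : ∀ᶠ i in F, (√(N i : ℝ))⁻¹ * s ∈ J := by
      filter_upwards [hx0.eventually (lt_mem_nhds (by linarith [H.ell_pos] : -ℓ < 0))] with i hi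
      exact H.Icc_subset ⟨hi.le, mul_nonpos_of_nonneg_of_nonpos (by positivity) hs.le⟩
    have hlin : Tendsto (fun i => -2 * ((k i : ℝ) - 1) * ((√(N i : ℝ))⁻¹ * s)) F (𝓝 (-2 * κ * s)) := by
      have h1 := ((hκ.mul_const s).const_mul (-2)).sub (hx0.const_mul (-2))
      rw [mul_zero, sub_zero, ← mul_assoc] at h1
      refine h1.congr fun i => ?_
      ring
    have := ((Real.continuous_exp.tendsto _).comp (hlin.sub hT)).const_mul 2
    refine this.congr' ?_
    filter_upwards [hmem] with i hi
    simp only [hg, indicator_of_mem hi, Function.comp_apply]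

lemma integral_profile_pos (κ : ℝ) (hD : 0 < D) :
    0 < ∫ s in Iio (0 : ℝ), 2 * Real.exp (-2 * κ * s - 2 * D * s ^ 2) := by
  have hI : Integrable fun s : ℝ => 2 * Real.exp (-2 * κ * s - 2 * D * s ^ 2) := by
    refine Integrable.const_mul ?_ 2
    refine ((integrable_exp_neg_mul_sq hD).const_mul (Real.exp (κ ^ 2 / D))).mono'
      (by fun_prop) (Eventually.of_forall fun s => ?_)
    rw [Real.norm_of_nonneg (Real.exp_pos _).le, ← Real.exp_add, Real.exp_le_exp]
    have : 0 ≤ (D * s + κ) ^ 2 * (1 / D) := by positivity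
    have e : (D * s + κ) ^ 2 * (1 / D) = D * s ^ 2 + 2 * κ * s + κ ^ 2 / D := by field_simp; ring
    linarith
  refine (setIntegral_pos_iff_support_of_nonneg_ae ?_ hI.integrableOn).2 ?_
  · exact Eventually.of_forall fun s => by simp only [Pi.zero_apply]; positivity
  · have : (Function.support fun s : ℝ => 2 * Real.exp (-2 * κ * s - 2 * D * s ^ 2)) = univ :=
      eq_univ_of_forall fun s => by simp only [Function.mem_support]; positivity
    rw [this, univ_inter]; simp

lemma one_add_sq_le_of_le {B κ v y : ℝ} (hB : 0 ≤ B) (hκ : 0 ≤ κ) (hv : κ - 1 - B ≤ v)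
    (hy : v ^ 2 ≤ y) : 1 + κ ^ 2 ≤ (5 + 4 * (B + 1) ^ 2) * (1 + y) := by
  have h0 : 0 ≤ y := (sq_nonneg v).trans hy
  have h1 : 0 ≤ (B + 1) ^ 2 * y := by positivity
  rcases le_total κ (2 * (B + 1)) with h | h
  · have : κ ^ 2 ≤ (2 * (B + 1)) ^ 2 := by gcongr
    linarith
  · have h6 : (κ / 2) ^ 2 ≤ v ^ 2 := by gcongr; linarith
    have h7 : 0 ≤ (B + 1) ^ 2 := by positivity
    linarith

/-- Supplies the dominating function in κ. Near the edge N m(x) differs from N by at most CX√N, so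
the Lorentzian in j = N - k is one in κ of unit width, up to a bounded shift. -/
lemma exists_inv_sqrt_mul_le (H : IsEdgeProfile ψ m J C ℓ D) {X : ℝ} (hX : 0 ≤ X) :
    ∃ M, 0 ≤ M ∧ ∀ N : ℕ, 3 ≤ N → ∀ x ∈ J, -(1 / 2) ≤ x → |√(N : ℝ) * x| ≤ X →
      ∀ κ : ℝ, 0 < κ → ∀ k : ℕ, 1 ≤ k → k ≤ N → κ * √(N : ℝ) ≤ k →
      (√(N : ℝ))⁻¹ * (Real.exp (2 * (N - k : ℕ) * x - N * ψ x) / edgeNorm ψ J N (N - k)) ≤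
        M * (1 + κ ^ 2)⁻¹ := by
  have hC := H.one_le_C
  obtain ⟨K, hK, hb⟩ := H.exists_div_edgeNorm_le
  have hB0 : 0 ≤ C * X := by positivity
  refine ⟨2 * K * (5 + 4 * (C * X + 1) ^ 2), by positivity, ?_⟩
  intro N hi3 x hiJ hi2 hi1 κ hκ k hk1 hle hk2
  have hN3 : (3 : ℝ) ≤ N := by exact_mod_cast hi3
  have hN0 : (0 : ℝ) < N := by linarith
  have hs : 0 < √(N : ℝ) := Real.sqrt_pos.2 hN0
  have hs1 : 1 ≤ √(N : ℝ) := Real.one_le_sqrt.2 (by linarith)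
  have hx0' : x ≤ 0 := H.subset hiJ
  set E := Real.exp (2 * x) with hE
  have hE1 : E ≤ 1 := Real.exp_le_one_iff.2 (by linarith)
  -- From x ≥ -1/2 and e < 3. Together with N ≥ 3 this gives N e^{2x} ≥ 1, the range of the term
  -- bound.
  have hEh : 1 / 3 ≤ E := by
    have h1 : Real.exp (-1) ≤ E := Real.exp_le_exp.2 (by linarith)
    have h2 : Real.exp 1 < 3 := by linarith [Real.exp_one_lt_d9]
    rw [Real.exp_neg] at h1
    refine le_trans ?_ h1
    rw [one_div]
    exact inv_anti₀ (Real.exp_pos 1) h2.le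
  have hE0 : 0 < E := Real.exp_pos _
  have hNE : 1 ≤ N * E := by
    calc (1 : ℝ) = 3 * (1 / 3) := by norm_num
      _ ≤ N * E := by gcongr
  have hbb := hb N (N - k) (by omega) x hiJ hNE
  have hkc : ((N - k : ℕ) : ℝ) = N - k := Nat.cast_sub hle
  have hae : Real.exp (2 * (N - k : ℕ) * x - N * ψ x) / edgeNorm ψ J N (N - k) =
      E⁻¹ * (Real.exp (2 * ((N - k : ℕ) + 1) * x - N * ψ x) / edgeNorm ψ J N (N - k)) := by
    rw [← mul_div_assoc, hE, ← Real.exp_neg, ← Real.exp_add]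
    congr 2; ring
  rw [hkc] at hbb
  set q := (N : ℝ) - k + 1 - N * m x with hq
  have hsE : E⁻¹ * √E ≤ 2 := by
    have hsE0 : 0 < √E := Real.sqrt_pos.2 hE0
    have : E⁻¹ * √E = (√E)⁻¹ := by
      nth_rewrite 1 [← Real.mul_self_sqrt hE0.le]
      field_simp
    rw [this, inv_le_comm₀ hsE0 (by norm_num)]
    refine Real.le_sqrt_of_sq_le ?_
    norm_num; linarith
  have hstep : (√(N : ℝ))⁻¹ * (Real.exp (2 * (N - k : ℕ) * x - N * ψ x) / edgeNorm ψ J N (N - k)) ≤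
      2 * K * (1 + q ^ 2 / (N * E))⁻¹ := by
    rw [hae, hkc]
    have h1 := mul_le_mul_of_nonneg_left (mul_le_mul_of_nonneg_left hbb (inv_pos.2 hE0).le)
      (inv_pos.2 hs).le
    refine h1.trans ?_
    rw [Real.sqrt_mul hN0.le]
    have e : (√(N : ℝ))⁻¹ * (E⁻¹ * (K * (√(N : ℝ) * √E * (1 + q ^ 2 / (N * E))⁻¹))) =
        (E⁻¹ * √E) * K * (1 + q ^ 2 / (N * E))⁻¹ := by
      generalize (1 + q ^ 2 / (N * E))⁻¹ = z
      field_simp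
    rw [e]
    gcongr
  refine hstep.trans ?_
  have hq1 : κ - 1 - C * X ≤ -q / √(N : ℝ) := by
    rw [le_div_iff₀ hs]
    have h1 := H.lip x hiJ 0 H.zero_mem hx0'
    rw [H.m_zero] at h1
    simp only [mul_zero, Real.exp_zero, mul_one, zero_sub] at h1
    have h2 : N * (1 - m x) ≤ C * X * √(N : ℝ) := by
      have h3 : √(N : ℝ) * -x ≤ X := by
        refine le_trans ?_ hi1
        rw [mul_neg]; exact neg_le_abs _
      calc (N : ℝ) * (1 - m x) ≤ N * (C * -x) := by gcongr
        _ = C * (√(N : ℝ) * -x) * √(N : ℝ) := by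
            nth_rewrite 1 [← Real.mul_self_sqrt hN0.le]; ring
        _ ≤ C * X * √(N : ℝ) := by gcongr
    rw [hq]
    linarith
  have hq2 : (-q / √(N : ℝ)) ^ 2 ≤ q ^ 2 / (N * E) := by
    rw [div_pow, Real.sq_sqrt hN0.le, neg_sq]
    exact div_le_div_of_nonneg_left (by positivity) (by positivity)
      (mul_le_of_le_one_right hN0.le hE1)
  have hfin := one_add_sq_le_of_le hB0 hκ.le hq1 hq2
  have hy : 0 ≤ q ^ 2 / (N * E) := by positivity
  rw [mul_assoc (2 * K)]
  refine mul_le_mul_of_nonneg_left ?_ (by positivity)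
  rw [← div_eq_mul_inv, le_div_iff₀ (by positivity), inv_mul_le_iff₀ (by positivity), mul_comm]
  exact hfin

/-- The scaling limit of the one-point function at the edge. -/
theorem tendsto_edgeOnePoint [F.IsCountablyGenerated] (H : IsEdgeProfile ψ m J C ℓ D) {N : ι → ℕ}
    (hN : Tendsto N F atTop) {x : ι → ℝ} (hxJ : ∀ᶠ i in F, x i ∈ J) {ξ : ℝ} (hξ : ξ < 0)
    (hx : Tendsto (fun i => √(N i : ℝ) * x i) F (𝓝 ξ)) :
    Tendsto (fun i => (N i : ℝ)⁻¹ * edgeOnePoint ψ J (N i) (x i)) F (𝓝 (D * plasma (2 * √D * ξ))) := by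
  have hC := H.one_le_C
  have hD := H.D_pos
  have hx0 := tendsto_zero_of_sqrt_mul hN hx
  set a : ι → ℕ → ℝ := fun i j =>
    Real.exp (2 * j * x i - N i * ψ (x i)) / edgeNorm ψ J (N i) j with ha
  -- Terms are indexed from the top degree, k = N - j with 1 ≤ k ≤ N, and are zero for k > N. The
  -- value at k = 0 never enters, because ⌈u⌉ ≥ 1 for u > 0.
  set T : ι → ℕ → ℝ := fun i k => if k ≤ N i then a i (N i - k) else 0 with hT
  have hsum : ∀ᶠ i in F, ∫ κ in Ioi (0 : ℝ), (√(N i : ℝ))⁻¹ * T i ⌈κ * √(N i : ℝ)⌉₊ =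
      (N i : ℝ)⁻¹ * edgeOnePoint ψ J (N i) (x i) := by
    filter_upwards [hN.eventually_ge_atTop 1] with i hi
    have hs : 0 < √(N i : ℝ) := Real.sqrt_pos.2 (by exact_mod_cast hi)
    rw [integral_const_mul, integral_comp_mul_right_Ioi (fun u => T i ⌈u⌉₊) 0 hs, zero_mul,
      integral_ceil_eq_sum (T i) (N i) (fun k hk => if_neg (not_le.2 hk)), smul_eq_mul, ← mul_assoc,
      ← mul_inv, Real.mul_self_sqrt (Nat.cast_nonneg _)]
    congr 1
    rw [edgeOnePoint, ← Finset.sum_range_reflect]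
    refine Finset.sum_congr rfl fun k hk => ?_
    have hk' := Finset.mem_range.1 hk
    simp only [hT, ha]
    rw [if_pos (by omega), show N i - (N i - 1 - k + 1) = k by omega]
  rw [← integral_profile_eq_plasma hD]
  refine Tendsto.congr' hsum ?_
  obtain ⟨M, hM, hb⟩ := H.exists_inv_sqrt_mul_le (by positivity : 0 ≤ |ξ| + 1)
  refine tendsto_integral_filter_of_dominated_convergence (fun κ => M * (1 + κ ^ 2)⁻¹) ?_ ?_ ?_ ?_
  · refine Eventually.of_forall fun i => Measurable.aestronglyMeasurable ?_
    exact ((measurable_from_nat (f := T i)).comp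
      (Nat.measurable_ceil.comp (measurable_mul_const _))).const_mul _
  · have hxi : ∀ᶠ i in F, |√(N i : ℝ) * x i| ≤ |ξ| + 1 :=
      hx.abs.eventually (ge_mem_nhds (by linarith))
    have hx2 : ∀ᶠ i in F, -(1 / 2) ≤ x i := hx0.eventually (le_mem_nhds (by norm_num))
    filter_upwards [hxi, hxJ, hx2, hN.eventually_ge_atTop 3] with i hi1 hiJ hi2 hi3
    have hs : 0 < √(N i : ℝ) := Real.sqrt_pos.2 (by exact_mod_cast (by omega : 0 < N i))
    filter_upwards [ae_restrict_mem measurableSet_Ioi] with κ hκ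
    have hκ : 0 < κ := hκ
    simp only [hT]
    split_ifs with hle
    swap
    · rw [mul_zero, norm_zero]; positivity
    have hpos : 0 < a i (N i - ⌈κ * √(N i : ℝ)⌉₊) :=
      div_pos (Real.exp_pos _) (H.edgeNorm_pos _ _)
    rw [Real.norm_of_nonneg (by positivity)]
    exact hb (N i) hi3 (x i) hiJ hi2 hi1 κ hκ _ (Nat.one_le_ceil_iff.2 (by positivity)) hle
      (Nat.le_ceil _)
  · exact (integrable_inv_one_add_sq.const_mul M).integrableOn
  · filter_upwards [ae_restrict_mem measurableSet_Ioi] with κ hκ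
    have hκ : 0 < κ := hκ
    have hsqrt := tendsto_sqrt_natCast hN
    have hklim : Tendsto (fun i => ((⌈κ * √(N i : ℝ)⌉₊ : ℕ) : ℝ) / √(N i : ℝ)) F (𝓝 κ) :=
      (tendsto_nat_ceil_mul_div_atTop hκ.le).comp hsqrt
    have hkle : ∀ᶠ i in F, 1 ≤ ⌈κ * √(N i : ℝ)⌉₊ ∧ ⌈κ * √(N i : ℝ)⌉₊ ≤ N i := by
      filter_upwards [hN.eventually_ge_atTop 1, hsqrt.eventually_ge_atTop κ] with i hi hi2
      have hs : 0 < √(N i : ℝ) := Real.sqrt_pos.2 (by exact_mod_cast hi)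
      refine ⟨Nat.one_le_ceil_iff.2 (by positivity), Nat.ceil_le.2 ?_⟩
      calc κ * √(N i : ℝ) ≤ √(N i : ℝ) * √(N i : ℝ) := by gcongr
        _ = N i := Real.mul_self_sqrt (Nat.cast_nonneg _)
    have hden := H.tendsto_sqrt_mul_edgeNorm hN hkle hklim
    have hnum : Tendsto (fun i => Real.exp (-2 * ((⌈κ * √(N i : ℝ)⌉₊ : ℕ) : ℝ) / √(N i : ℝ) *
        (√(N i : ℝ) * x i) - N i * (ψ (x i) - ψ 0 - 2 * x i))) F
        (𝓝 (Real.exp (-2 * κ * ξ - 2 * D * ξ ^ 2))) := by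
      refine (Real.continuous_exp.tendsto _).comp (Tendsto.sub (Tendsto.mul ?_ hx)
        (H.tendsto_mul_taylor hN hx hξ))
      refine (hklim.const_mul (-2)).congr fun i => by ring
    refine (hnum.div hden (integral_profile_pos κ hD).ne').congr' ?_
    filter_upwards [hkle, hN.eventually_ge_atTop 1] with i hi hi1
    have hs : 0 < √(N i : ℝ) := Real.sqrt_pos.2 (by exact_mod_cast hi1)
    simp only [hT, ha, Pi.div_apply, if_pos hi.2]
    have hw := H.edgeNorm_pos (N i) (N i - ⌈κ * √(N i : ℝ)⌉₊)
    have hex : Real.exp (-2 * ((⌈κ * √(N i : ℝ)⌉₊ : ℕ) : ℝ) / √(N i : ℝ) *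
        (√(N i : ℝ) * x i) - N i * (ψ (x i) - ψ 0 - 2 * x i)) = Real.exp (N i * ψ 0) *
        Real.exp (2 * ((N i - ⌈κ * √(N i : ℝ)⌉₊ : ℕ) : ℝ) * x i - N i * ψ (x i)) := by
      rw [← Real.exp_add, Nat.cast_sub hi.2]
      congr 1
      field_simp
      ring
    rw [hex]
    have := Real.exp_pos (N i * ψ 0)
    field_simp

end IsEdgeProfile
end HardEdge
end

/-! ### Geometry of rotation invariant droplets -/

noncomputable section

namespace HardEdge

/-- The closed annulus (a disc if `r = 0`) about `a`. -/
def annulus (a : ℂ) (r ρ : ℝ) : Set ℂ := {z | ‖z - a‖ ∈ Icc r ρ}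

variable {Q : ℂ → EReal} {S : Set ℂ} {a p u : ℂ} {r ρ R : ℝ} {σ : Measure ℂ}

/-- The set of distances to `a` is compact and connected, hence a closed interval, and rotation
invariance recovers S from it. -/
lemma exists_eq_annulus (hS : IsCompact S) (hconn : IsConnected S)
    (hrot : ∀ z w, ‖z - a‖ = ‖w - a‖ → z ∈ S → w ∈ S) :
    ∃ r ρ : ℝ, 0 ≤ r ∧ r ≤ ρ ∧ S = annulus a r ρ := by
  have hc : Continuous fun z : ℂ => ‖z - a‖ := by fun_prop
  have h1 := eq_Icc_of_connected_compact (hconn.image _ hc.continuousOn) (hS.image hc)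
  set I := (fun z : ℂ => ‖z - a‖) '' S
  have hne : I.Nonempty := hconn.nonempty.image _
  refine ⟨sInf I, sSup I, ?_, ?_, ?_⟩
  · refine Real.sInf_nonneg ?_
    rintro _ ⟨z, -, rfl⟩
    exact norm_nonneg _
  · rw [h1] at hne
    exact nonempty_Icc.1 hne
  · ext z
    rw [annulus, mem_ofPred_eq, ← h1]
    refine ⟨fun h => ⟨z, h, rfl⟩, ?_⟩
    rintro ⟨w, hw, h⟩
    exact hrot w z h hw

lemma mem_support_of_map_rotAbout {c : ℂ} (h : σ.map (rotAbout a c) = σ) {z : ℂ}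
    (hz : z ∈ σ.support) : rotAbout a c z ∈ σ.support := by
  rw [Measure.mem_support_iff_forall] at hz ⊢
  intro U hU
  obtain ⟨V, hVU, hV, hzV⟩ := mem_nhds_iff.1 hU
  refine lt_of_lt_of_le ?_ (measure_mono hVU)
  rw [← h, Measure.map_apply (continuous_rotAbout a c).measurable hV.measurableSet]
  exact hz _ ((hV.preimage (continuous_rotAbout a c)).mem_nhds hzV)

/-- A point beyond radius ρ lies on an unbounded ray avoiding the annulus; the component of a point
in the hole cannot reach the exterior, by connectedness. -/
lemma polyHull_annulus (hr : 0 ≤ r) (hrρ : r ≤ ρ) :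
    polyHull (annulus a r ρ) = Metric.closedBall a ρ := by
  ext z
  rw [polyHull, mem_union, mem_ofPred_eq, mem_closedBall_iff_norm]
  constructor
  · rintro (h | ⟨h, hb⟩)
    · exact h.2
    · by_contra hcon
      push Not at hcon
      have hz : 0 < ‖z - a‖ := lt_of_le_of_lt (hr.trans hrρ) hcon
      set ray := (fun s : ℝ => a + s * (z - a)) '' Ici 1 with hray
      have hpre : IsPreconnected ray :=
        isPreconnected_Ici.image _ (by fun_prop)
      have hsub : ray ⊆ (annulus a r ρ)ᶜ := by
        rintro _ ⟨s, hs, rfl⟩ hmem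
        have hs : (1 : ℝ) ≤ s := hs
        have h2 := hmem.2
        rw [add_sub_cancel_left, norm_mul, Complex.norm_real, Real.norm_of_nonneg (by linarith)] at h2
        nlinarith
      have hzr : z ∈ ray := ⟨1, by simp, by simp⟩
      have hb2 := hb.subset (hpre.subset_connectedComponentIn hzr hsub)
      obtain ⟨M, hM⟩ := hb2.subset_closedBall a
      have hs1 : 1 ≤ max 1 ((M + 1) / ‖z - a‖) := le_max_left _ _
      have := hM ⟨max 1 ((M + 1) / ‖z - a‖), hs1, rfl⟩
      rw [mem_closedBall_iff_norm] at this
      simp only at this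
      rw [add_sub_cancel_left, norm_mul, Complex.norm_real,
        Real.norm_of_nonneg (by linarith)] at this
      have h3 : (M + 1) / ‖z - a‖ * ‖z - a‖ ≤ max 1 ((M + 1) / ‖z - a‖) * ‖z - a‖ := by
        gcongr; exact le_max_right _ _
      rw [div_mul_cancel₀ _ hz.ne'] at h3
      linarith
  · intro h
    by_cases hz : z ∈ annulus a r ρ
    · exact Or.inl hz
    · refine Or.inr ⟨hz, ?_⟩
      have hlt : ‖z - a‖ < r := by
        by_contra hcon
        exact hz ⟨not_lt.1 hcon, h⟩
      refine Metric.isBounded_ball.subset (t := Metric.ball a r) ?_ 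
      have hc : Continuous fun z : ℂ => ‖z - a‖ := by fun_prop
      have hsub : connectedComponentIn (annulus a r ρ)ᶜ z ⊆
          {w | ‖w - a‖ < r} ∪ {w | ρ < ‖w - a‖} := by
        refine (connectedComponentIn_subset _ _).trans fun w hw => ?_
        by_contra hcon
        simp only [mem_union, mem_ofPred_eq, not_or, not_lt] at hcon
        exact hw hcon
      have hsub2 := isPreconnected_connectedComponentIn.subset_left_of_subset_union
        (isOpen_lt hc continuous_const) (isOpen_lt continuous_const hc)
        (disjoint_left.2 fun w hw1 hw2 => by
          simp only [mem_ofPred_eq] at hw1 hw2; linarith) hsub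
        ⟨z, mem_connectedComponentIn hz, hlt⟩
      intro w hw
      rw [mem_ball_iff_norm]
      exact hsub2 hw

lemma norm_sub_of_mem_outerBoundary (hr : 0 ≤ r) (hrρ : r ≤ ρ)
    (hp : p ∈ outerBoundary (annulus a r ρ)) : ‖p - a‖ = ρ := by
  rw [outerBoundary, polyHull_annulus hr hrρ] at hp
  exact mem_sphere_iff_norm.1 (Metric.frontier_closedBall_subset_sphere hp)

lemma IsLocalDefiningFunction.hasDerivAt_line {g : ℂ → ℝ} (h : IsLocalDefiningFunction S p g)
    (v : ℂ) : HasDerivAt (fun t : ℝ => g (p + t * v)) (inner ℝ (gradient g p) v) 0 := by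
  have h1 : HasFDerivAt g (fderiv ℝ g p) p := h.analytic.differentiableAt.hasFDerivAt
  have h2 : HasDerivAt (fun t : ℝ => p + t * v) v 0 := by
    simpa using ((Complex.ofRealCLM.hasDerivAt (x := (0 : ℝ))).mul_const v).const_add p
  have h3 : HasFDerivAt g (fderiv ℝ g p) (p + ((0 : ℝ) : ℂ) * v) := by simpa using h1
  have h4 := h3.comp_hasDerivAt (0 : ℝ) h2
  rw [inner_gradient_left] 
  exact h4

lemma IsLocalDefiningFunction.eventually_mem {g : ℂ → ℝ} (h : IsLocalDefiningFunction S p g)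
    {v : ℂ} (hv : inner ℝ (gradient g p) v < 0) : ∀ᶠ t : ℝ in 𝓝[>] 0, p + t * v ∈ S := by
  have h1 := (h.hasDerivAt_line v).hasDerivWithinAt (s := Ioi 0)
  rw [hasDerivWithinAt_iff_tendsto_slope' (by simp)] at h1
  have h2 : Tendsto (fun t : ℝ => p + t * v) (𝓝[>] 0) (𝓝 p) := by
    have : Continuous fun t : ℝ => p + t * v := by fun_prop
    simpa using (this.tendsto 0).mono_left nhdsWithin_le_nhds
  filter_upwards [h1.eventually (gt_mem_nhds hv), h2.eventually h.mem_iff,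
    self_mem_nhdsWithin] with t ht1 ht2 ht3
  have ht3 : 0 < t := ht3
  rw [ht2]
  rw [slope_def_field] at ht1
  simp only [Complex.ofReal_zero, zero_mul, add_zero, h.zero, sub_zero] at ht1
  rw [div_lt_iff₀ ht3, zero_mul] at ht1
  exact ht1.le

lemma IsLocalDefiningFunction.eventually_notMem {g : ℂ → ℝ} (h : IsLocalDefiningFunction S p g)
    {v : ℂ} (hv : 0 < inner ℝ (gradient g p) v) : ∀ᶠ t : ℝ in 𝓝[>] 0, p + t * v ∉ S := by
  have h1 := (h.hasDerivAt_line v).hasDerivWithinAt (s := Ioi 0)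
  rw [hasDerivWithinAt_iff_tendsto_slope' (by simp)] at h1
  have h2 : Tendsto (fun t : ℝ => p + t * v) (𝓝[>] 0) (𝓝 p) := by
    have : Continuous fun t : ℝ => p + t * v := by fun_prop
    simpa using (this.tendsto 0).mono_left nhdsWithin_le_nhds
  filter_upwards [h1.eventually (lt_mem_nhds hv), h2.eventually h.mem_iff,
    self_mem_nhdsWithin] with t ht1 ht2 ht3
  have ht3 : 0 < t := ht3
  rw [ht2, not_le]
  rw [slope_def_field] at ht1
  simp only [Complex.ofReal_zero, zero_mul, add_zero, h.zero, sub_zero] at ht1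
  exact (div_pos_iff_of_pos_right ht3).1 ht1

lemma norm_add_mul_sq (b v : ℂ) (t : ℝ) :
    ‖b + t * v‖ ^ 2 = ‖b‖ ^ 2 + 2 * t * inner ℝ b v + t ^ 2 * ‖v‖ ^ 2 := by
  have : (t : ℂ) * v = t • v := by simp
  rw [this, norm_add_sq_real, inner_smul_right, norm_smul, mul_pow, Real.norm_eq_abs, sq_abs]
  ring

/-- If r = ρ, the set is a circle or a point. But the side g ≤ 0 contains a short segment from p in
the direction -∇g, and the distance to `a` cannot be constant along a segment. -/
lemma lt_of_isLocalDefiningFunction {g : ℂ → ℝ} (hrρ : r ≤ ρ)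
    (h : IsLocalDefiningFunction (annulus a r ρ) p g) : r < ρ := by
  refine lt_of_le_of_ne hrρ ?_
  rintro rfl
  have hg := h.gradient_ne_zero
  set v := -gradient g p with hv
  have hv0 : 0 < ‖v‖ := by rw [hv, norm_neg]; exact norm_pos_iff.2 hg
  have h1 := h.eventually_mem (v := v) (by
    rw [hv, inner_neg_right, real_inner_self_eq_norm_sq, neg_lt_zero]
    exact pow_pos (norm_pos_iff.2 hg) 2)
  have hps : p ∈ annulus a r r := h.mem_iff.self_of_nhds.2 h.zero.le
  obtain ⟨ε, hε, hsub⟩ := mem_nhdsGT_iff_exists_Ioo_subset.1 h1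
  have hε : 0 < ε := hε
  have key : ∀ t ∈ Ioo 0 ε, 2 * inner ℝ (p - a) v + t * ‖v‖ ^ 2 = 0 := by
    intro t ht
    have h2 : p + t * v ∈ annulus a r r := hsub ht
    have e1 : ‖p - a‖ = r := le_antisymm hps.2 hps.1
    have e2 : ‖p + t * v - a‖ = r := le_antisymm h2.2 h2.1
    rw [show p + t * v - a = p - a + t * v by ring] at e2
    have e3 := norm_add_mul_sq (p - a) v t
    rw [e1, e2] at e3
    have : t * (2 * inner ℝ (p - a) v + t * ‖v‖ ^ 2) = 0 := by linarith
    exact (mul_eq_zero.1 this).resolve_left ht.1.ne'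
  have k1 := key (ε / 2) ⟨by linarith, by linarith⟩
  have k2 := key (ε / 3) ⟨by linarith, by linarith⟩
  have : ε / 6 * ‖v‖ ^ 2 = 0 := by linarith
  have h3 : 0 < ε / 6 * ‖v‖ ^ 2 := by positivity
  linarith

/-- If u were not the radial direction, v = ρu - (p - a) would make an acute angle with u and an
obtuse one with p - a. Moving from p along v would then leave S, as seen by g, while entering the
disc of radius ρ. -/
lemma eq_of_isOutwardUnitNormal (hr : 0 ≤ r) (hrρ : r < ρ) (hp : ‖p - a‖ = ρ)
    (hu : IsOutwardUnitNormal (annulus a r ρ) p u) : (ρ : ℂ) * u = p - a := by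
  obtain ⟨hu1, g, c, hg, hc, hgc⟩ := hu
  set b := p - a with hb
  have hρ : 0 < ρ := hr.trans_lt hrρ
  have hcs : inner ℝ b u ≤ ρ := by
    have := real_inner_le_norm b u
    rwa [hp, hu1, mul_one] at this
  have hsq : ‖(ρ : ℂ) * u - b‖ ^ 2 = 2 * ρ * (ρ - inner ℝ b u) := by
    have := norm_add_mul_sq (-b) u ρ
    rw [show -b + ρ * u = ρ * u - b by ring, norm_neg, hp, hu1, inner_neg_left] at this
    rw [this]; ring
  rcases hcs.eq_or_lt with heq | hlt
  · rw [heq, sub_self, mul_zero] at hsq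
    exact sub_eq_zero.1 (norm_eq_zero.1 (pow_eq_zero_iff two_ne_zero |>.1 hsq))
  · exfalso
    set v := (ρ : ℂ) * u - b with hv
    have hρu : (ρ : ℂ) * u = ρ • u := by simp
    have h1 : 0 < inner ℝ (gradient g p) v := by
      rw [hgc, hv, hρu, inner_smul_left, inner_sub_right, inner_smul_right,
        real_inner_self_eq_norm_sq, hu1, real_inner_comm]
      simp only [conj_trivial]
      exact mul_pos hc (by linarith)
    have h2 : inner ℝ b v < 0 := by
      rw [hv, hρu, inner_sub_right, inner_smul_right, real_inner_self_eq_norm_sq, hp]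
      nlinarith
    have h3 := hg.eventually_notMem h1
    have hcont : Continuous fun t : ℝ => ‖b + t * v‖ := by fun_prop
    have h4 : ∀ᶠ t : ℝ in 𝓝[>] 0, r < ‖b + t * v‖ := by
      refine (hcont.tendsto 0).mono_left nhdsWithin_le_nhds |>.eventually (lt_mem_nhds ?_)
      simpa [hp] using hrρ
    have hcont2 : Continuous fun t : ℝ => 2 * inner ℝ b v + t * ‖v‖ ^ 2 := by fun_prop
    have h5 : ∀ᶠ t : ℝ in 𝓝[>] 0, 2 * inner ℝ b v + t * ‖v‖ ^ 2 < 0 := by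
      refine (hcont2.tendsto 0).mono_left nhdsWithin_le_nhds |>.eventually (gt_mem_nhds ?_)
      linarith
    obtain ⟨t, ht3, ht4, ht5, ht0⟩ := (h3.and (h4.and (h5.and self_mem_nhdsWithin))).exists
    have ht0 : 0 < t := ht0
    refine ht3 ?_
    rw [annulus, mem_ofPred_eq, show p + t * v - a = b + t * v by rw [hb]; ring]
    refine ⟨ht4.le, ?_⟩
    refine (pow_le_pow_iff_left₀ (norm_nonneg _) hρ.le two_ne_zero).1 ?_
    rw [norm_add_mul_sq, hp]
    nlinarith

end HardEdge
end

/-! ### From Frostman's conditions to an edge profile -/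

noncomputable section

namespace HardEdge

variable {Q : ℂ → EReal} {a p : ℂ} {r ρ R κ : ℝ} {σ : Measure ℂ} {k : ℝ → ℝ}

lemma log_max_exp_convex (hρ : 0 < ρ) (y : ℝ) {s t α β : ℝ} (hα : 0 ≤ α) (hβ : 0 ≤ β)
    (hαβ : α + β = 1) :
    Real.log (max (ρ * Real.exp (α * s + β * t)) y) ≤
      α * Real.log (max (ρ * Real.exp s) y) + β * Real.log (max (ρ * Real.exp t) y) := by
  have h1 : ∀ τ, Real.log ρ + τ ≤ Real.log (max (ρ * Real.exp τ) y) := by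
    intro τ
    rw [← Real.log_exp τ, ← Real.log_mul hρ.ne' (Real.exp_pos τ).ne', Real.log_exp]
    exact Real.log_le_log (by positivity) (le_max_left _ _)
  rcases le_total y (ρ * Real.exp (α * s + β * t)) with h | h
  · rw [max_eq_left h, Real.log_mul hρ.ne' (Real.exp_pos _).ne', Real.log_exp]
    have h2 := mul_le_mul_of_nonneg_left (h1 s) hα
    have h3 := mul_le_mul_of_nonneg_left (h1 t) hβ
    have h4 : Real.log ρ = α * Real.log ρ + β * Real.log ρ := by rw [← add_mul, hαβ, one_mul]
    linarith
  · rw [max_eq_right h]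
    have hy : 0 < y := lt_of_lt_of_le (by positivity) h
    have h2 : ∀ τ, Real.log y ≤ Real.log (max (ρ * Real.exp τ) y) := fun τ =>
      Real.log_le_log hy (le_max_right _ _)
    have h3 := mul_le_mul_of_nonneg_left (h2 s) hα
    have h4 := mul_le_mul_of_nonneg_left (h2 t) hβ
    have h5 : Real.log y = α * Real.log y + β * Real.log y := by rw [← add_mul, hαβ, one_mul]
    linarith

/-- In the logarithm of the radius, each log max(·, |w - a|) is a maximum of an affine function and
a constant, hence convex, and σ averages these. On the droplet this convexity passes to ψ and makes
m nondecreasing. -/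
lemma convexOn_radialPotential [IsProbabilityMeasure σ] (hR : ∀ᵐ w ∂σ, ‖w - a‖ ≤ R) (hρ : 0 < ρ) :
    ConvexOn ℝ univ fun t => radialPotential σ a (ρ * Real.exp t) := by
  refine ⟨convex_univ, fun s _ t _ α β hα hβ hαβ => ?_⟩
  have hI : ∀ τ, Integrable (fun w => Real.log (max (ρ * Real.exp τ) ‖w - a‖)) σ := fun τ =>
    integrable_log_max hR (by positivity)
  simp only [smul_eq_mul, radialPotential]
  rw [← integral_const_mul, ← integral_const_mul,
    ← integral_add ((hI s).const_mul α) ((hI t).const_mul β)]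
  exact integral_mono (hI _) (((hI s).const_mul α).add ((hI t).const_mul β))
    fun w => log_max_exp_convex hρ _ hα hβ hαβ

lemma radialPotential_of_le [IsProbabilityMeasure σ] (h : ∀ᵐ w ∂σ, ‖w - a‖ ≤ r) :
    radialPotential σ a r = Real.log r := by
  have : radialPotential σ a r = ∫ _w, Real.log r ∂σ := by
    refine integral_congr_ae ?_
    filter_upwards [h] with w hw
    rw [max_eq_left hw]
  rw [this]; simp

lemma radialPotential_eq_of_le {s : ℝ} (h : ∀ᵐ w ∂σ, r ≤ ‖w - a‖) (hs : s ≤ r) :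
    radialPotential σ a s = radialPotential σ a r := by
  refine integral_congr_ae ?_
  filter_upwards [h] with w hw
  rw [max_eq_right hw, max_eq_right (hs.trans hw)]

/-- For r > 0 the factor s is bounded below. For a disc, evenness gives k'(0) = 0, so that k'(s) is
at most a multiple of s; this is the decay of m near the centre. -/
lemma exists_deriv_le (hr : 0 ≤ r) (hk : AnalyticOnNhd ℝ k (Icc r ρ))
    (heven : r = 0 → ∀ s, k (-s) = k s) :
    ∃ C, 0 ≤ C ∧ ∀ s ∈ Icc r ρ, |deriv k s| ≤ C * s ∧ |deriv (deriv k) s| ≤ C := by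
  obtain ⟨M, hM⟩ := isCompact_Icc.exists_bound_of_continuousOn hk.deriv.deriv.continuousOn
  have hM' : ∀ s ∈ Icc r ρ, ‖deriv (deriv k) s‖ ≤ |M| := fun s hs => (hM s hs).trans (le_abs_self _)
  rcases hr.eq_or_lt with rfl | hr
  · have h0 : ∀ s ∈ Icc 0 ρ, deriv k 0 = 0 := by
      intro s hs
      have hd : HasDerivAt k (deriv k 0) 0 :=
        (hk 0 ⟨le_rfl, hs.1.trans hs.2⟩).differentiableAt.hasDerivAt
      have hd2 : HasDerivAt (fun s => k (-s)) (-deriv k 0) 0 := by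
        have hd' : HasDerivAt k (deriv k 0) (-0) := by rwa [neg_zero]
        exact (hd'.comp (0 : ℝ) (hasDerivAt_neg (0 : ℝ))).congr_deriv (by ring)
      have : (fun s => k (-s)) = k := funext (heven rfl)
      rw [this] at hd2
      have := hd.unique hd2
      linarith
    refine ⟨|M|, abs_nonneg _, fun s hs => ⟨?_, hM' s hs⟩⟩
    have h1 := Convex.norm_image_sub_le_of_norm_hasDerivWithin_le (f := deriv k)
      (f' := deriv (deriv k)) (s := Icc 0 ρ) (x := 0) (y := s)
      (fun x hx => (hk.deriv x hx).differentiableAt.hasDerivAt.hasDerivWithinAt) hM'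
      (convex_Icc 0 ρ) ⟨le_rfl, hs.1.trans hs.2⟩ hs
    rwa [h0 s hs, sub_zero, sub_zero, Real.norm_eq_abs, Real.norm_of_nonneg hs.1] at h1
  · obtain ⟨M₁, hM₁⟩ := isCompact_Icc.exists_bound_of_continuousOn hk.deriv.continuousOn
    refine ⟨|M| + |M₁| / r, by positivity, fun s hs => ⟨?_, ?_⟩⟩
    · calc |deriv k s| ≤ |M₁| := (hM₁ s hs).trans (le_abs_self _)
        _ = |M₁| / r * r := by field_simp
        _ ≤ (|M| + |M₁| / r) * s := by
          gcongr
          · linarith [abs_nonneg M]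
          · exact hs.1
    · have : 0 ≤ |M₁| / r := by positivity
      have := hM' s hs
      rw [Real.norm_eq_abs] at this
      linarith

lemma hasDerivAt_mul_exp (ρ t : ℝ) : HasDerivAt (fun t => ρ * Real.exp t) (ρ * Real.exp t) t :=
  (Real.hasDerivAt_exp t).const_mul ρ

/-- The variational conditions of the equilibrium problem make the potential an edge profile in
logarithmic coordinates. -/
theorem exists_isEdgeProfile [IsProbabilityMeasure σ] (hr : 0 ≤ r) (hrρ : r < ρ) (hρR : ρ < R)
    (hle : ∀ᵐ w ∂σ, ‖w - a‖ ≤ ρ) (hge : ∀ᵐ w ∂σ, r ≤ ‖w - a‖)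
    (hk : AnalyticOnNhd ℝ k (Icc r ρ)) (heven : r = 0 → ∀ s, k (-s) = k s)
    (hF : ∀ s₀ ∈ Icc r ρ, ∀ᶠ s in 𝓝 s₀, 0 < s → s ≤ R → κ ≤ k s - 2 * radialPotential σ a s)
    (hFeq : ∀ s ∈ Icc r ρ, 0 < s → k s - 2 * radialPotential σ a s = κ)
    (hD : 0 < deriv (deriv k) ρ * ρ ^ 2 + deriv k ρ * ρ) :
    ∃ C ℓ, IsEdgeProfile (fun t => k (ρ * Real.exp t))
      (fun t => deriv k (ρ * Real.exp t) * (ρ * Real.exp t) / 2)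
      {t | ρ * Real.exp t ∈ Icc r ρ} C ℓ
      ((deriv (deriv k) ρ * ρ ^ 2 + deriv k ρ * ρ) / 4) := by
  have hρ : 0 < ρ := hr.trans_lt hrρ
  obtain ⟨C, hC, hb⟩ := exists_deriv_le hr hk heven
  set m : ℝ → ℝ := fun t => deriv k (ρ * Real.exp t) * (ρ * Real.exp t) / 2 with hm
  set J : Set ℝ := {t | ρ * Real.exp t ∈ Icc r ρ} with hJ
  have hmono : Monotone fun t => ρ * Real.exp t := fun s t h =>
    mul_le_mul_of_nonneg_left (Real.exp_le_exp.2 h) hρ.le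
  have hord : J.OrdConnected := ordConnected_Icc.preimage_mono hmono
  have hpos : ∀ t, 0 < ρ * Real.exp t := fun t => by positivity
  have hψ : ∀ t ∈ J, HasDerivAt (fun t => k (ρ * Real.exp t)) (2 * m t) t := by
    intro t ht
    have h := (hk _ ht).differentiableAt.hasDerivAt.comp t (hasDerivAt_mul_exp ρ t)
    exact h.congr_deriv (by simp only [hm]; ring)
  have hmd : ∀ t ∈ J, HasDerivAt m ((deriv (deriv k) (ρ * Real.exp t) * (ρ * Real.exp t) ^ 2 +
      deriv k (ρ * Real.exp t) * (ρ * Real.exp t)) / 2) t := by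
    intro t ht
    have h := (((hk.deriv _ ht).differentiableAt.hasDerivAt.comp t (hasDerivAt_mul_exp ρ t)).mul
      (hasDerivAt_mul_exp ρ t)).div_const 2
    exact h.congr_deriv (by simp only [Function.comp_apply]; ring)
  have hlip : ∀ s ∈ J, ∀ t ∈ J, s ≤ t → m t - m s ≤ C * ρ ^ 2 * Real.exp (2 * t) * (t - s) := by
    intro s hs t ht hst
    rcases hst.eq_or_lt with rfl | hst
    · simp
    have hsub : Icc s t ⊆ J := hord.out hs ht
    obtain ⟨c, hc, hcs⟩ := exists_hasDerivAt_eq_slope m _ hst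
      (fun τ hτ => (hmd τ (hsub hτ)).continuousAt.continuousWithinAt)
      (fun τ hτ => hmd τ (hsub (Ioo_subset_Icc_self hτ)))
    rw [eq_div_iff (by linarith)] at hcs
    rw [← hcs]
    refine mul_le_mul_of_nonneg_right ?_ (by linarith)
    have hbc := hb _ (hsub (Ioo_subset_Icc_self hc))
    have hp := hpos c
    have e : (ρ * Real.exp c) ^ 2 ≤ ρ ^ 2 * Real.exp (2 * t) := by
      rw [mul_pow, ← Real.exp_nat_mul]
      exact mul_le_mul_of_nonneg_left (Real.exp_le_exp.2 (by push_cast; linarith [hc.2]))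
        (by positivity)
    have h1 : deriv (deriv k) (ρ * Real.exp c) * (ρ * Real.exp c) ^ 2 ≤ C * (ρ * Real.exp c) ^ 2 := by
      gcongr; exact (le_abs_self _).trans hbc.2
    have h2 : deriv k (ρ * Real.exp c) * (ρ * Real.exp c) ≤ C * (ρ * Real.exp c) * (ρ * Real.exp c) := by
      gcongr; exact (le_abs_self _).trans hbc.1
    have h3 := mul_le_mul_of_nonneg_left e hC
    linarith [h1, h2, h3]
  have hVm : ∀ s t, s ≤ t → 0 ≤ radialPotential σ a (ρ * Real.exp t) -
      radialPotential σ a (ρ * Real.exp s) ∧ radialPotential σ a (ρ * Real.exp t) -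
      radialPotential σ a (ρ * Real.exp s) ≤ t - s := by
    intro s t hst
    have h := abs_radialPotential_sub_le hle (hpos s) (hmono hst)
    simp only at h
    rw [Real.log_mul hρ.ne' (Real.exp_pos t).ne', Real.log_mul hρ.ne' (Real.exp_pos s).ne',
      Real.log_exp, Real.log_exp] at h
    exact ⟨h.1, by linarith [h.2]⟩
  have h0J : (0 : ℝ) ∈ J := by
    simp only [hJ, mem_ofPred_eq, Real.exp_zero, mul_one]; exact ⟨hrρ.le, le_rfl⟩
  have hev : ∀ t₀ ∈ J, ∀ᶠ t in 𝓝 t₀, κ ≤ k (ρ * Real.exp t) -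
      2 * radialPotential σ a (ρ * Real.exp t) := by
    intro t₀ ht₀
    have hc : Tendsto (fun t => ρ * Real.exp t) (𝓝 t₀) (𝓝 (ρ * Real.exp t₀)) :=
      (hasDerivAt_mul_exp ρ t₀).continuousAt
    filter_upwards [hc.eventually (hF _ ht₀),
      hc.eventually (ge_mem_nhds (lt_of_le_of_lt ht₀.2 hρR))] with t ht1 ht2
    exact ht1 (hpos t) ht2
  have heq : ∀ t ∈ J, k (ρ * Real.exp t) - 2 * radialPotential σ a (ρ * Real.exp t) = κ :=
    fun t ht => hFeq _ ht (hpos t)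
  -- To the right of the edge the potential is exactly log ρ + t, to the left at least that. Since
  -- the Frostman inequality also holds slightly outside S, ψ(t) - 2t has a local minimum at 0.
  have hm0 : m 0 = 1 := by
    have hmin : IsLocalMin (fun t => k (ρ * Real.exp t) - 2 * t) 0 := by
      filter_upwards [hev 0 h0J] with t ht
      have h0 := heq 0 h0J
      rcases le_total t 0 with h | h
      · have := (hVm t 0 h).2
        linarith
      · have h1 : radialPotential σ a (ρ * Real.exp t) = Real.log ρ + t := by
          rw [radialPotential_of_le, Real.log_mul hρ.ne' (Real.exp_pos t).ne', Real.log_exp]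
          filter_upwards [hle] with w hw
          exact hw.trans (le_mul_of_one_le_right hρ.le (Real.one_le_exp h))
        have h2 : radialPotential σ a (ρ * Real.exp 0) = Real.log ρ := by
          rw [Real.exp_zero, mul_one, radialPotential_of_le hle]
        linarith
    have := hmin.hasDerivAt_eq_zero ((hψ 0 h0J).sub ((hasDerivAt_id (0 : ℝ)).const_mul 2))
    linarith
  -- The choice ℓ = 1 - r/ρ works by e^t ≥ 1 + t: for t ≥ -ℓ the radius ρe^t is at least r.
  refine ⟨C * ρ ^ 2, 1 - r / ρ, ?_, hord, ?_, ?_, ?_, ?_, hψ, ?_, hm0, hlip, ?_, ?_, by positivity, ?_⟩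
  · exact measurableSet_Icc.preimage (by fun_prop)
  · intro t ht
    have := ht.2
    by_contra hcon
    have h1 : 1 < Real.exp t := Real.one_lt_exp_iff.2 (by simpa using hcon)
    nlinarith
  · rw [sub_pos, div_lt_one hρ]; exact hrρ
  · linarith [div_nonneg hr hρ.le]
  · intro t ht
    have h1 : r / ρ ≤ Real.exp t := by
      have := Real.add_one_le_exp t
      linarith [ht.1]
    rw [div_le_iff₀ hρ] at h1
    refine ⟨by linarith, ?_⟩
    exact mul_le_of_le_one_right hρ.le (Real.exp_le_one_iff.2 ht.2)
  · have hconv : ConvexOn ℝ J fun t => k (ρ * Real.exp t) := by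
      have h1 := (((convexOn_radialPotential hle hρ).smul (by norm_num : (0 : ℝ) ≤ 2)).add_const κ).subset
        (subset_univ J) hord.convex
      refine h1.congr fun t ht => ?_
      have := heq t ht
      simp only [smul_eq_mul, Pi.add_apply]
      linarith
    have h2 := hconv.monotoneOn_deriv fun t ht => (hψ t ht).differentiableAt
    intro s hs t ht hst
    have h3 := h2 hs ht hst
    rw [(hψ s hs).deriv, (hψ t ht).deriv] at h3
    linarith
  · intro t ht
    have hp := hpos t
    have h2 : deriv k (ρ * Real.exp t) * (ρ * Real.exp t) ≤ C * (ρ * Real.exp t) * (ρ * Real.exp t) := by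
      gcongr; exact (le_abs_self _).trans (hb _ ht).1
    have e : C * ρ ^ 2 * Real.exp (2 * t) = C * (ρ * Real.exp t) * (ρ * Real.exp t) := by
      rw [show 2 * t = t + t by ring, Real.exp_add]; ring
    have h3 : 0 ≤ C * (ρ * Real.exp t) * (ρ * Real.exp t) := by positivity
    rw [e]
    simp only [hm]
    linarith
  · intro x hx s hs
    -- For a disc J is a half-line and steps to the left never leave it. For a proper annulus a step
    -- leaving J passes the inner edge T, where m vanishes, and the Lipschitz bound gives the second
    -- alternative.
    rcases hr.eq_or_lt with h0 | hr0
    · left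
      refine ⟨by rw [← h0]; exact (hpos _).le, le_trans ?_ hx.2⟩
      exact hmono (by linarith)
    · by_cases hxs : x - s ∈ J
      · exact Or.inl hxs
      right
      set T := Real.log (r / ρ) with hT
      have hTr : ρ * Real.exp T = r := by
        rw [hT, Real.exp_log (by positivity)]; field_simp
      have hTJ : T ∈ J := by
        simp only [hJ, mem_ofPred_eq, hTr]; exact ⟨le_rfl, hrρ.le⟩
      have hTx : T ≤ x := by
        by_contra hcon
        have := mul_lt_mul_of_pos_left (Real.exp_lt_exp.2 (not_le.1 hcon)) hρ
        rw [hTr] at this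
        linarith [hx.1]
      have hsT : x - s ≤ T := by
        by_contra hcon
        refine hxs ⟨?_, le_trans (hmono (by linarith)) hx.2⟩
        rw [← hTr]
        exact hmono (not_le.1 hcon).le
      -- To the left of the inner edge the radial potential is constant, as no mass lies in the
      -- hole, and it is nondecreasing to the right; by Frostman ψ has a local minimum at T.
      have hmT : m T = 0 := by
        have hmin : IsLocalMin (fun t => k (ρ * Real.exp t)) T := by
          filter_upwards [hev T hTJ] with t ht
          have hT0 := heq T hTJ
          rcases le_total t T with h | h
          · have h1 : radialPotential σ a (ρ * Real.exp t) = radialPotential σ a (ρ * Real.exp T) := by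
              rw [hTr]
              refine radialPotential_eq_of_le hge ?_
              rw [← hTr]; exact hmono h
            linarith
          · have := (hVm T t h).1
            linarith
        have := hmin.hasDerivAt_eq_zero (hψ T hTJ)
        linarith
      have h1 := hlip T hTJ x hx hTx
      rw [hmT, sub_zero] at h1
      refine h1.trans ?_
      gcongr
      linarith
  · have h := hmd 0 h0J
    rw [Real.exp_zero, mul_one] at h
    exact (h.congr_deriv (by ring)).hasDerivWithinAt

end HardEdge
end

/-! ### The Laplacian and the monomial norms in polar coordinates -/

noncomputable section

namespace HardEdge

variable {Q : ℂ → EReal} {a p : ℂ} {r ρ R κ : ℝ} {σ : Measure ℂ} {k : ℝ → ℝ}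

/-- The potential along the real direction through `a`. -/
def radialProfile (Q : ℂ → EReal) (a : ℂ) (s : ℝ) : ℝ := (Q (a + s)).toReal

lemma IsRadialAbout.toReal_eq (hrad : IsRadialAbout Q a) (z : ℂ) :
    (Q z).toReal = radialProfile Q a ‖z - a‖ := by
  rw [radialProfile, hrad z (a + ‖z - a‖) (by simp)]

lemma analyticAt_radialProfile (hQ : IsAdmissible Q) {s : ℝ}
    (hs : a + (s : ℂ) ∈ interior (finiteSet Q)) : AnalyticAt ℝ (radialProfile Q a) s := by
  have h1 : AnalyticAt ℝ (fun s : ℝ => a + (s : ℂ)) s :=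
    analyticAt_const.add (Complex.ofRealCLM.analyticAt s)
  exact AnalyticAt.comp (g := fun w => (Q w).toReal) (hQ.analytic _ hs) h1

lemma iteratedFDeriv_two_eq_of_hasDerivAt {f : ℂ → ℝ} (hf : AnalyticAt ℝ f p) {v : ℂ}
    {g₁ : ℝ → ℝ} {c : ℝ} (h₁ : ∀ᶠ s in 𝓝 (0 : ℝ), HasDerivAt (fun s : ℝ => f (p + s * v)) (g₁ s) s)
    (h₂ : HasDerivAt g₁ c 0) : iteratedFDeriv ℝ 2 f p ![v, v] = c := by
  have hl : ∀ s : ℝ, HasDerivAt (fun t : ℝ => p + t * v) v s := fun s => by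
    simpa using ((Complex.ofRealCLM.hasDerivAt (x := s)).mul_const v).const_add p
  have hl0 : p + ((0 : ℝ) : ℂ) * v = p := by simp
  have hlt : Tendsto (fun t : ℝ => p + t * v) (𝓝 0) (𝓝 p) := by
    have := (hl 0).continuousAt
    rwa [ContinuousAt, hl0] at this
  have h3 : g₁ =ᶠ[𝓝 0] fun s => fderiv ℝ f (p + s * v) v := by
    filter_upwards [h₁, hlt.eventually hf.eventually_analyticAt] with s hs1 hs2
    exact hs1.unique (hs2.differentiableAt.hasFDerivAt.comp_hasDerivAt s (hl s))
  have h4 : HasFDerivAt (fderiv ℝ f) (fderiv ℝ (fderiv ℝ f) p) (p + ((0 : ℝ) : ℂ) * v) := by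
    rw [hl0]; exact hf.fderiv.differentiableAt.hasFDerivAt
  have h5 : HasDerivAt (fun s : ℝ => fderiv ℝ f (p + s * v)) (fderiv ℝ (fderiv ℝ f) p v) 0 :=
    h4.comp_hasDerivAt (0 : ℝ) (hl 0)
  have h6 : HasDerivAt (fun s : ℝ => fderiv ℝ f (p + s * v) v) (fderiv ℝ (fderiv ℝ f) p v v) 0 :=
    (ContinuousLinearMap.apply ℝ ℝ v).hasFDerivAt.comp_hasDerivAt (0 : ℝ) h5
  rw [iteratedFDeriv_two_apply]
  exact (h₂.unique (h6.congr_of_eventuallyEq h3)).symm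

/-- The Laplacian is computed in the orthonormal frame of radial and tangential directions at p:
second derivatives along the two lines give k'' and k'/ρ. -/
lemma laplacian_eq_radialProfile (hQ : IsAdmissible Q) (hrad : IsRadialAbout Q a) (hρ : 0 < ρ)
    (hp : ‖p - a‖ = ρ) (hpi : p ∈ interior (finiteSet Q)) :
    Laplacian.laplacian (fun w : ℂ => (Q w).toReal) p =
      deriv (deriv (radialProfile Q a)) ρ + deriv (radialProfile Q a) ρ / ρ := by
  set k := radialProfile Q a with hk
  set f : ℂ → ℝ := fun w => (Q w).toReal with hf
  have hkρ : AnalyticAt ℝ k ρ := analyticAt_radialProfile hQ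
    (hrad.mem_interior (by simp [hp, abs_of_pos hρ]) hpi)
  have hfk : ∀ z, f z = k ‖z - a‖ := fun z => hrad.toReal_eq z
  have hfp : AnalyticAt ℝ f p := hQ.analytic p hpi
  have hu : ‖(p - a) / ρ‖ = 1 := by
    rw [norm_div, hp, Complex.norm_real, Real.norm_of_nonneg hρ.le, div_self hρ.ne']
  set e : Circle := ⟨(p - a) / ρ, mem_sphere_zero_iff_norm.2 hu⟩ with he
  have hρc : (ρ : ℂ) ≠ 0 := by exact_mod_cast hρ.ne'
  have hpe : p - a = ρ * (e : ℂ) := by rw [he]; simp only; field_simp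
  have hen : ‖(e : ℂ)‖ = 1 := hu
  have h1 : iteratedFDeriv ℝ 2 f p ![(e : ℂ), (e : ℂ)] = deriv (deriv k) ρ := by
    refine iteratedFDeriv_two_eq_of_hasDerivAt hfp (g₁ := fun s => deriv k (ρ + s)) ?_ ?_
    · have ht : Tendsto (fun s : ℝ => ρ + s) (𝓝 0) (𝓝 ρ) := by
        have : Continuous fun s : ℝ => ρ + s := by fun_prop
        simpa using this.tendsto 0
      have hev : (fun s : ℝ => f (p + s * e)) =ᶠ[𝓝 0] fun s => k (ρ + s) := by
        filter_upwards [ht.eventually (lt_mem_nhds hρ)] with s hs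
        rw [hfk, show p + s * e - a = ((ρ + s : ℝ) : ℂ) * e by
          rw [add_sub_right_comm, hpe]; push_cast; ring, norm_mul, hen, mul_one, Complex.norm_real,
          Real.norm_of_nonneg hs.le]
      filter_upwards [hev.eventuallyEq_nhds, ht.eventually hkρ.eventually_analyticAt] with s hs1 hs2
      have := hs2.differentiableAt.hasDerivAt.comp_const_add ρ s
      exact this.congr_of_eventuallyEq hs1
    · have : HasDerivAt (deriv k) (deriv (deriv k) ρ) (ρ + 0) := by
        rw [add_zero]; exact hkρ.deriv.differentiableAt.hasDerivAt
      exact this.comp_const_add ρ 0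
  -- Along the tangent line the distance to `a` is √(ρ² + s²). The first derivative vanishes at s =
  -- 0, and its difference quotient there is k'/√(ρ² + s²), which tends to k'(ρ)/ρ.
  have h2 : iteratedFDeriv ℝ 2 f p ![(e * Complex.I : ℂ), (e * Complex.I : ℂ)] = deriv k ρ / ρ := by
    refine iteratedFDeriv_two_eq_of_hasDerivAt hfp
      (g₁ := fun s => s * (deriv k √(ρ ^ 2 + s ^ 2) / √(ρ ^ 2 + s ^ 2))) ?_ ?_
    · have hfe : (fun s : ℝ => f (p + s * (e * Complex.I))) = fun s => k √(ρ ^ 2 + s ^ 2) := by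
        funext s
        rw [hfk, show p + s * (e * Complex.I) - a = ((ρ : ℂ) + s * Complex.I) * e by
          rw [add_sub_right_comm, hpe]; ring, norm_mul, hen, mul_one, Complex.norm_add_mul_I]
      have ht : Tendsto (fun s : ℝ => √(ρ ^ 2 + s ^ 2)) (𝓝 0) (𝓝 ρ) := by
        have : Continuous fun s : ℝ => √(ρ ^ 2 + s ^ 2) := by fun_prop
        simpa [Real.sqrt_sq hρ.le] using this.tendsto 0
      rw [hfe]
      filter_upwards [ht.eventually hkρ.eventually_analyticAt] with s hs
      have hne : ρ ^ 2 + s ^ 2 ≠ 0 := by positivity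
      have hd : HasDerivAt (fun s : ℝ => √(ρ ^ 2 + s ^ 2)) (2 * s / (2 * √(ρ ^ 2 + s ^ 2))) s := by
        refine HasDerivAt.sqrt ?_ hne
        simpa using (hasDerivAt_pow 2 s).const_add (ρ ^ 2)
      refine (hs.differentiableAt.hasDerivAt.comp s hd).congr_deriv ?_
      have : 0 < √(ρ ^ 2 + s ^ 2) := Real.sqrt_pos.2 (by positivity)
      field_simp
    · have hc : ContinuousAt (fun s : ℝ => deriv k √(ρ ^ 2 + s ^ 2) / √(ρ ^ 2 + s ^ 2)) 0 := by
        have h0 : √(ρ ^ 2 + 0 ^ 2) = ρ := by simp [Real.sqrt_sq hρ.le]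
        refine ContinuousAt.div ?_ (by fun_prop) (by rw [h0]; exact hρ.ne')
        refine ContinuousAt.comp' (f := fun s : ℝ => √(ρ ^ 2 + s ^ 2)) (g := deriv k) ?_ (by fun_prop)
        rw [h0]; exact hkρ.deriv.continuousAt
      rw [hasDerivAt_iff_tendsto_slope]
      have h0 : √(ρ ^ 2 + 0 ^ 2) = ρ := by simp [Real.sqrt_sq hρ.le]
      have hc' := hc.tendsto
      rw [h0] at hc'
      refine (hc'.mono_left nhdsWithin_le_nhds).congr' ?_
      filter_upwards [self_mem_nhdsWithin] with s hs
      have hs : s ≠ 0 := hs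
      rw [slope_def_field]
      field_simp
      simp only [sub_zero]
      ring
  rw [InnerProductSpace.laplacian_eq_iteratedFDeriv_orthonormalBasis f
    (Complex.orthonormalBasisOneI.map (rotation e))]
  simp [Fin.sum_univ_two, h1, h2]

/-- Polar coordinates, then |z - a| = ρe^t. The normalization of area by π leaves the factor 2 of
`edgeNorm`, and the Jacobian raises 2j to 2j + 2. -/
lemma monomialNorm_annulus (hrad : IsRadialAbout Q a) (hρ : 0 < ρ) (n j : ℕ) :
    monomialNorm Q (annulus a r ρ) a n j = ρ ^ (2 * j + 2) *
      edgeNorm (fun t => radialProfile Q a (ρ * Real.exp t)) {t | ρ * Real.exp t ∈ Icc r ρ} n j := by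
  set k := radialProfile Q a with hk
  set F : ℝ → ℝ := fun y => y ^ (2 * j) * (Icc r ρ).indicator (fun y => Real.exp (-(n * k y))) y with hF
  have h1 : ∀ z, ‖z - a‖ ^ (2 * j) * weight Q (annulus a r ρ) n z = F ‖z - a‖ := by
    intro z
    simp only [hF, weight]
    congr 1
    by_cases hz : ‖z - a‖ ∈ Icc r ρ
    · rw [indicator_of_mem hz, indicator_of_mem (show z ∈ annulus a r ρ from hz), hrad.toReal_eq]
    · rw [indicator_of_notMem hz, indicator_of_notMem (show z ∉ annulus a r ρ from hz)]
  have hJ : MeasurableSet {t | ρ * Real.exp t ∈ Icc r ρ} := measurableSet_Icc.preimage (by fun_prop)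
  have himg : (fun t => ρ * Real.exp t) '' univ = Ioi 0 := by
    ext y
    simp only [image_univ, mem_range, mem_Ioi]
    constructor
    · rintro ⟨t, rfl⟩; positivity
    · intro hy
      refine ⟨Real.log (y / ρ), ?_⟩
      rw [Real.exp_log (by positivity)]; field_simp
  have h2 : ∫ y in Ioi (0 : ℝ), y * F y =
      ∫ t, (ρ * Real.exp t) * ((ρ * Real.exp t) * F (ρ * Real.exp t)) := by
    rw [← himg, integral_image_eq_integral_abs_deriv_smul MeasurableSet.univ
      (fun t _ => (hasDerivAt_mul_exp ρ t).hasDerivWithinAt)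
      (fun s _ t _ h => Real.exp_injective (mul_left_cancel₀ hρ.ne' h)), setIntegral_univ]
    refine integral_congr_ae (Eventually.of_forall fun t => ?_)
    simp only [smul_eq_mul]
    rw [abs_of_pos (by positivity)]
  have hvol : (volume : Measure ℂ).real (Metric.ball 0 1) = Real.pi := by
    simp [Measure.real, Complex.volume_ball]
  rw [monomialNorm]
  simp_rw [h1]
  rw [dA, integral_smul_measure, integral_sub_right_eq_self (fun z => F ‖z‖) a,
    integral_fun_norm_addHaar, Complex.finrank_real_complex, hvol]
  simp only [smul_eq_mul, nsmul_eq_mul, Nat.reduceSub, pow_one, Nat.cast_ofNat]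
  have hpi : ∀ x : ℝ, Real.pi⁻¹ * (2 * (Real.pi * x)) = 2 * x := by
    intro x; field_simp
  rw [h2, ENNReal.toReal_inv, ENNReal.toReal_ofReal Real.pi_pos.le, edgeNorm, hpi,
    ← integral_indicator hJ, ← integral_const_mul, ← integral_const_mul]
  refine integral_congr_ae (Eventually.of_forall fun t => ?_)
  simp only [hF]
  by_cases ht : ρ * Real.exp t ∈ Icc r ρ
  · rw [indicator_of_mem ht, indicator_of_mem (show t ∈ {t | ρ * Real.exp t ∈ Icc r ρ} from ht)]
    have e : Real.exp (2 * (j + 1) * t - n * k (ρ * Real.exp t)) =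
        Real.exp t ^ (2 * j + 2) * Real.exp (-(n * k (ρ * Real.exp t))) := by
      rw [← Real.exp_nat_mul, ← Real.exp_add]
      congr 1; push_cast; ring
    rw [e]
    ring
  · rw [indicator_of_notMem ht, indicator_of_notMem (show t ∉ {t | ρ * Real.exp t ∈ Icc r ρ} from ht)]
    ring

end HardEdge
end

/-! ### The droplet as an edge profile, and the rescaled limit -/

noncomputable section

namespace HardEdge

variable {Q : ℂ → EReal} {S : Set ℂ} {a p u : ℂ} {r ρ C ℓ D : ℝ} {m : ℝ → ℝ}

/-- Geometry of a radially symmetric droplet with regular outer boundary. -/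
theorem exists_annulus_isEdgeProfile (hQ : IsAdmissible Q) (hS : IsDroplet Q S)
    (hSint : S ⊆ interior (finiteSet Q)) (hSconn : IsConnected S) (hrad : IsRadialAbout Q a)
    (hp : p ∈ outerBoundary S) (hu : IsOutwardUnitNormal S p u) (hpos : 0 < quarterLaplacian Q p) :
    ∃ (r ρ : ℝ) (m : ℝ → ℝ) (C ℓ : ℝ), 0 ≤ r ∧ r < ρ ∧ S = annulus a r ρ ∧ (ρ : ℂ) * u = p - a ∧
      IsEdgeProfile (fun t => radialProfile Q a (ρ * Real.exp t)) m
        {t | ρ * Real.exp t ∈ Icc r ρ} C ℓ (ρ ^ 2 * quarterLaplacian Q p) := by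
  obtain ⟨σ, hmin, hSσ⟩ := hS
  have hprob : IsProbabilityMeasure σ := hmin.1.1
  have hcomp : IsCompact S := by
    obtain ⟨K, hK, hK0⟩ := hmin.1.2
    rw [hSσ]
    exact hK.of_isClosed_subset Measure.isClosed_support
      (Measure.support_subset_of_isClosed hK.isClosed (mem_ae_iff.2 hK0))
  obtain ⟨M, hM⟩ := hcomp.isBounded.subset_closedBall a
  -- R ≥ 1 keeps log(2R) nonnegative, and the factor 2 gives ρ < R, so that Frostman's inequality is
  -- available at radii slightly larger than ρ.
  set R := max 1 (2 * M) with hRdef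
  have hR : 1 ≤ R := le_max_left _ _
  have hSR2 : S ⊆ Metric.closedBall a (R / 2) :=
    hM.trans (Metric.closedBall_subset_closedBall (by linarith [le_max_right 1 (2 * M)]))
  have hSR : S ⊆ Metric.closedBall a R :=
    hSR2.trans (Metric.closedBall_subset_closedBall (by linarith))
  have hSint' : σ.support ⊆ interior (finiteSet Q) := hSσ ▸ hSint
  have hσ : IsConfined Q a R σ := isConfined_of_support hmin hSint' (hSσ ▸ hSR)
  have hfin := mutualEnergy_self_ne_top hQ hrad hR hmin hSint' (hSσ ▸ hSR2)
  obtain ⟨κ, hκ1, hκ2⟩ := exists_frostman hQ hrad hR hmin hσ hSint' (hSσ ▸ hSR) hfin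
  have hrot : ∀ z w, ‖z - a‖ = ‖w - a‖ → z ∈ S → w ∈ S := by
    intro z w hzw hz
    obtain ⟨c, hc, rfl⟩ := exists_rotAbout_eq hzw
    rw [hSσ] at hz ⊢
    exact mem_support_of_map_rotAbout (map_rotAbout_eq hQ hrad hR hmin hσ hfin hc) hz
  obtain ⟨r, ρ, hr, hrρ, hann⟩ := exists_eq_annulus hcomp hSconn hrot
  have hlt : r < ρ := by
    obtain ⟨-, g, c, hg, -⟩ := hu
    exact lt_of_isLocalDefiningFunction (a := a) hrρ (hann ▸ hg)
  have hρ : 0 < ρ := hr.trans_lt hlt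
  have hpρ : ‖p - a‖ = ρ := norm_sub_of_mem_outerBoundary hr hrρ (hann ▸ hp)
  have hnorm : ∀ s : ℝ, 0 ≤ s → ‖a + s - a‖ = s := fun s hs => by simp [abs_of_nonneg hs]
  have hmem : ∀ s ∈ Icc r ρ, a + (s : ℂ) ∈ S := by
    intro s hs
    rw [hann, annulus, mem_ofPred_eq, hnorm s (hr.trans hs.1)]
    exact hs
  have hρR : ρ < R := by
    have := mem_closedBall_iff_norm.1 (hSR2 (hmem ρ ⟨hrρ, le_rfl⟩))
    rw [hnorm ρ hρ.le] at this
    linarith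
  have hae : ∀ᵐ w ∂σ, ‖w - a‖ ∈ Icc r ρ := by
    have : σ.supportᶜᶜ ∈ ae σ := compl_mem_ae_iff.2 Measure.measure_compl_support
    filter_upwards [this] with w hw
    rw [compl_compl, ← hSσ, hann] at hw
    exact hw
  have hpi : p ∈ interior (finiteSet Q) := by
    refine hSint ?_
    rw [hann, annulus, mem_ofPred_eq, hpρ]
    exact ⟨hrρ, le_rfl⟩
  have hlap := laplacian_eq_radialProfile hQ hrad hρ hpρ hpi
  set k := radialProfile Q a with hk
  have hDeq : (deriv (deriv k) ρ * ρ ^ 2 + deriv k ρ * ρ) / 4 = ρ ^ 2 * quarterLaplacian Q p := by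
    rw [quarterLaplacian, hlap]
    field_simp
  obtain ⟨C, ℓ, H⟩ := exists_isEdgeProfile (σ := σ) (a := a) (k := k) (κ := κ) hr hlt hρR
    (hae.mono fun w hw => hw.2) (hae.mono fun w hw => hw.1)
    (fun s hs => analyticAt_radialProfile hQ (hSint (hmem s hs)))
    (fun _ s => by rw [hk, radialProfile, radialProfile, hrad (a + s) (a + (-s : ℝ)) (by simp)])
    (by
      intro s₀ hs₀
      have hc : Continuous fun s : ℝ => a + (s : ℂ) := by fun_prop
      filter_upwards [hc.continuousAt.eventually_mem
        (isOpen_interior.mem_nhds (hSint (hmem s₀ hs₀)))] with s hs h0 hsR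
      exact hκ1 s h0 hsR hs)
    (by
      intro s hs h0
      have h1 := hκ2 (a + s) (hSσ ▸ hmem s hs) (by simpa using h0.ne')
      rwa [hnorm s h0.le] at h1)
    (by
      have : 0 < ρ ^ 2 * quarterLaplacian Q p := by positivity
      linarith)
  rw [hDeq] at H
  exact ⟨r, ρ, _, C, ℓ, hr, hlt, hann, eq_of_isOutwardUnitNormal hr hlt hpρ (hann ▸ hu), H⟩

lemma onePoint_annulus_eq_sum (hQ : IsAdmissible Q) (hrad : IsRadialAbout Q a) (hρ : 0 < ρ)
    (hSint : annulus a r ρ ⊆ interior (finiteSet Q))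
    (H : IsEdgeProfile (fun t => radialProfile Q a (ρ * Real.exp t)) m
      {t | ρ * Real.exp t ∈ Icc r ρ} C ℓ D) (n : ℕ) (ζ : ℂ) :
    onePoint (localized Q (annulus a r ρ)) n ζ = weight Q (annulus a r ρ) n ζ *
      ∑ j ∈ Finset.range n, ‖ζ - a‖ ^ (2 * j) / monomialNorm Q (annulus a r ρ) a n j := by
  have hcont : Continuous fun z : ℂ => ‖z - a‖ := by fun_prop
  refine onePoint_eq_sum ?_ ?_ hQ.lsc.measurable hQ.ne_bot ?_ hrad ?_ ?_ ζ
  · refine (isCompact_closedBall a ρ).of_isClosed_subset (isClosed_Icc.preimage hcont) fun z hz => ?_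
    exact mem_closedBall_iff_norm.2 hz.2
  · exact hQ.analytic.continuousOn.mono hSint
  · intro z hz
    have h : z ∈ finiteSet Q := interior_subset (hSint hz)
    exact (show Q z < ⊤ from h).ne
  · intro z w h hz
    rw [annulus, mem_ofPred_eq] at hz ⊢
    rwa [← h]
  · intro j
    rw [monomialNorm_annulus hrad hρ]
    exact mul_pos (by positivity) (H.edgeNorm_pos n j)

lemma onePoint_annulus (hQ : IsAdmissible Q) (hrad : IsRadialAbout Q a) (hρ : 0 < ρ)
    (hSint : annulus a r ρ ⊆ interior (finiteSet Q))
    (H : IsEdgeProfile (fun t => radialProfile Q a (ρ * Real.exp t)) m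
      {t | ρ * Real.exp t ∈ Icc r ρ} C ℓ D) (n : ℕ) {ζ : ℂ} {x : ℝ} (hx : ‖ζ - a‖ = ρ * Real.exp x)
    (hxJ : ρ * Real.exp x ∈ Icc r ρ) :
    onePoint (localized Q (annulus a r ρ)) n ζ = (ρ ^ 2)⁻¹ *
      edgeOnePoint (fun t => radialProfile Q a (ρ * Real.exp t)) {t | ρ * Real.exp t ∈ Icc r ρ} n x := by
  have hζ : ζ ∈ annulus a r ρ := by rw [annulus, mem_ofPred_eq, hx]; exact hxJ
  rw [onePoint_annulus_eq_sum hQ hrad hρ hSint H, weight, indicator_of_mem hζ, edgeOnePoint,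
    Finset.mul_sum, Finset.mul_sum]
  refine Finset.sum_congr rfl fun j _ => ?_
  rw [monomialNorm_annulus hrad hρ, hrad.toReal_eq, hx]
  have hpos := H.edgeNorm_pos n j
  have e : Real.exp (2 * j * x - n * radialProfile Q a (ρ * Real.exp x)) =
      Real.exp x ^ (2 * j) * Real.exp (-(n * radialProfile Q a (ρ * Real.exp x))) := by
    rw [← Real.exp_nat_mul, ← Real.exp_add]
    congr 1; push_cast; ring
  rw [e]
  generalize edgeNorm (fun t => radialProfile Q a (ρ * Real.exp t)) _ n j = w at hpos
  generalize Real.exp (-(n * radialProfile Q a (ρ * Real.exp x))) = y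
  field_simp
  ring

lemma onePoint_annulus_of_notMem (hQ : IsAdmissible Q) (hrad : IsRadialAbout Q a) (hρ : 0 < ρ)
    (hSint : annulus a r ρ ⊆ interior (finiteSet Q))
    (H : IsEdgeProfile (fun t => radialProfile Q a (ρ * Real.exp t)) m
      {t | ρ * Real.exp t ∈ Icc r ρ} C ℓ D) (n : ℕ) {ζ : ℂ} (hζ : ζ ∉ annulus a r ρ) :
    onePoint (localized Q (annulus a r ρ)) n ζ = 0 := by
  rw [onePoint_annulus_eq_sum hQ hrad hρ hSint H, weight, indicator_of_notMem hζ, zero_mul]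

lemma exists_onePoint_annulus_le (hQ : IsAdmissible Q) (hrad : IsRadialAbout Q a) (hρ : 0 < ρ)
    (hr : 0 ≤ r) (hSint : annulus a r ρ ⊆ interior (finiteSet Q))
    (H : IsEdgeProfile (fun t => radialProfile Q a (ρ * Real.exp t)) m
      {t | ρ * Real.exp t ∈ Icc r ρ} C ℓ D) :
    ∃ K, 0 ≤ K ∧ ∀ (n : ℕ) (ζ : ℂ), onePoint (localized Q (annulus a r ρ)) n ζ ≤ K * n := by
  obtain ⟨K, hK⟩ := H.exists_edgeOnePoint_le
  have key : ∀ (n : ℕ) (ζ : ℂ), ζ ≠ a → onePoint (localized Q (annulus a r ρ)) n ζ ≤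
      (ρ ^ 2)⁻¹ * |K| * n := by
    intro n ζ hζa
    by_cases hζ : ζ ∈ annulus a r ρ
    · have h0 : 0 < ‖ζ - a‖ := norm_pos_iff.2 (sub_ne_zero.2 hζa)
      have hx : ‖ζ - a‖ = ρ * Real.exp (Real.log (‖ζ - a‖ / ρ)) := by
        rw [Real.exp_log (by positivity)]; field_simp
      have hxJ : ρ * Real.exp (Real.log (‖ζ - a‖ / ρ)) ∈ Icc r ρ := by rw [← hx]; exact hζ
      rw [onePoint_annulus hQ hrad hρ hSint H n hx hxJ, mul_assoc]
      gcongr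
      exact (hK n _ hxJ).trans (by gcongr; exact le_abs_self K)
    · rw [onePoint_annulus_of_notMem hQ hrad hρ hSint H n hζ]
      positivity
  refine ⟨(ρ ^ 2)⁻¹ * |K|, by positivity, fun n ζ => ?_⟩
  -- The centre has no logarithmic coordinate. If it lies in the droplet, which is then a disc, the
  -- bound there follows from continuity along a ray.
  rcases eq_or_ne ζ a with rfl | hζ
  swap
  · exact key n ζ hζ
  by_cases hmem : ζ ∈ annulus ζ r ρ
  swap
  · rw [onePoint_annulus_of_notMem hQ hrad hρ hSint H n hmem]
    positivity
  have hr0 : r = 0 := le_antisymm (by simpa using hmem.1) hr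
  set G : ℝ → ℝ := fun s => Real.exp (-(n * radialProfile Q ζ s)) *
    ∑ j ∈ Finset.range n, s ^ (2 * j) / monomialNorm Q (annulus ζ r ρ) ζ n j with hG
  have hGeq : ∀ s ∈ Icc 0 ρ, onePoint (localized Q (annulus ζ r ρ)) n (ζ + s) = G s := by
    intro s hs
    have hns : ‖ζ + s - ζ‖ = s := by simp [abs_of_nonneg hs.1]
    have hs' : ζ + (s : ℂ) ∈ annulus ζ r ρ := by
      rw [annulus, mem_ofPred_eq, hns, hr0]; exact hs
    rw [onePoint_annulus_eq_sum hQ hrad hρ hSint H, weight, indicator_of_mem hs', hrad.toReal_eq, hns]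
  have hGc : ContinuousAt G 0 := by
    have hk : ContinuousAt (radialProfile Q ζ) 0 :=
      (analyticAt_radialProfile hQ (by simpa using hSint hmem)).continuousAt
    simp only [hG]
    fun_prop
  have h0 := hGeq 0 ⟨le_rfl, hρ.le⟩
  rw [Complex.ofReal_zero, add_zero] at h0
  rw [h0]
  refine le_of_tendsto (hGc.tendsto.mono_left nhdsWithin_le_nhds : Tendsto G (𝓝[>] 0) _) ?_
  filter_upwards [Ioc_mem_nhdsGT hρ] with s hs
  rw [← hGeq s ⟨hs.1.le, hs.2⟩]
  exact key n _ (by simpa using hs.1.ne')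

/-- Convergence jointly in index and point already forces the limit to be continuous on s, and is
then locally uniform. -/
lemma tendstoLocallyUniformlyOn_of_tendsto_prod {F : ℕ → ℂ → ℝ} {f : ℂ → ℝ} {s : Set ℂ}
    (h : ∀ z ∈ s, Tendsto (fun y : ℕ × ℂ => F y.1 y.2) (atTop ×ˢ 𝓝 z) (𝓝 (f z))) :
    TendstoLocallyUniformlyOn F f atTop s := by
  rw [tendstoLocallyUniformlyOn_iff_forall_tendsto]
  intro z hz
  have hpt : ∀ y ∈ s, Tendsto (fun n => F n y) atTop (𝓝 (f y)) := fun y hy =>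
    (h y hy).comp (tendsto_id.prodMk tendsto_const_nhds)
  have hf : Tendsto f (𝓝[s] z) (𝓝 (f z)) := by
    rw [Metric.nhds_basis_closedBall.tendsto_right_iff]
    intro ε hε
    obtain ⟨A, hA, B, hB, hAB⟩ := eventually_prod_iff.1
      ((h z hz).eventually (Metric.closedBall_mem_nhds _ hε))
    filter_upwards [self_mem_nhdsWithin, nhdsWithin_le_nhds hB] with y hys hy
    refine Metric.isClosed_closedBall.mem_of_tendsto (hpt y hys) ?_
    filter_upwards [hA] with n hn
    exact hAB hn hy
  have h1 : Tendsto (fun y : ℕ × ℂ => f y.2) (atTop ×ˢ 𝓝[s] z) (𝓝 (f z)) := hf.comp tendsto_snd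
  have h2 : Tendsto (fun y : ℕ × ℂ => F y.1 y.2) (atTop ×ˢ 𝓝[s] z) (𝓝 (f z)) :=
    (h z hz).mono_left (prod_mono le_rfl nhdsWithin_le_nhds)
  exact (h1.prodMk_nhds h2).mono_right (nhds_le_uniformity (f z))

/-- log|1 + w| is the real part of log(1 + w), whose derivative at w = 0 is 1; so only Re z
survives, and circles about `a` flatten to vertical lines. -/
lemma tendsto_sqrt_mul_log_norm {ι : Type*} {F : Filter ι} {N : ι → ℕ} {z : ι → ℂ} {z₀ : ℂ} {c : ℝ}
    (hc : 0 < c) (hN : Tendsto N F atTop) (hz : Tendsto z F (𝓝 z₀)) :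
    Tendsto (fun i => √(N i : ℝ) * Real.log ‖1 + z i / ((c * √(N i : ℝ) : ℝ) : ℂ)‖) F
      (𝓝 (z₀.re / c)) := by
  have hs := IsEdgeProfile.tendsto_sqrt_natCast hN
  have hd : HasFDerivAt Complex.log ((ContinuousLinearMap.toSpanSingleton ℂ (1 : ℂ))) 1 := by
    simpa using (Complex.hasStrictDerivAt_log (x := 1) (by simp)).hasDerivAt.hasFDerivAt
  have hmul : Tendsto (fun i => ((√(N i : ℝ) : ℝ) : ℂ) • (z i / ((c * √(N i : ℝ) : ℝ) : ℂ))) F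
      (𝓝 (z₀ / c)) := by
    refine (hz.div_const (c : ℂ)).congr' ?_
    filter_upwards [hN.eventually_ge_atTop 1] with i hi
    have h1 : 0 < √(N i : ℝ) := Real.sqrt_pos.2 (by exact_mod_cast hi)
    have h2 : ((√(N i : ℝ) : ℝ) : ℂ) ≠ 0 := by exact_mod_cast h1.ne'
    have h3 : (c : ℂ) ≠ 0 := by exact_mod_cast hc.ne'
    rw [smul_eq_mul]
    push_cast
    field_simp
  have hzero : Tendsto (fun i => z i / ((c * √(N i : ℝ) : ℝ) : ℂ)) F (𝓝 0) := by
    have h1 : Tendsto (fun i => (c * √(N i : ℝ))⁻¹) F (𝓝 0) :=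
      tendsto_inv_atTop_zero.comp (hs.const_mul_atTop hc)
    have h2 := hz.mul ((Complex.continuous_ofReal.tendsto 0).comp h1)
    rw [Complex.ofReal_zero, mul_zero] at h2
    refine h2.congr fun i => ?_
    simp only [Function.comp_apply, Complex.ofReal_inv, div_eq_mul_inv]
  have hlim := (hasFDerivWithinAt_univ.2 hd).lim hzero (Eventually.of_forall fun _ => mem_univ _) hmul
  have hre := (Complex.continuous_re.tendsto _).comp hlim
  simp only [ContinuousLinearMap.toSpanSingleton_apply, smul_eq_mul, mul_one, Complex.div_ofReal_re] at hre
  refine hre.congr fun i => ?_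
  simp [Complex.log_re]

/-- Convergence of the rescaled one-point functions, jointly in the index and the point. -/
theorem tendsto_rescaledOnePoint (hQ : IsAdmissible Q) (hrad : IsRadialAbout Q a) (hr : 0 ≤ r)
    (hrρ : r < ρ) (hSint : annulus a r ρ ⊆ interior (finiteSet Q)) (hu1 : ‖u‖ = 1)
    (hu : (ρ : ℂ) * u = p - a) (hpos : 0 < quarterLaplacian Q p)
    (H : IsEdgeProfile (fun t => radialProfile Q a (ρ * Real.exp t)) m
      {t | ρ * Real.exp t ∈ Icc r ρ} C ℓ (ρ ^ 2 * quarterLaplacian Q p)) {z₀ : ℂ} (hz₀ : z₀.re ≠ 0) :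
    Tendsto (fun y : ℕ × ℂ => rescaledOnePoint Q (annulus a r ρ) p u y.1 y.2) (atTop ×ˢ 𝓝 z₀)
      (𝓝 (limitOnePoint z₀)) := by
  have hρ : 0 < ρ := hr.trans_lt hrρ
  have hρc : (ρ : ℂ) ≠ 0 := by exact_mod_cast hρ.ne'
  set Δ := quarterLaplacian Q p with hΔ
  set c := ρ * √Δ with hc
  have hc0 : 0 < c := by positivity
  have hcD : √(ρ ^ 2 * Δ) = c := by rw [Real.sqrt_mul (sq_nonneg ρ), Real.sqrt_sq hρ.le]
  have hN : Tendsto (fun y : ℕ × ℂ => y.1) (atTop ×ˢ 𝓝 z₀) atTop := tendsto_fst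
  have hz : Tendsto (fun y : ℕ × ℂ => y.2) (atTop ×ˢ 𝓝 z₀) (𝓝 z₀) := tendsto_snd
  set x : ℕ × ℂ → ℝ := fun y => Real.log ‖1 + y.2 / ((c * √(y.1 : ℝ) : ℝ) : ℂ)‖ with hx
  have hxlim : Tendsto (fun y : ℕ × ℂ => √(y.1 : ℝ) * x y) (atTop ×ˢ 𝓝 z₀) (𝓝 (z₀.re / c)) :=
    tendsto_sqrt_mul_log_norm hc0 hN hz
  have hx0 := IsEdgeProfile.tendsto_zero_of_sqrt_mul hN hxlim
  set ζ : ℕ × ℂ → ℂ := fun y => p + u * (y.2 / (√(y.1 * Δ) : ℂ)) with hζ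
  have hζn : ∀ y, ‖ζ y - a‖ = ρ * ‖1 + y.2 / ((c * √(y.1 : ℝ) : ℝ) : ℂ)‖ := by
    intro y
    have : ζ y - a = u * (ρ * (1 + y.2 / ((c * √(y.1 : ℝ) : ℝ) : ℂ))) := by
      rw [hζ, hc]
      simp only
      rw [Real.sqrt_mul (Nat.cast_nonneg _), add_sub_right_comm, ← hu]
      push_cast
      rcases Nat.eq_zero_or_pos y.1 with h | h
      · simp [h, mul_comm]
      · have h1 : ((√(y.1 : ℝ) : ℝ) : ℂ) ≠ 0 := by
          exact_mod_cast (Real.sqrt_pos.2 (by exact_mod_cast h)).ne'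
        have h2 : ((√Δ : ℝ) : ℂ) ≠ 0 := by exact_mod_cast (Real.sqrt_pos.2 hpos).ne'
        field_simp
    rw [this, norm_mul, hu1, one_mul, norm_mul, Complex.norm_real, Real.norm_of_nonneg hρ.le]
  -- The convention `Real.log 0 = 0` means that x y ≠ 0 already excludes a vanishing norm.
  have hlogne : ∀ y, x y ≠ 0 → ‖ζ y - a‖ = ρ * Real.exp (x y) := by
    intro y hy
    rw [hζn, hx]
    simp only
    rw [Real.exp_log]
    refine (norm_nonneg _).lt_of_ne' fun h => hy ?_
    simp only [hx, h, Real.log_zero]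
  rcases lt_or_gt_of_ne hz₀ with hneg | hposz
  · have hξ : z₀.re / c < 0 := div_neg_of_neg_of_pos hneg hc0
    have hxneg : ∀ᶠ y in atTop ×ˢ 𝓝 z₀, x y < 0 := by
      filter_upwards [hxlim.eventually (gt_mem_nhds hξ)] with y hy
      by_contra hcon
      exact absurd hy (not_lt.2 (mul_nonneg (Real.sqrt_nonneg _) (not_lt.1 hcon)))
    have hxJ : ∀ᶠ y in atTop ×ˢ 𝓝 z₀, x y ∈ {t | ρ * Real.exp t ∈ Icc r ρ} := by
      filter_upwards [hxneg, hx0.eventually (lt_mem_nhds (neg_lt_zero.2 H.ell_pos))] with y h1 h2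
      exact H.Icc_subset ⟨h2.le, h1.le⟩
    have hlim := (H.tendsto_edgeOnePoint hN hxJ hξ hxlim).const_mul (ρ ^ 2 * Δ)⁻¹
    -- Here √D = c cancels the scale of the logarithmic coordinate, leaving the argument 2 Re z₀ =
    -- z₀ + z̄₀.
    have hval : (ρ ^ 2 * Δ)⁻¹ * (ρ ^ 2 * Δ * plasma (2 * √(ρ ^ 2 * Δ) * (z₀.re / c))) =
        limitOnePoint z₀ := by
      rw [inv_mul_cancel_left₀ (by positivity), hcD, limitOnePoint,
        indicator_of_mem (show z₀ ∈ {w : ℂ | w.re < 0} from hneg)]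
      simp only [Pi.one_apply, mul_one]
      congr 1
      rw [Complex.add_re, Complex.conj_re]
      field_simp
      ring
    rw [hval] at hlim
    refine hlim.congr' ?_
    filter_upwards [hxneg, hxJ] with y h1 h2
    rw [rescaledOnePoint, onePoint_annulus hQ hrad hρ hSint H y.1 (hlogne y h1.ne) h2, ← hΔ]
    rw [mul_inv, mul_inv]
    ring
  · have hξ : 0 < z₀.re / c := div_pos hposz hc0
    have hlimz : limitOnePoint z₀ = 0 := by
      rw [limitOnePoint, indicator_of_notMem (show z₀ ∉ {w : ℂ | w.re < 0} from not_lt.2 hposz.le),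
        mul_zero]
    rw [hlimz]
    refine tendsto_const_nhds.congr' ?_
    filter_upwards [hxlim.eventually (lt_mem_nhds hξ)] with y hy
    have hxpos : 0 < x y := (pos_iff_pos_of_mul_pos hy).1 (by
      refine (Real.sqrt_nonneg _).lt_of_ne fun h => ?_
      rw [← h, zero_mul] at hy
      exact hy.false)
    rw [rescaledOnePoint, onePoint_annulus_of_notMem hQ hrad hρ hSint H, mul_zero]
    intro hmem
    have h1 : ‖ζ y - a‖ ≤ ρ := hmem.2
    rw [hlogne y hxpos.ne'] at h1
    have h2 := Real.one_lt_exp_iff.2 hxpos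
    nlinarith

end HardEdge
end

namespace HardEdge

lemma ae_re_ne_zero : ∀ᵐ z : ℂ, z.re ≠ 0 := by
  have h := Measure.addHaar_submodule (volume : Measure ℂ) (LinearMap.ker Complex.reLm) (by
    intro h
    have : (1 : ℂ) ∈ LinearMap.ker Complex.reLm := h ▸ Submodule.mem_top
    simp at this)
  rw [ae_iff]
  refine measure_mono_null (fun z hz => ?_) h
  simpa using hz

end HardEdge

theorem mainTheorem1 (Q : ℂ → EReal) (S : Set ℂ) (a p u : ℂ)
    (hQ : HardEdge.IsAdmissible Q)
    (hS : HardEdge.IsDroplet Q S)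
    (hSint : S ⊆ interior (HardEdge.finiteSet Q))
    (hSconn : IsConnected S)
    (hreg : ∀ q ∈ HardEdge.outerBoundary S, HardEdge.IsRegularPoint S q)
    (hrad : HardEdge.IsRadialAbout Q a)
    (hp : p ∈ HardEdge.outerBoundary S)
    (hu : HardEdge.IsOutwardUnitNormal S p u)
    (hpos : 0 < HardEdge.quarterLaplacian Q p) :
    (∃ C : ℝ, ∀ (n : ℕ) (z : ℂ), |HardEdge.rescaledOnePoint Q S p u n z| ≤ C) ∧
    (∀ᵐ z : ℂ, Tendsto (fun n : ℕ => HardEdge.rescaledOnePoint Q S p u n z) atTop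
      (𝓝 (HardEdge.limitOnePoint z))) ∧
    TendstoLocallyUniformlyOn (fun n : ℕ => HardEdge.rescaledOnePoint Q S p u n)
      HardEdge.limitOnePoint atTop {z : ℂ | z.re ≠ 0} := by
  obtain ⟨r, ρ, m, C, ℓ, hr, hrρ, rfl, hρu, H⟩ :=
    HardEdge.exists_annulus_isEdgeProfile hQ hS hSint hSconn hrad hp hu hpos
  have hρ : 0 < ρ := hr.trans_lt hrρ
  have hlim : ∀ z ∈ {z : ℂ | z.re ≠ 0}, Tendsto
      (fun y : ℕ × ℂ => HardEdge.rescaledOnePoint Q (HardEdge.annulus a r ρ) p u y.1 y.2)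
      (atTop ×ˢ 𝓝 z) (𝓝 (HardEdge.limitOnePoint z)) := fun z hz =>
    HardEdge.tendsto_rescaledOnePoint hQ hrad hr hrρ hSint hu.1 hρu hpos H hz
  have hloc := HardEdge.tendstoLocallyUniformlyOn_of_tendsto_prod hlim
  refine ⟨?_, ?_, hloc⟩
  · obtain ⟨K, hK, hb⟩ := HardEdge.exists_onePoint_annulus_le hQ hrad hρ hr hSint H
    refine ⟨K / HardEdge.quarterLaplacian Q p, fun n z => ?_⟩
    have h0 : 0 ≤ HardEdge.rescaledOnePoint Q (HardEdge.annulus a r ρ) p u n z := by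
      refine mul_nonneg (by positivity) ?_
      cases n with
      | zero => exact le_rfl
      | succ n => exact ENNReal.toReal_nonneg
    rw [abs_of_nonneg h0, HardEdge.rescaledOnePoint]
    rcases Nat.eq_zero_or_pos n with rfl | hn
    -- For n = 0 the prefactor is 0⁻¹ = 0.
    · simp only [Nat.cast_zero, zero_mul, inv_zero]
      positivity
    · have hn' : (0 : ℝ) < n := by exact_mod_cast hn
      rw [inv_mul_le_iff₀ (by positivity)]
      refine (hb n _).trans (le_of_eq ?_)
      field_simp
  · filter_upwards [HardEdge.ae_re_ne_zero] with z hz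
    exact hloc.tendsto_at hz
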